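/- An instance of \textsc{Job Interval Selection} consists of an interval graph $G$ on $n\ge 1$ vertices, a coloring $\mathrm{col}\colon V(G)\to\{1,\dots,\gamma\}$ and a natural number $k$; the question is whether $G$ has an independent set of exactly $k$ vertices of pairwise distinct colors. The graph is given by a $c$-compact interval representation for the minimum possible $c$, that is, every vertex $v$ is represented by an interval $[v_s,v_e]$ with integers $1\le v_s\le v_e\le c$, the intervals are sorted by increasing start points, two distinct vertices are adjacent if and only if their intervals intersect, and no representation of $G$ of this kind with a smaller $c$ exists. Let $\ell=\max_v (v_e-v_s)$ be the length of a longest interval. The machine model is the word RAM with read-only input, working memory that is initially zero, unit-cost instructions (addition, subtraction, multiplication, division and remainder on $w$-bit words, direct and indirect memory access, comparison and jumps) and, for randomized algorithms, a unit-cost instruction that draws a uniformly random element of $\{0,\dots,m-1\}$ for a given word $m$. Space is the number of words of the working memory. **Theorem.** (i) There are a randomized algorithm and a constant $K$ such that the following holds for every instance with $n\ge1$, every real $0<\varepsilon<1$, given to the algorithm as the integer $\lceil 1/\varepsilon\rceil$, and every word length $w\ge K\cdot\bigl(k+\lceil\log_2(n+\gamma+\lceil 1/\varepsilon\rceil+1)\rceil\bigr)$.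 Whatever the outcomes of its random choices, the algorithm halts within $K\cdot 5.5^k\cdot\max\{1,|\ln\varepsilon|\}\cdot n$ steps and uses at most $K\cdot 2^k\cdot(\ell+1)$ words of working memory. It never accepts a no-instance, and it accepts every yes-instance with probability at least $1-\varepsilon$. (ii) There are a deterministic algorithm and a constant $K$ such that, for every instance with $n\ge1$ and every word length $w\ge K\cdot\bigl(k+\lceil\log_2(n+\gamma+1)\rceil\bigr)$, the algorithm halts within $K\cdot 12.8^k\cdot\gamma\cdot n$ steps and accepts if and only if the instance is a yes-instance. In short: \textsc{Job Interval Selection} can be solved with one-sided error probability $\varepsilon$ in $O(5.5^k\cdot|\ln\varepsilon|\cdot n)$ time and $O(2^k\cdot\ell)$ space, and deterministically in $O(12.8^k\cdot\gamma n)$ time. -/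

import Mathlib

/-! ## Compact interval representations and Job Interval Selection -/

/-- A `c`-compact interval representation of an `n`-vertex graph: the vertex `v` is represented by
the closed interval `[first v, last v]` with integer end points in `{1, …, c}`, and the intervals
are sorted by increasing start points. -/
structure CompactRep (n c : ℕ) where
  first : Fin n → ℕ
  last : Fin n → ℕ
  one_le_first : ∀ v, 1 ≤ first v
  first_le_last : ∀ v, first v ≤ last v
  last_le : ∀ v, last v ≤ c
  sorted : Monotone first

namespace CompactRep

/-- The interval graph of the representation. (Intervals with integer end points share a real point
if and only if they share an integer point.) -/
def graph {n c : ℕ} (R : CompactRep n c) : SimpleGraph (Fin n) where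
  Adj u v := u ≠ v ∧
    (Set.Icc (R.first u) (R.last u) ∩ Set.Icc (R.first v) (R.last v)).Nonempty
  symm := ⟨fun _ _ h => ⟨h.1.symm, by rw [Set.inter_comm]; exact h.2⟩⟩
  loopless := ⟨fun _ h => h.1 rfl⟩

/-- The length `ℓ` of a longest interval of the representation. -/
def maxLength {n c : ℕ} (R : CompactRep n c) : ℕ :=
  Finset.univ.sup fun v => R.last v - R.first v

end CompactRep

/-- A graph is `c`-compact if it admits a `c`-compact interval representation
(the isomorphism takes care of the sorting of the vertices). -/
def IsCompactGraph {n : ℕ} (G : SimpleGraph (Fin n)) (c : ℕ) : Prop :=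
  ∃ R : CompactRep n c, Nonempty (R.graph ≃g G)

/-- An instance of Job Interval Selection: an interval graph on `n` vertices, given by a
`c`-compact representation for minimum `c`, a coloring of its vertices with `γ` colors, and a
natural number `k`. -/
structure JobIntervalSelection where
  n : ℕ
  γ : ℕ
  k : ℕ
  c : ℕ
  rep : CompactRep n c
  c_minimum : ∀ c', IsCompactGraph rep.graph c' → c ≤ c'
  col : Fin n → Fin γ

namespace JobIntervalSelection

/-- The instance is a yes-instance: there is a colorful independent set of size `k`. -/
def IsYes (I : JobIntervalSelection) : Prop :=
  ∃ S : Finset (Fin I.n), S.card = I.k ∧ I.rep.graph.IsIndepSet (S : Set (Fin I.n)) ∧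
    Set.InjOn I.col (S : Set (Fin I.n))

/-- The instance as a sequence of numbers: `n, γ, k`, and then start point, end point and color
(a number in `{1, …, γ}`) of each interval, in the order of the representation. -/
def encode (I : JobIntervalSelection) : List ℕ :=
  [I.n, I.γ, I.k] ++
    (List.finRange I.n).flatMap fun v => [I.rep.first v, I.rep.last v, (I.col v : ℕ) + 1]

end JobIntervalSelection

/-! ## A randomized word RAM

The machine has a read-only input, a random access working memory of `w`-bit words that are
initially `0`, and unit-cost instructions. Arithmetic is modulo `2 ^ w`. -/

namespace WordRAM

/-- The binary arithmetic operations. -/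
inductive ArithOp
  | add | sub | mul | div | mod

/-- Wrap-around arithmetic on `w`-bit words. -/
def ArithOp.eval (w : ℕ) : ArithOp → ℕ → ℕ → ℕ
  | .add, x, y => (x + y) % 2 ^ w
  | .sub, x, y => (x + (2 ^ w - y)) % 2 ^ w
  | .mul, x, y => (x * y) % 2 ^ w
  | .div, x, y => x / y
  | .mod, x, y => x % y

/-- The instructions; `M` is the working memory and `X` the input.
* `const d v`: `M[d] := v`
* `arith o d a b`: `M[d] := M[a] o M[b]`
* `load d a`: `M[d] := M[M[a]]`
* `store d a`: `M[M[d]] := M[a]`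
* `input d a`: `M[d] := X[M[a]]`
* `rand d a`: `M[d] :=` a uniformly random number in `{0, …, M[a] - 1}` (and `0` if `M[a] = 0`)
* `jump l`: go to instruction `l`
* `jumpLt a b l`: go to instruction `l` if `M[a] < M[b]`
* `accept`, `reject`: halt with this answer -/
inductive Instr
  | const (d v : ℕ)
  | arith (o : ArithOp) (d a b : ℕ)
  | load (d a : ℕ)
  | store (d a : ℕ)
  | input (d a : ℕ)
  | rand (d a : ℕ)
  | jump (l : ℕ)
  | jumpLt (a b l : ℕ)
  | accept
  | reject

/-- A program is a finite list of instructions. -/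
abbrev Program := List Instr

/-- A program is deterministic if it has no random instruction. -/
def Program.IsDeterministic (P : Program) : Prop :=
  ∀ d a : ℕ, Instr.rand d a ∉ P

inductive Status
  | running | accepted | rejected

/-- A configuration: status, program counter and working memory. -/
structure Config where
  status : Status
  pc : ℕ
  mem : ℕ → ℕ

/-- The initial configuration. -/
def init : Config := ⟨.running, 0, fun _ => 0⟩

/-- Write the value `v` to the memory cell `d` and go to the next instruction. -/
def Config.write (σ : Config) (d v : ℕ) : Config :=
  { σ with pc := σ.pc + 1, mem := Function.update σ.mem d v }

/-- The effect of an instruction; `r` is the random number that `rand` stores. -/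
def exec (w : ℕ) (x : List ℕ) (σ : Config) (r : ℕ) : Instr → Config
  | .const d v => σ.write d (v % 2 ^ w)
  | .arith o d a b => σ.write d (o.eval w (σ.mem a) (σ.mem b))
  | .load d a => σ.write d (σ.mem (σ.mem a))
  | .store d a => σ.write (σ.mem d) (σ.mem a)
  | .input d a => σ.write d (x.getD (σ.mem a) 0 % 2 ^ w)
  | .rand d _ => σ.write d r
  | .jump l => { σ with pc := l }
  | .jumpLt a b l => { σ with pc := if σ.mem a < σ.mem b then l else σ.pc + 1 }
  | .accept => { σ with status := .accepted }
  | .reject => { σ with status := .rejected }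

/-- The memory cells that an instruction reads or writes. -/
def cells (σ : Config) : Instr → List ℕ
  | .const d _ => [d]
  | .arith _ d a b => [d, a, b]
  | .load d a => [d, a, σ.mem a]
  | .store d a => [d, a, σ.mem d]
  | .input d a => [d, a]
  | .rand d a => [d, a]
  | .jump _ => []
  | .jumpLt a b _ => [a, b]
  | .accept => []
  | .reject => []

/-- The uniform distribution on `{0, …, m - 1}` (the point mass at `0` if `m = 0`). -/
noncomputable def uniformBelow (m : ℕ) : PMF ℕ :=
  (PMF.uniformOfFintype (Fin (m - 1 + 1))).map fun r => (r : ℕ)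

/-- One step of the program `P` with word length `w` on the input `x`. A halted configuration stays
as it is; running off the program rejects. -/
noncomputable def step (P : Program) (w : ℕ) (x : List ℕ) (σ : Config) : PMF Config :=
  match σ.status with
  | .accepted => PMF.pure σ
  | .rejected => PMF.pure σ
  | .running =>
    match P[σ.pc]? with
    | none => PMF.pure { σ with status := .rejected }
    | some (.rand d a) =>
        (uniformBelow (σ.mem a)).map fun r => exec w x σ r (.rand d a)
    | some i => PMF.pure (exec w x σ 0 i)

/-- The distribution of the configuration after `t` steps. -/
noncomputable def run (P : Program) (w : ℕ) (x : List ℕ) : ℕ → PMF Config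
  | 0 => PMF.pure init
  | t + 1 => (run P w x t).bind (step P w x)

/-- Whatever the random numbers are, the program halts within `t` steps. -/
def HaltsWithin (P : Program) (w : ℕ) (x : List ℕ) (t : ℕ) : Prop :=
  ∀ σ ∈ (run P w x t).support, σ.status ≠ .running

/-- Whatever the random numbers are, the program reads and writes only the first `s` cells of the
working memory. -/
def SpaceWithin (P : Program) (w : ℕ) (x : List ℕ) (s : ℕ) : Prop :=
  ∀ t, ∀ σ ∈ (run P w x t).support, σ.status = .running →
    ∀ i, P[σ.pc]? = some i → ∀ a ∈ cells σ i, a < s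

/-- The probability that the program has accepted after `t` steps. -/
noncomputable def acceptProb (P : Program) (w : ℕ) (x : List ℕ) (t : ℕ) : ENNReal :=
  (run P w x t).toOuterMeasure {σ | σ.status = .accepted}

end WordRAM

/-! ## Reasoning about runs of the word RAM -/

/-! Both algorithms treat the intervals in decreasing order of their start points and rest on one
remark (`isYes_iff`, `chain_cases`): an independent set is a chain, in which every interval ends
before the later ones start, and among the intervals treated so far the latest one can occur in a
chain only as its first element. Minimality of `c` enters only through `c ≤ n`, which bounds all end
points by `n`.

Randomized algorithm: color coding. The colors receive labels below `k`; for every set `m` of labels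
a table stores the largest start point of a chain whose labels are distinct and form `m`. Prepending
an interval (`reach_step`) is an in-place update of `2 ^ k` entries (`tableStep_spec`). Since the
space may not depend on `γ`, labels are not stored per color: a random multiplier hashes the colors
to `32 * 2 ^ k` cells, separating the `k` colors of a solution with probability at least 1/2
(`card_injOn_hashIdx`), and the cells get random labels, which are distinct on `k` given cells with
probability `k! / k ^ k`, at least `e ^ (-k)`. As `e < 11/4`, on the order of `(11/4) ^ k` trials
times the bit length of `⌈1/ε⌉` suffice (`pow_numTrials_le`), and a trial costs `O(2 ^ k * n)`; `2 *
11/4 = 5.5`. Equal colors always get equal labels, so no-instances are never accepted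
(`reach_full`).

Deterministic algorithm: exterior algebra. Over a prime field with more elements than occurring
colors, the color numbered `c` becomes the vector `(1, c, …, c ^ (k-1))`. A product of such vectors
has a nonzero top coordinate exactly if there are `k` of them with distinct numbers (Vandermonde;
`prod_powers_ne_zero`, `prod_powers_ne_zero_iff`). Instead of all chains, the algorithm keeps an
echelon basis of the span of their products, at most `2 ^ k` rows. Each row is tagged with the start
point of the interval that created it; because tags never increase in the course of the algorithm,
the rows with tag above `e` span the products of all chains that start after `e`, for all `e` at
once (`addIntervals_spec`). The row with pivot at the full mask exists if and only if there is a
solution (`start_full_pos_iff`). Multiplying and eliminating costs `O(8 ^ k)` per interval, and the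
factor `γ` pays for the search for the prime.

Both programs are verified with a weakest precondition calculus (`WP`) whose postconditions also
carry the remaining time and a lower bound on the acceptance probability. The calculus is justified
by the certificate `Good`, whose soundness (`Good.sound`) gives termination, space, one-sidedness
and acceptance probability together. -/

namespace WordRAM

/-- The distribution of the configuration reached from `σ` after `t` steps. -/
noncomputable def runFrom (P : Program) (w : ℕ) (x : List ℕ) : Config → ℕ → PMF Config
  | σ, 0 => PMF.pure σ
  | σ, t + 1 => (step P w x σ).bind fun σ' => runFrom P w x σ' t

theorem runFrom_succ' (P : Program) (w : ℕ) (x : List ℕ) (σ : Config) (t : ℕ) :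
    runFrom P w x σ (t + 1) = (runFrom P w x σ t).bind (step P w x) := by
  induction t generalizing σ with
  | zero => simp [runFrom, PMF.pure_bind]
  | succ t ih =>
    rw [runFrom, funext fun σ' => ih σ', ← PMF.bind_bind]
    rfl

theorem run_eq_runFrom (P : Program) (w : ℕ) (x : List ℕ) (t : ℕ) :
    run P w x t = runFrom P w x init t := by
  induction t with
  | zero => rfl
  | succ t ih => rw [runFrom_succ', run, ih]

theorem runFrom_halted (P : Program) (w : ℕ) (x : List ℕ) (σ : Config) (h : σ.status ≠ .running)
    (t : ℕ) : runFrom P w x σ t = PMF.pure σ := by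
  have hs : step P w x σ = PMF.pure σ := by
    unfold step
    rcases hσ : σ.status with _ | _ | _ <;> simp_all
  induction t with
  | zero => rfl
  | succ t ih => rw [runFrom, hs, PMF.pure_bind, ih]

/-- The data that a run depends on apart from the program, a set `A` of memory cells that the
program may use, and a condition `Y` that has to hold if the program accepts. -/
structure Env where
  w : ℕ
  x : List ℕ
  A : ℕ → Prop
  Y : Prop
  temp : ∀ a < 8, A a

/-- From the configuration `σ`, the program halts within `t` steps, uses only cells in `A`,
accepts only if `Y` holds, and accepts with probability at least `p`. -/
inductive Good (Γ : Env) (P : Program) : ℕ → Config → ℝ → Prop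
  | accepted (t : ℕ) (σ : Config) (p : ℝ) (h : σ.status = .accepted) (hY : Γ.Y) (hp : p ≤ 1) :
      Good Γ P t σ p
  | rejected (t : ℕ) (σ : Config) (p : ℝ) (h : σ.status = .rejected) (hp : p ≤ 0) :
      Good Γ P t σ p
  | step (t : ℕ) (σ : Config) (p : ℝ) (i : Instr) (h : σ.status = .running)
      (hi : P[σ.pc]? = some i) (hr : ∀ d a, i ≠ .rand d a) (hc : ∀ a ∈ cells σ i, Γ.A a)
      (hg : Good Γ P t (exec Γ.w Γ.x σ 0 i) p) : Good Γ P (t + 1) σ p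
  | rand (t : ℕ) (σ : Config) (p : ℝ) (d a : ℕ) (f : ℕ → ℝ) (h : σ.status = .running)
      (hi : P[σ.pc]? = some (.rand d a)) (hc : ∀ b ∈ cells σ (.rand d a), Γ.A b)
      (hm : 0 < σ.mem a)
      (hg : ∀ r < σ.mem a, Good Γ P t (exec Γ.w Γ.x σ r (.rand d a)) (f r))
      (hp : p * σ.mem a ≤ ∑ r ∈ Finset.range (σ.mem a), f r) : Good Γ P (t + 1) σ p

namespace Good

variable {Γ : Env} {P : Program}

theorem mono {t : ℕ} {σ : Config} {p : ℝ} (h : Good Γ P t σ p) :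
    ∀ {t' : ℕ}, t ≤ t' → Good Γ P t' σ p := by
  induction h with
  | accepted t σ p h hY hp => exact fun _ => .accepted _ _ _ h hY hp
  | rejected t σ p h hp => exact fun _ => .rejected _ _ _ h hp
  | step t σ p i h hi hr hc hg ih =>
    intro t' ht
    obtain ⟨s, rfl⟩ : ∃ s, t' = s + 1 := ⟨t' - 1, by omega⟩
    exact .step _ _ _ i h hi hr hc (ih (by omega))
  | rand t σ p d a f h hi hc hm hg hp ih =>
    intro t' ht
    obtain ⟨s, rfl⟩ : ∃ s, t' = s + 1 := ⟨t' - 1, by omega⟩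
    exact .rand _ _ _ d a f h hi hc hm (fun r hr => ih r hr (by omega)) hp

theorem step_to {t pc pc' : ℕ} {μ μ' : ℕ → ℕ} {p : ℝ} {i : Instr} (hi : P[pc]? = some i)
    (hr : ∀ d a, i ≠ .rand d a) (hc : ∀ a ∈ cells ⟨.running, pc, μ⟩ i, Γ.A a)
    (he : exec Γ.w Γ.x ⟨.running, pc, μ⟩ 0 i = ⟨.running, pc', μ'⟩)
    (hg : Good Γ P t ⟨.running, pc', μ'⟩ p) : Good Γ P (t + 1) ⟨.running, pc, μ⟩ p :=
  .step _ _ _ i rfl hi hr hc (by rwa [he])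

/-- What `Good` says about the distribution of runs. -/
theorem sound {t : ℕ} {σ : Config} {p : ℝ} (h : Good Γ P t σ p) :
    (∀ t', ∀ σ' ∈ (runFrom P Γ.w Γ.x σ t').support, σ'.status = .running →
      ∀ i, P[σ'.pc]? = some i → ∀ a ∈ cells σ' i, Γ.A a) ∧
    (∀ σ' ∈ (runFrom P Γ.w Γ.x σ t).support,
      σ'.status ≠ .running ∧ (σ'.status = .accepted → Γ.Y)) ∧
    ENNReal.ofReal p ≤ (runFrom P Γ.w Γ.x σ t).toOuterMeasure {σ | σ.status = .accepted} := by
  induction h with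
  | accepted t σ p h hY hp =>
    have hh : σ.status ≠ .running := by simp [h]
    simp only [runFrom_halted _ _ _ _ hh, PMF.support_pure, Set.mem_singleton_iff]
    refine ⟨?_, ?_, ?_⟩
    · rintro t' _ rfl h'; exact absurd h' hh
    · rintro _ rfl; exact ⟨hh, fun _ => hY⟩
    · rw [PMF.toOuterMeasure_pure_apply, if_pos (by simpa using h)]
      simpa using hp
  | rejected t σ p h hp =>
    have hh : σ.status ≠ .running := by simp [h]
    simp only [runFrom_halted _ _ _ _ hh, PMF.support_pure, Set.mem_singleton_iff]
    refine ⟨?_, ?_, ?_⟩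
    · rintro t' _ rfl h'; exact absurd h' hh
    · rintro _ rfl; exact ⟨hh, fun h' => by simp [h] at h'⟩
    · rw [ENNReal.ofReal_of_nonpos hp]; exact zero_le
  | step t σ p i h hi hr hc hg ih =>
    have hs : WordRAM.step P Γ.w Γ.x σ = PMF.pure (exec Γ.w Γ.x σ 0 i) := by
      unfold WordRAM.step
      rw [h]
      simp only [hi]
    have hrun : ∀ t', runFrom P Γ.w Γ.x σ (t' + 1) = runFrom P Γ.w Γ.x (exec Γ.w Γ.x σ 0 i) t' := by
      intro t'; rw [runFrom, hs, PMF.pure_bind]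
    refine ⟨?_, ?_, ?_⟩
    · rintro (_ | t') σ' hσ'
      · simp only [runFrom, PMF.support_pure, Set.mem_singleton_iff] at hσ'
        subst hσ'
        intro _ j hj
        rw [hi] at hj
        cases hj
        exact hc
      · rw [hrun] at hσ'; exact ih.1 t' σ' hσ'
    · rw [hrun]; exact ih.2.1
    · rw [hrun]; exact ih.2.2
  | rand t σ p d a f h hi hc hm hg hp ih =>
    have hs : WordRAM.step P Γ.w Γ.x σ =
        (PMF.uniformOfFintype (Fin (σ.mem a - 1 + 1))).map
          fun r : Fin (σ.mem a - 1 + 1) => exec Γ.w Γ.x σ (r : ℕ) (.rand d a) := by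
      unfold WordRAM.step
      rw [h]
      simp only [hi]
      change PMF.map _ (PMF.map _ (PMF.map (fun r : Fin (σ.mem a - 1 + 1) => (r : ℕ)) _)) = _
      rw [PMF.map_comp, PMF.map_comp]
      rfl
    have hrun : ∀ t', runFrom P Γ.w Γ.x σ (t' + 1) =
        (PMF.uniformOfFintype (Fin (σ.mem a - 1 + 1))).bind
          fun r => runFrom P Γ.w Γ.x (exec Γ.w Γ.x σ r (.rand d a)) t' := by
      intro t'; rw [runFrom, hs]; exact PMF.bind_map _ _ _
    have hlt : ∀ r : Fin (σ.mem a - 1 + 1), (r : ℕ) < σ.mem a := fun r => by have := r.2; omega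
    refine ⟨?_, ?_, ?_⟩
    · rintro (_ | t') σ' hσ'
      · simp only [runFrom, PMF.support_pure, Set.mem_singleton_iff] at hσ'
        subst hσ'
        intro _ j hj
        rw [hi] at hj
        cases hj
        exact hc
      · rw [hrun, PMF.mem_support_bind_iff] at hσ'
        obtain ⟨r, -, hr⟩ := hσ'
        exact (ih r (hlt r)).1 t' σ' hr
    · intro σ' hσ'
      rw [hrun, PMF.mem_support_bind_iff] at hσ'
      obtain ⟨r, -, hr⟩ := hσ'
      exact (ih r (hlt r)).2.1 σ' hr
    · rw [hrun, PMF.toOuterMeasure_bind_apply, tsum_fintype]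
      simp only [PMF.uniformOfFintype_apply, Fintype.card_fin]
      have e1 : σ.mem a - 1 + 1 = σ.mem a := by omega
      have hm' : (0 : ℝ) < σ.mem a := by exact_mod_cast hm
      calc ENNReal.ofReal p
          ≤ ENNReal.ofReal (∑ r ∈ Finset.range (σ.mem a), (σ.mem a : ℝ)⁻¹ * f r) := by
            apply ENNReal.ofReal_le_ofReal
            rw [← Finset.mul_sum, ← div_eq_inv_mul, le_div_iff₀ hm']
            exact hp
        -- The bounds `f r` may be negative, so truncation to nonnegative values is only subadditive
        -- here.
        _ ≤ ∑ r ∈ Finset.range (σ.mem a), ENNReal.ofReal ((σ.mem a : ℝ)⁻¹ * f r) :=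
            Finset.le_sum_of_subadditive _ ENNReal.ofReal_zero.le
              (fun _ _ => ENNReal.ofReal_add_le) _ _
        _ = ∑ r : Fin (σ.mem a - 1 + 1), ENNReal.ofReal ((σ.mem a : ℝ)⁻¹ * f r) := by
            rw [Finset.sum_range, ← e1]
            simp
        _ ≤ _ := by
            refine Finset.sum_le_sum fun r _ => ?_
            have e2 : ((σ.mem a - 1 + 1 : ℕ) : ENNReal) = σ.mem a := by rw [e1]
            rw [ENNReal.ofReal_mul (by positivity), ENNReal.ofReal_inv_of_pos hm', e2,
              ENNReal.ofReal_natCast]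
            gcongr
            exact (ih r (hlt r)).2.2

end Good

/-- What `Good` says about the run from the initial configuration. -/
theorem Good.run {Γ : Env} {P : Program} {t : ℕ} {p : ℝ} (h : Good Γ P t init p) :
    HaltsWithin P Γ.w Γ.x t ∧
    (∀ s, (∀ a, Γ.A a → a < s) → SpaceWithin P Γ.w Γ.x s) ∧
    (∀ σ ∈ (run P Γ.w Γ.x t).support, σ.status = .accepted → Γ.Y) ∧
    ENNReal.ofReal p ≤ acceptProb P Γ.w Γ.x t := by
  obtain ⟨h1, h2, h3⟩ := h.sound
  simp only [HaltsWithin, SpaceWithin, acceptProb, run_eq_runFrom]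
  exact ⟨fun σ hσ => (h2 σ hσ).1, fun s hs t σ hσ hr i hi a ha => hs a (h1 t σ hσ hr i hi a ha),
    fun σ hσ => (h2 σ hσ).2, h3⟩

/-! ## A structured language on top of the word RAM

Cells `0, …, 7` hold intermediate values of expressions. -/

/-- The arithmetic operations on natural numbers. -/
def ArithOp.nat : ArithOp → ℕ → ℕ → ℕ
  | .add, x, y => x + y
  | .sub, x, y => x - y
  | .mul, x, y => x * y
  | .div, x, y => x / y
  | .mod, x, y => x % y

/-- The arithmetic operation does not wrap around. -/
def ArithOp.ok (w : ℕ) : ArithOp → ℕ → ℕ → Prop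
  | .add, x, y => x + y < 2 ^ w
  | .sub, x, y => y ≤ x ∧ x < 2 ^ w
  | .mul, x, y => x * y < 2 ^ w
  | .div, _, _ => True
  | .mod, _, _ => True

theorem ArithOp.eval_eq_nat {w : ℕ} {o : ArithOp} {x y : ℕ} (h : o.ok w x y) :
    o.eval w x y = o.nat x y := by
  cases o with
  | add => exact Nat.mod_eq_of_lt h
  | sub =>
    obtain ⟨h1, h2⟩ := h
    have : x + (2 ^ w - y) = (x - y) + 2 ^ w := by omega
    simp only [ArithOp.eval, ArithOp.nat, this, Nat.add_mod_right]
    exact Nat.mod_eq_of_lt (by omega)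
  | mul => exact Nat.mod_eq_of_lt h
  | div => rfl
  | mod => rfl

/-- Expressions: constants, arithmetic operations, memory cells and input items. -/
inductive Exp
  | cst (v : ℕ)
  | op (o : ArithOp) (a b : Exp)
  | ld (a : Exp)
  | inp (a : Exp)

namespace Exp

/-- Code that stores the value of the expression in cell `i`, using cells `i, …, 7`. -/
def code : Exp → ℕ → List Instr
  | cst v, i => [.const i v]
  | op o a b, i => a.code i ++ (b.code (i + 1) ++ [.arith o i i (i + 1)])
  | ld a, i => a.code i ++ [.load i i]
  | inp a, i => a.code i ++ [.input i i]

def cost : Exp → ℕ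
  | cst _ => 1
  | op _ a b => a.cost + (b.cost + 1)
  | ld a => a.cost + 1
  | inp a => a.cost + 1

@[simp]
theorem length_code (e : Exp) (i : ℕ) : (e.code i).length = e.cost := by
  induction e generalizing i <;> simp_all [code, cost]

/-- The value of the expression. -/
def val (x : List ℕ) (μ : ℕ → ℕ) : Exp → ℕ
  | cst v => v
  | op o a b => o.nat (a.val x μ) (b.val x μ)
  | ld a => μ (a.val x μ)
  | inp a => x.getD (a.val x μ) 0

/-- The expression can be evaluated without overflow, and reads admissible cells only. -/
def ok (Γ : Env) (μ : ℕ → ℕ) : Exp → ℕ → Prop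
  | cst v, i => v < 2 ^ Γ.w ∧ i < 8
  | op o a b, i => a.ok Γ μ i ∧ b.ok Γ μ (i + 1) ∧ o.ok Γ.w (a.val Γ.x μ) (b.val Γ.x μ)
  | ld a, i => a.ok Γ μ i ∧ 8 ≤ a.val Γ.x μ ∧ Γ.A (a.val Γ.x μ)
  | inp a, i => a.ok Γ μ i ∧ Γ.x.getD (a.val Γ.x μ) 0 < 2 ^ Γ.w

theorem ok_lt {Γ : Env} {μ : ℕ → ℕ} {e : Exp} {i : ℕ} (h : e.ok Γ μ i) : i < 8 := by
  induction e generalizing i with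
  | cst v => exact h.2
  | op o a b iha ihb => exact iha h.1
  | ld a ih => exact ih h.1
  | inp a ih => exact ih h.1

/-- Loads are admissible only at addresses from 8 on, so intermediate values of other expressions
cannot influence the result. -/
theorem ok_congr {Γ : Env} {μ ν : ℕ → ℕ} {e : Exp} {i : ℕ} (h : e.ok Γ μ i)
    (hν : ∀ a, 8 ≤ a → ν a = μ a) : e.ok Γ ν i ∧ e.val Γ.x ν = e.val Γ.x μ := by
  induction e generalizing i with
  | cst v => exact ⟨h, rfl⟩
  | op o a b iha ihb =>
    obtain ⟨h1, h2, h3⟩ := h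
    obtain ⟨a1, a2⟩ := iha h1
    obtain ⟨b1, b2⟩ := ihb h2
    exact ⟨⟨a1, b1, by rwa [a2, b2]⟩, by simp only [val, a2, b2]⟩
  | ld a ih =>
    obtain ⟨h1, h2, h3⟩ := h
    obtain ⟨a1, a2⟩ := ih h1
    exact ⟨⟨a1, by rwa [a2], by rwa [a2]⟩, by simp only [val, a2, hν _ h2]⟩
  | inp a ih =>
    obtain ⟨h1, h2⟩ := h
    obtain ⟨a1, a2⟩ := ih h1
    exact ⟨⟨a1, by rwa [a2]⟩, by simp only [val, a2]⟩

end Exp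

/-- The code `l` stands in the program at position `i`. -/
def CodeAt (P : Program) (i : ℕ) (l : List Instr) : Prop :=
  ∀ j < l.length, P[i + j]? = l[j]?

theorem CodeAt.append {P : Program} {i : ℕ} {l l' : List Instr} (h : CodeAt P i (l ++ l')) :
    CodeAt P i l ∧ CodeAt P (i + l.length) l' := by
  refine ⟨fun j hj => ?_, fun j hj => ?_⟩
  · rw [h j (by simp; omega), List.getElem?_append_left hj]
  · rw [Nat.add_assoc, h _ (by simp; omega), List.getElem?_append_right (by omega)]
    simp

theorem CodeAt.cons {P : Program} {i : ℕ} {a : Instr} {l : List Instr} (h : CodeAt P i (a :: l)) :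
    P[i]? = some a ∧ CodeAt P (i + 1) l := by
  obtain ⟨h1, h2⟩ := CodeAt.append (l := [a]) (l' := l) h
  exact ⟨by simpa using h1 0 (by simp), h2⟩

theorem CodeAt.self (P : Program) : CodeAt P 0 P := fun j _ => by simp

/-- `Good` for all memories that agree with `μ` outside the cells for intermediate values. -/
def GoodM (Γ : Env) (P : Program) (i : ℕ) (μ : ℕ → ℕ) (t : ℕ) (p : ℝ) : Prop :=
  ∀ ν : ℕ → ℕ, (∀ a, 8 ≤ a → ν a = μ a) → Good Γ P t ⟨.running, i, ν⟩ p

theorem GoodM.mono {Γ : Env} {P : Program} {i : ℕ} {μ : ℕ → ℕ} {t t' : ℕ} {p : ℝ}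
    (h : GoodM Γ P i μ t p) (ht : t ≤ t') : GoodM Γ P i μ t' p :=
  fun ν hν => (h ν hν).mono ht

/-- Evaluation into cell `i` leaves the cells below `i` alone; hence the left operand in cell `i`
survives while the right operand is computed in cell `i + 1`. The claim is in continuation form to
fit the backward reading of `Good`. -/
theorem Exp.good {Γ : Env} {P : Program} {e : Exp} {i off : ℕ} {μ : ℕ → ℕ} (t : ℕ) {p : ℝ}
    (h : e.ok Γ μ i) (hP : CodeAt P off (e.code i))
    (hg : ∀ ν : ℕ → ℕ, ν i = e.val Γ.x μ → (∀ a, a < i ∨ 8 ≤ a → ν a = μ a) →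
      Good Γ P t ⟨.running, off + e.cost, ν⟩ p) :
    Good Γ P (t + e.cost) ⟨.running, off, μ⟩ p := by
  induction e generalizing i off μ t with
  | cst v =>
    refine .step _ _ _ _ rfl hP.cons.1 (by simp) ?_ (hg _ ?_ ?_)
    · simpa [cells] using Γ.temp _ h.2
    · simp [Exp.val, Nat.mod_eq_of_lt h.1]
    · intro a ha
      have := h.2
      exact Function.update_of_ne (by omega) _ _
  | op o a b iha ihb =>
    obtain ⟨h1, h2, h3⟩ := h
    have hi := Exp.ok_lt h2
    obtain ⟨c1, c2⟩ := hP.append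
    obtain ⟨c2, c3⟩ := c2.append
    have : t + (op o a b).cost = ((t + 1) + b.cost) + a.cost := by simp only [cost]; omega
    rw [this]
    refine iha _ h1 c1 fun ν hν1 hν2 => ?_
    obtain ⟨k2, v2⟩ := Exp.ok_congr h2 (ν := ν) fun a ha => hν2 a (.inr ha)
    rw [Exp.length_code] at c2 c3
    refine ihb _ k2 c2 fun ν' hν1' hν2' => ?_
    have vi : ν' i = a.val Γ.x μ := by rw [hν2' i (.inl (by omega)), hν1]
    rw [Exp.length_code] at c3
    refine .step_to c3.cons.1 (by simp) ?_ rfl ?_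
    · simpa [cells] using ⟨Γ.temp _ (by omega), Γ.temp _ hi⟩
    rw [Nat.add_assoc, Nat.add_assoc]
    refine hg _ ?_ ?_
    · simp only [Function.update_self]
      rw [vi, hν1', v2, ArithOp.eval_eq_nat h3]
      rfl
    · intro a ha
      exact (Function.update_of_ne (by omega) _ _).trans ((hν2' a (by omega)).trans (hν2 a ha))
  | ld a ih =>
    obtain ⟨h1, h2, h3⟩ := h
    obtain ⟨c1, c2⟩ := hP.append
    rw [Exp.length_code] at c2
    have hi := Exp.ok_lt h1
    have : t + (ld a).cost = (t + 1) + a.cost := by simp only [cost]; omega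
    rw [this]
    refine ih _ h1 c1 fun ν hν1 hν2 => ?_
    refine .step_to c2.cons.1 (by simp) ?_ rfl (hg _ ?_ ?_)
    · simpa [cells, hν1] using ⟨Γ.temp _ hi, h3⟩
    · simp only [Function.update_self]
      rw [hν1, hν2 _ (.inr h2)]
      rfl
    · intro a ha
      exact (Function.update_of_ne (by omega) _ _).trans (hν2 a ha)
  | inp a ih =>
    obtain ⟨h1, h2⟩ := h
    obtain ⟨c1, c2⟩ := hP.append
    rw [Exp.length_code] at c2
    have hi := Exp.ok_lt h1
    have : t + (inp a).cost = (t + 1) + a.cost := by simp only [cost]; omega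
    rw [this]
    refine ih _ h1 c1 fun ν hν1 hν2 => ?_
    refine .step_to c2.cons.1 (by simp) ?_ rfl (hg _ ?_ ?_)
    · simpa [cells] using Γ.temp _ hi
    · simp only [Function.update_self]
      rw [hν1, Nat.mod_eq_of_lt h2]
      rfl
    · intro a ha
      exact (Function.update_of_ne (by omega) _ _).trans (hν2 a ha)

/-- Evaluating two expressions into cells `0` and `1`. -/
theorem Exp.good_pair {Γ : Env} {P : Program} {e f : Exp} {off : ℕ} {μ : ℕ → ℕ} (t : ℕ) {p : ℝ}
    (he : e.ok Γ μ 0) (hf : f.ok Γ μ 1) (hP : CodeAt P off (e.code 0 ++ f.code 1))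
    (hg : ∀ ν : ℕ → ℕ, ν 0 = e.val Γ.x μ → ν 1 = f.val Γ.x μ → (∀ a, 8 ≤ a → ν a = μ a) →
      Good Γ P t ⟨.running, off + e.cost + f.cost, ν⟩ p) :
    GoodM Γ P off μ (t + f.cost + e.cost) p := by
  intro ν hν
  obtain ⟨he, ve⟩ := Exp.ok_congr he hν
  obtain ⟨hf, vf⟩ := Exp.ok_congr hf hν
  obtain ⟨c1, c2⟩ := hP.append
  rw [Exp.length_code] at c2
  refine Exp.good _ he c1 fun ν1 h1 h1' => ?_
  obtain ⟨hf, vf'⟩ := Exp.ok_congr hf (ν := ν1) fun a ha => h1' a (.inr ha)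
  refine Exp.good _ hf c2 fun ν2 h2 h2' => ?_
  refine hg ν2 ?_ ?_ ?_
  · rw [h2' 0 (.inl (by omega)), h1, ve]
  · rw [h2, vf', vf]
  · intro a ha; rw [h2' a (.inr ha), h1' a (.inr ha), hν a ha]

/-- Structured commands.
* `store d e`: write the value of `e` to the cell with address `d`
* `rnd d e`: write a random number below `e` to the cell with address `d`
* `ite e f c c'`: `c` if `e < f`, else `c'`
* `loop e f c`: repeat `c` as long as `e < f`
* `call c`: the same as `c`, for which a specification is available -/
inductive Cmd
  | skip
  | store (d e : Exp)
  | rnd (d e : Exp)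
  | seq (c c' : Cmd)
  | ite (e f : Exp) (c c' : Cmd)
  | loop (e f : Exp) (c : Cmd)
  | call (c : Cmd)
  | accept
  | reject

namespace Cmd

def size : Cmd → ℕ
  | skip => 0
  | store d e => d.cost + e.cost + 1
  | rnd d e => d.cost + e.cost + 2
  | seq c c' => c.size + c'.size
  | ite e f c c' => e.cost + f.cost + 1 + c'.size + 1 + c.size
  | .loop e f c => e.cost + f.cost + 2 + c.size + 1
  | call c => c.size
  | accept => 1
  | reject => 1

/-- The code of the command at position `i` of a program. -/
def code : Cmd → ℕ → List Instr
  | skip, _ => []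
  | store d e, _ => (d.code 0 ++ e.code 1) ++ [.store 0 1]
  | rnd d e, _ => (d.code 0 ++ e.code 1) ++ [.rand 1 1, .store 0 1]
  | seq c c', i => c.code i ++ c'.code (i + c.size)
  | ite e f c c', i =>
    (e.code 0 ++ f.code 1) ++
      (.jumpLt 0 1 (i + e.cost + f.cost + 1 + c'.size + 1) ::
        (c'.code (i + e.cost + f.cost + 1) ++
          (.jump (i + e.cost + f.cost + 1 + c'.size + 1 + c.size) ::
            c.code (i + e.cost + f.cost + 1 + c'.size + 1))))
  | .loop e f c, i =>
    (e.code 0 ++ f.code 1) ++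
      (.jumpLt 0 1 (i + e.cost + f.cost + 2) :: .jump (i + e.cost + f.cost + 2 + c.size + 1) ::
        (c.code (i + e.cost + f.cost + 2) ++ [.jump i]))
  | call c, i => c.code i
  | accept, _ => [.accept]
  | reject, _ => [.reject]

@[simp]
theorem length_code (c : Cmd) (i : ℕ) : (c.code i).length = c.size := by
  induction c generalizing i <;> simp_all [code, size] <;> omega

end Cmd

/-- A postcondition relates the memory, the number of steps left, and the probability of acceptance
that the rest of the program has to guarantee. -/
abbrev Post := (ℕ → ℕ) → ℕ → ℝ → Prop

/-- The weakest precondition of a command. -/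
def WP (Γ : Env) (c : Cmd) (Q : Post) : Post := fun μ n p =>
  ∀ (P : Program) (i r : ℕ), CodeAt P i (c.code i) →
    (∀ μ' n' p', Q μ' n' p' → GoodM Γ P (i + c.size) μ' (n' + r) p') → GoodM Γ P i μ (n + r) p

theorem WP.mono {Γ : Env} {c : Cmd} {Q R : Post} {μ : ℕ → ℕ} {n m : ℕ} {p : ℝ}
    (h : WP Γ c Q μ n p) (hn : n ≤ m)
    (hQ : ∀ μ' n' p', Q μ' n' p' → R μ' (n' + (m - n)) p') : WP Γ c R μ m p := by
  intro P i r hP hR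
  have := h P i (m - n + r) hP fun μ' n' p' hq => by
    have := hR _ _ _ (hQ _ _ _ hq)
    rwa [Nat.add_assoc] at this
  convert this using 1
  omega

theorem WP.imp {Γ : Env} {c : Cmd} {Q R : Post} {μ : ℕ → ℕ} {n : ℕ} {p : ℝ}
    (h : WP Γ c Q μ n p) (hQ : ∀ μ' n' p', Q μ' n' p' → R μ' n' p') : WP Γ c R μ n p :=
  h.mono le_rfl fun μ' n' p' hq => by simpa using hQ _ _ _ hq

theorem WP.skip {Γ : Env} {Q : Post} {μ : ℕ → ℕ} {n : ℕ} {p : ℝ} (h : Q μ n p) :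
    WP Γ .skip Q μ n p := fun _ _ _ _ hQ => hQ _ _ _ h

theorem WP.accept {Γ : Env} {Q : Post} {μ : ℕ → ℕ} {n : ℕ} {p : ℝ} (hY : Γ.Y) (hp : p ≤ 1)
    (hn : 1 ≤ n) : WP Γ .accept Q μ n p := by
  intro P i r hP _ ν _
  obtain ⟨m, rfl⟩ : ∃ m, n = m + 1 := ⟨n - 1, by omega⟩
  rw [Nat.add_right_comm]
  exact .step _ _ _ _ rfl hP.cons.1 (by simp) (by simp [cells]) (.accepted _ _ _ rfl hY hp)

theorem WP.reject {Γ : Env} {Q : Post} {μ : ℕ → ℕ} {n : ℕ} {p : ℝ} (hp : p ≤ 0)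
    (hn : 1 ≤ n) : WP Γ .reject Q μ n p := by
  intro P i r hP _ ν _
  obtain ⟨m, rfl⟩ : ∃ m, n = m + 1 := ⟨n - 1, by omega⟩
  rw [Nat.add_right_comm]
  exact .step _ _ _ _ rfl hP.cons.1 (by simp) (by simp [cells]) (.rejected _ _ _ rfl hp)

theorem WP.seq {Γ : Env} {c c' : Cmd} {Q : Post} {μ : ℕ → ℕ} {n : ℕ} {p : ℝ}
    (h : WP Γ c (WP Γ c' Q) μ n p) : WP Γ (.seq c c') Q μ n p := by
  intro P i r hP hQ
  obtain ⟨c1, c2⟩ := hP.append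
  rw [Cmd.length_code] at c2
  exact h P i r c1 fun μ' n' p' h' => h' P _ r c2 fun μ'' n'' p'' hq => by
    have := hQ _ _ _ hq
    rwa [Cmd.size, ← Nat.add_assoc] at this

theorem WP.store {Γ : Env} {d e : Exp} {Q : Post} {μ : ℕ → ℕ} {n : ℕ} {p : ℝ}
    (hd : d.ok Γ μ 0) (he : e.ok Γ μ 1) (hA : Γ.A (d.val Γ.x μ))
    (hn : d.cost + e.cost + 1 ≤ n)
    (hQ : Q (Function.update μ (d.val Γ.x μ) (e.val Γ.x μ)) (n - (d.cost + e.cost + 1)) p) :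
    WP Γ (.store d e) Q μ n p := by
  intro P i r hP hR
  obtain ⟨c1, c2⟩ := hP.append
  simp only [List.length_append, Exp.length_code] at c2
  have := Exp.good_pair (n - (d.cost + e.cost + 1) + r + 1) hd he c1 (p := p) ?_
  · convert this using 1; omega
  intro ν h0 h1 hν
  refine .step_to (by rw [Nat.add_assoc]; exact c2.cons.1) (by simp) ?_ rfl ?_
  · simpa [cells, h0] using ⟨Γ.temp 0 (by omega), Γ.temp 1 (by omega), hA⟩
  · have := hR _ _ _ hQ
    simp only [Cmd.size, ← Nat.add_assoc] at this
    refine this _ fun a ha => ?_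
    simp only [h0, h1, Function.update_apply]
    split_ifs <;> simp [hν a ha]

theorem WP.rnd {Γ : Env} {d e : Exp} {Q : Post} {μ : ℕ → ℕ} {n : ℕ} {p : ℝ}
    (hd : d.ok Γ μ 0) (he : e.ok Γ μ 1) (hA : Γ.A (d.val Γ.x μ))
    (hn : d.cost + e.cost + 2 ≤ n) (hm : 0 < e.val Γ.x μ) (f : ℕ → ℝ)
    (hp : p * e.val Γ.x μ ≤ ∑ r ∈ Finset.range (e.val Γ.x μ), f r)
    (hQ : ∀ r < e.val Γ.x μ,
      Q (Function.update μ (d.val Γ.x μ) r) (n - (d.cost + e.cost + 2)) (f r)) :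
    WP Γ (.rnd d e) Q μ n p := by
  intro P i r hP hR
  obtain ⟨c1, c2⟩ := hP.append
  simp only [List.length_append, Exp.length_code] at c2
  have := Exp.good_pair (n - (d.cost + e.cost + 2) + r + 1 + 1) hd he c1 (p := p) ?_
  · convert this using 1; omega
  intro ν h0 h1 hν
  refine .rand _ _ _ _ _ f rfl (by rw [Nat.add_assoc]; exact c2.cons.1) ?_ ?_ ?_ ?_
  · simpa [cells] using Γ.temp 1 (by omega)
  · simpa [h1] using hm
  · intro q hq
    refine .step_to (i := .store 0 1) ?_ (by simp) ?_ rfl ?_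
    · have := c2.cons.2.cons.1
      simpa [exec, Config.write, Nat.add_assoc] using this
    · simpa [cells, exec, Config.write, h0] using ⟨Γ.temp 0 (by omega), Γ.temp 1 (by omega), hA⟩
    · have := hR _ _ _ (hQ q (by simpa [h1] using hq))
      simp only [Cmd.size, ← Nat.add_assoc] at this
      refine this _ fun a ha => ?_
      have h1a : a ≠ 1 := by omega
      simp only [h0, Function.update_apply]
      simp only [if_pos, zero_ne_one, if_false, h1a]
      split_ifs <;> simp [hν a ha]
  · simpa [h1] using hp

theorem WP.ite {Γ : Env} {e f : Exp} {c c' : Cmd} {Q : Post} {μ : ℕ → ℕ} {n : ℕ} {p : ℝ}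
    (he : e.ok Γ μ 0) (hf : f.ok Γ μ 1) (hn : e.cost + f.cost + 2 ≤ n)
    (h1 : e.val Γ.x μ < f.val Γ.x μ → WP Γ c Q μ (n - (e.cost + f.cost + 2)) p)
    (h2 : ¬ e.val Γ.x μ < f.val Γ.x μ → WP Γ c' Q μ (n - (e.cost + f.cost + 2)) p) :
    WP Γ (.ite e f c c') Q μ n p := by
  intro P i r hP hR
  simp only [Cmd.size, ← Nat.add_assoc] at hR
  obtain ⟨c1, c2⟩ := hP.append
  simp only [List.length_append, Exp.length_code, ← Nat.add_assoc] at c2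
  obtain ⟨c2, c3⟩ := c2.cons
  obtain ⟨c3, c4⟩ := c3.append
  rw [Cmd.length_code] at c4
  obtain ⟨c4, c5⟩ := c4.cons
  have := Exp.good_pair (n - (e.cost + f.cost + 2) + (r + 1) + 1) he hf c1 (p := p) ?_
  · convert this using 1; omega
  intro ν h0 hh1 hν
  refine .step _ _ _ _ rfl c2 (by simp) ?_ ?_
  · simpa [cells] using ⟨Γ.temp 0 (by omega), Γ.temp 1 (by omega)⟩
  simp only [exec, h0, hh1]
  split_ifs with hlt
  · exact h1 hlt P _ (r + 1) c5
      (fun μ' n' p' hq => (hR μ' n' p' hq).mono (by omega)) ν hν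
  · refine h2 hlt P _ (r + 1) c3 (fun μ' n' p' hq ν' hν' => ?_) ν hν
    exact .step_to (t := n' + r) c4 (by simp) (by simp [cells]) rfl (hR μ' n' p' hq ν' hν')

/-- The rule for loops: `I j` is the invariant with `j` iterations left, and `b` bounds the cost of
an iteration. -/
theorem WP.loop {Γ : Env} {e f : Exp} {c : Cmd} {Q : Post} {μ : ℕ → ℕ} {n : ℕ} {p : ℝ}
    (I : ℕ → (ℕ → ℕ) → ℝ → Prop) (j b : ℕ) (h0 : I j μ p)
    (hok : ∀ j μ p, I j μ p → e.ok Γ μ 0 ∧ f.ok Γ μ 1 ∧ (e.val Γ.x μ < f.val Γ.x μ ↔ 0 < j))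
    (hn : j * (b + (e.cost + f.cost + 2)) + (e.cost + f.cost + 2) ≤ n)
    (hstep : ∀ j μ p, I (j + 1) μ p → WP Γ c (fun μ' _ p' => I j μ' p') μ b p)
    (hend : ∀ μ p, I 0 μ p →
      Q μ (n - (j * (b + (e.cost + f.cost + 2)) + (e.cost + f.cost + 2))) p) :
    WP Γ (.loop e f c) Q μ n p := by
  intro P i r hP hR
  simp only [Cmd.size, ← Nat.add_assoc] at hR
  obtain ⟨c1, c2⟩ := hP.append
  simp only [List.length_append, Exp.length_code, ← Nat.add_assoc] at c2
  obtain ⟨c2, c3⟩ := c2.cons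
  obtain ⟨c3, c4⟩ := c3.cons
  obtain ⟨c4, c5⟩ := c4.append
  rw [Cmd.length_code] at c5
  have c5 := c5.cons.1
  obtain ⟨s, rfl⟩ := Nat.exists_eq_add_of_le hn
  clear hn
  rw [Nat.add_sub_cancel_left] at hend
  set K := e.cost + f.cost + 2 with hK
  induction j generalizing μ p with
  | zero =>
    obtain ⟨he, hf, hl⟩ := hok _ _ _ h0
    have := Exp.good_pair (s + r + 1 + 1) he hf c1 (p := p) ?_
    · convert this using 1; omega
    intro ν h0' hh1 hν
    refine .step _ _ _ _ rfl c2 (by simp) ?_ ?_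
    · simpa [cells] using ⟨Γ.temp 0 (by omega), Γ.temp 1 (by omega)⟩
    simp only [exec, h0', hh1]
    rw [if_neg (by rw [hl]; omega)]
    exact .step_to c3 (by simp) (by simp [cells]) rfl (hR _ _ _ (hend μ p h0) ν hν)
  | succ j ih =>
    obtain ⟨he, hf, hl⟩ := hok _ _ _ h0
    have := Exp.good_pair (b + (j * (b + K) + K + s + r + 1) + 1) he hf c1 (p := p) ?_
    · convert this using 1
      rw [Nat.add_mul]; omega
    intro ν h0' hh1 hν
    refine .step _ _ _ _ rfl c2 (by simp) ?_ ?_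
    · simpa [cells] using ⟨Γ.temp 0 (by omega), Γ.temp 1 (by omega)⟩
    simp only [exec, h0', hh1]
    rw [if_pos (by rw [hl]; omega)]
    refine hstep _ _ _ h0 P _ (j * (b + K) + K + s + r + 1) ?_ (fun μ' n' p' hq ν' hν' => ?_) ν hν
    · exact c4
    -- Steps that the body has saved are discarded, so that every iteration is charged the full `b`.
    refine Good.mono (t := j * (b + K) + K + s + r + 1) ?_ (by omega)
    exact .step_to c5 (by simp) (by simp [cells]) rfl (ih hq ν' hν')

/-- The precondition that loop-free code needs, computed by recursion. -/
def vc (Γ : Env) : Cmd → Post → Post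
  | .skip, Q => Q
  | .store d e, Q => fun μ n p =>
      d.ok Γ μ 0 ∧ e.ok Γ μ 1 ∧ Γ.A (d.val Γ.x μ) ∧ d.cost + e.cost + 1 ≤ n ∧
        Q (Function.update μ (d.val Γ.x μ) (e.val Γ.x μ)) (n - (d.cost + e.cost + 1)) p
  | .rnd d e, Q => fun μ n p => WP Γ (.rnd d e) Q μ n p
  | .seq c c', Q => vc Γ c (vc Γ c' Q)
  | .ite e f c c', Q => fun μ n p =>
      e.ok Γ μ 0 ∧ f.ok Γ μ 1 ∧ e.cost + f.cost + 2 ≤ n ∧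
        (e.val Γ.x μ < f.val Γ.x μ → vc Γ c Q μ (n - (e.cost + f.cost + 2)) p) ∧
        (¬ e.val Γ.x μ < f.val Γ.x μ → vc Γ c' Q μ (n - (e.cost + f.cost + 2)) p)
  | .loop e f c, Q => fun μ n p => WP Γ (.loop e f c) Q μ n p
  | .call c, Q => fun μ n p => WP Γ c Q μ n p
  | .accept, _ => fun _ n p => Γ.Y ∧ p ≤ 1 ∧ 1 ≤ n
  | .reject, _ => fun _ n p => p ≤ 0 ∧ 1 ≤ n

theorem WP.of_vc {Γ : Env} {c : Cmd} {Q : Post} {μ : ℕ → ℕ} {n : ℕ} {p : ℝ}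
    (h : vc Γ c Q μ n p) : WP Γ c Q μ n p := by
  induction c generalizing Q μ n p with
  | skip => exact .skip h
  | store d e => exact .store h.1 h.2.1 h.2.2.1 h.2.2.2.1 h.2.2.2.2
  | rnd d e => exact h
  | seq c c' ih ih' => exact .seq ((ih h).imp fun _ _ _ h' => ih' h')
  | ite e f c c' ih ih' =>
    exact .ite h.1 h.2.1 h.2.2.1 (fun h' => ih (h.2.2.2.1 h')) (fun h' => ih' (h.2.2.2.2 h'))
  | loop e f c ih => exact h
  | call c ih => exact h
  | accept => exact .accept h.1 h.2.1 h.2.2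
  | reject => exact .reject h.1 h.2

/-- Total correctness with a bound `b` on the number of steps, for commands that do not draw
random numbers. -/
def HT (Γ : Env) (c : Cmd) (μ : ℕ → ℕ) (b : ℕ) (R : (ℕ → ℕ) → Prop) : Prop :=
  ∀ p, WP Γ c (fun μ' _ p' => R μ' ∧ p' = p) μ b p

theorem HT.wp {Γ : Env} {c : Cmd} {μ : ℕ → ℕ} {b n : ℕ} {R : (ℕ → ℕ) → Prop} {Q : Post} {p : ℝ}
    (h : HT Γ c μ b R) (hn : b ≤ n) (hQ : ∀ μ' m, R μ' → n - b ≤ m → Q μ' m p) :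
    WP Γ c Q μ n p :=
  (h p).mono hn fun μ' n' p' ⟨h1, h2⟩ => by subst h2; exact hQ _ _ h1 (by omega)

/-- The rule for loops with a deterministic body. -/
theorem HT.loop {Γ : Env} {e f : Exp} {c : Cmd} {μ : ℕ → ℕ} {n : ℕ} {R : (ℕ → ℕ) → Prop}
    (I : ℕ → (ℕ → ℕ) → Prop) (j b : ℕ) (h0 : I j μ)
    (hok : ∀ j μ, I j μ → e.ok Γ μ 0 ∧ f.ok Γ μ 1 ∧ (e.val Γ.x μ < f.val Γ.x μ ↔ 0 < j))
    (hn : j * (b + (e.cost + f.cost + 2)) + (e.cost + f.cost + 2) ≤ n)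
    (hstep : ∀ j μ, I (j + 1) μ → HT Γ c μ b (I j))
    (hend : ∀ μ, I 0 μ → R μ) :
    HT Γ (.loop e f c) μ n R := fun p =>
  WP.loop (fun j μ p' => I j μ ∧ p' = p) j b ⟨h0, rfl⟩ (fun j μ p h => hok j μ h.1) hn
    (fun j μ p' h => by obtain ⟨h, rfl⟩ := h; exact hstep j μ h p')
    (fun μ p' h => ⟨hend μ h.1, h.2⟩)

/-- The program of a command. -/
def Cmd.program (c : Cmd) : Program := c.code 0

/-- The postcondition `False` expresses that control never reaches the end of the code: every run
stops at an accepting or rejecting instruction. -/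
theorem WP.good {Γ : Env} {c : Cmd} {n : ℕ} {p : ℝ}
    (h : WP Γ c (fun _ _ _ => False) (fun _ => 0) n p) : Good Γ c.program n init p :=
  h c.program 0 0 (CodeAt.self _) (fun _ _ _ h => h.elim) _ fun _ _ => rfl

/-- Commands without random draws. -/
def Cmd.Det : Cmd → Prop
  | .rnd _ _ => False
  | .seq c c' => c.Det ∧ c'.Det
  | .ite _ _ c c' => c.Det ∧ c'.Det
  | .loop _ _ c => c.Det
  | .call c => c.Det
  | _ => True

theorem Exp.rand_notMem_code (e : Exp) (i d a : ℕ) : Instr.rand d a ∉ e.code i := by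
  induction e generalizing i <;> simp_all [Exp.code]

theorem Cmd.Det.rand_notMem_code {c : Cmd} (h : c.Det) (i d a : ℕ) : Instr.rand d a ∉ c.code i := by
  induction c generalizing i <;>
    simp_all [Cmd.code, Cmd.Det, Exp.rand_notMem_code]

theorem Cmd.Det.isDeterministic {c : Cmd} (h : c.Det) : Program.IsDeterministic c.program :=
  fun d a => h.rand_notMem_code 0 d a

/-! ### Notation for expressions and rules for their values, costs and admissibility -/

namespace Exp

instance : Add Exp := ⟨op .add⟩
instance : Sub Exp := ⟨op .sub⟩
instance : Mul Exp := ⟨op .mul⟩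
instance : Div Exp := ⟨op .div⟩
instance : Mod Exp := ⟨op .mod⟩
instance (n : ℕ) : OfNat Exp n := ⟨cst n⟩

/-- The content of the cell `d`. -/
def v (d : ℕ) : Exp := ld (cst d)

section

variable (x : List ℕ) (μ : ℕ → ℕ) (a b : Exp) (n d : ℕ) (Γ : Env) (i : ℕ)

@[simp] theorem val_add : (a + b).val x μ = a.val x μ + b.val x μ := rfl
@[simp] theorem val_sub : (a - b).val x μ = a.val x μ - b.val x μ := rfl
@[simp] theorem val_mul : (a * b).val x μ = a.val x μ * b.val x μ := rfl
@[simp] theorem val_div : (a / b).val x μ = a.val x μ / b.val x μ := rfl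
@[simp] theorem val_mod : (a % b).val x μ = a.val x μ % b.val x μ := rfl
@[simp] theorem val_ofNat : (no_index (OfNat.ofNat n) : Exp).val x μ = n := rfl
@[simp] theorem val_v : (v d).val x μ = μ d := rfl
@[simp] theorem val_ld : (ld a).val x μ = μ (a.val x μ) := rfl
@[simp] theorem val_inp : (inp a).val x μ = x.getD (a.val x μ) 0 := rfl

@[simp] theorem cost_add : (a + b).cost = a.cost + (b.cost + 1) := rfl
@[simp] theorem cost_sub : (a - b).cost = a.cost + (b.cost + 1) := rfl
@[simp] theorem cost_mul : (a * b).cost = a.cost + (b.cost + 1) := rfl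
@[simp] theorem cost_div : (a / b).cost = a.cost + (b.cost + 1) := rfl
@[simp] theorem cost_mod : (a % b).cost = a.cost + (b.cost + 1) := rfl
@[simp] theorem cost_ofNat : (no_index (OfNat.ofNat n) : Exp).cost = 1 := rfl
@[simp] theorem cost_v : (v d).cost = 2 := rfl
@[simp] theorem cost_ld : (ld a).cost = a.cost + 1 := rfl
@[simp] theorem cost_inp : (inp a).cost = a.cost + 1 := rfl

@[simp] theorem ok_add : (a + b).ok Γ μ i ↔
    a.ok Γ μ i ∧ b.ok Γ μ (i + 1) ∧ a.val Γ.x μ + b.val Γ.x μ < 2 ^ Γ.w := Iff.rfl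
@[simp] theorem ok_sub : (a - b).ok Γ μ i ↔ a.ok Γ μ i ∧ b.ok Γ μ (i + 1) ∧
    b.val Γ.x μ ≤ a.val Γ.x μ ∧ a.val Γ.x μ < 2 ^ Γ.w := Iff.rfl
@[simp] theorem ok_mul : (a * b).ok Γ μ i ↔
    a.ok Γ μ i ∧ b.ok Γ μ (i + 1) ∧ a.val Γ.x μ * b.val Γ.x μ < 2 ^ Γ.w := Iff.rfl
@[simp] theorem ok_div : (a / b).ok Γ μ i ↔ a.ok Γ μ i ∧ b.ok Γ μ (i + 1) := by
  change _ ∧ _ ∧ True ↔ _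
  simp
@[simp] theorem ok_mod : (a % b).ok Γ μ i ↔ a.ok Γ μ i ∧ b.ok Γ μ (i + 1) := by
  change _ ∧ _ ∧ True ↔ _
  simp
@[simp] theorem ok_ld :
    (ld a).ok Γ μ i ↔ a.ok Γ μ i ∧ 8 ≤ a.val Γ.x μ ∧ Γ.A (a.val Γ.x μ) := Iff.rfl
@[simp] theorem ok_inp :
    (inp a).ok Γ μ i ↔ a.ok Γ μ i ∧ Γ.x.getD (a.val Γ.x μ) 0 < 2 ^ Γ.w := Iff.rfl

end

end Exp

/-- The first 64 cells may be used, and small numbers fit into a word. -/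
structure Env.Std (Γ : Env) : Prop where
  cell : ∀ a < 64, Γ.A a
  word : 128 ≤ 2 ^ Γ.w

/-- The form `↔ True` makes this a rewriting rule whose numerical side conditions are discharged on
the spot. -/
theorem Exp.ok_ofNat {Γ : Env} (h : Γ.Std) (μ : ℕ → ℕ) {n i : ℕ} (hn : n < 128) (hi : i < 8) :
    (no_index (OfNat.ofNat n) : Exp).ok Γ μ i ↔ True :=
  iff_true_intro ⟨hn.trans_le h.word, hi⟩

theorem Exp.ok_v {Γ : Env} (h : Γ.Std) (μ : ℕ → ℕ) {d i : ℕ} (hd : d < 64) (h8 : 8 ≤ d)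
    (hi : i < 8) : (v d).ok Γ μ i ↔ True :=
  iff_true_intro ⟨⟨by have := h.word; omega, hi⟩, h8, h.cell d hd⟩

/-- Assignment to the cell `d`. -/
def Cmd.set (d : ℕ) (e : Exp) : Cmd := .store (.cst d) e

theorem vc_set {Γ : Env} (h : Γ.Std) {d : ℕ} (hd : d < 64) (e : Exp) (Q : Post) (μ : ℕ → ℕ) (n : ℕ)
    (p : ℝ) : vc Γ (.set d e) Q μ n p ↔
      e.ok Γ μ 1 ∧ e.cost + 2 ≤ n ∧
        Q (Function.update μ d (e.val Γ.x μ)) (n - (e.cost + 2)) p := by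
  have e1 : (Exp.cst d).cost + e.cost + 1 = e.cost + 2 := by simp only [Exp.cost]; omega
  simp only [Cmd.set, vc, e1]
  constructor
  · rintro ⟨-, h1, -, h2, h3⟩; exact ⟨h1, h2, h3⟩
  · rintro ⟨h1, h2, h3⟩
    exact ⟨⟨by have := h.word; omega, by omega⟩, h1, h.cell d hd, h2, h3⟩

section

variable (Γ : Env) (c c' : Cmd) (d e f : Exp) (Q : Post) (μ : ℕ → ℕ) (n : ℕ) (p : ℝ)

@[simp] theorem vc_skip : vc Γ .skip Q μ n p ↔ Q μ n p := Iff.rfl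

@[simp] theorem vc_store : vc Γ (.store d e) Q μ n p ↔
    d.ok Γ μ 0 ∧ e.ok Γ μ 1 ∧ Γ.A (d.val Γ.x μ) ∧ d.cost + e.cost + 1 ≤ n ∧
      Q (Function.update μ (d.val Γ.x μ) (e.val Γ.x μ)) (n - (d.cost + e.cost + 1)) p := Iff.rfl

@[simp] theorem vc_rnd : vc Γ (.rnd d e) Q μ n p ↔ WP Γ (.rnd d e) Q μ n p := Iff.rfl

@[simp] theorem vc_seq : vc Γ (.seq c c') Q μ n p ↔ vc Γ c (vc Γ c' Q) μ n p := Iff.rfl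

@[simp] theorem vc_ite : vc Γ (.ite e f c c') Q μ n p ↔
    e.ok Γ μ 0 ∧ f.ok Γ μ 1 ∧ e.cost + f.cost + 2 ≤ n ∧
      (e.val Γ.x μ < f.val Γ.x μ → vc Γ c Q μ (n - (e.cost + f.cost + 2)) p) ∧
      (¬ e.val Γ.x μ < f.val Γ.x μ → vc Γ c' Q μ (n - (e.cost + f.cost + 2)) p) := Iff.rfl

@[simp] theorem vc_loop :
    vc Γ (.loop e f c) Q μ n p ↔ WP Γ (.loop e f c) Q μ n p := Iff.rfl

@[simp] theorem vc_call : vc Γ (.call c) Q μ n p ↔ WP Γ c Q μ n p := Iff.rfl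

@[simp] theorem vc_accept : vc Γ .accept Q μ n p ↔ Γ.Y ∧ p ≤ 1 ∧ 1 ≤ n := Iff.rfl

@[simp] theorem vc_reject : vc Γ .reject Q μ n p ↔ p ≤ 0 ∧ 1 ≤ n := Iff.rfl

end

end WordRAM

/-! ## Combinatorics of Job Interval Selection -/

/-- Every graph with an interval representation is `n`-compact. -/
theorem CompactRep.isCompactGraph {n c : ℕ} (R : CompactRep n c) : IsCompactGraph R.graph n := by
  classical
  -- Every end point is replaced by the number of intervals that start no later. This rank is at
  -- most `n` and jumps at each start point, so comparisons with start points, which decide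
  -- intersections, are preserved.
  let r : ℕ → ℕ := fun x => (Finset.univ.filter fun u => R.first u ≤ x).card
  have hmono : Monotone r := fun x y h => Finset.card_le_card fun u hu => by
    simp only [Finset.mem_filter, Finset.mem_univ, true_and] at hu ⊢
    exact hu.trans h
  have hlt : ∀ u y, y < R.first u → r y < r (R.first u) := fun u y h => by
    refine Finset.card_lt_card ⟨fun v hv => ?_, fun hs => ?_⟩
    · simp only [Finset.mem_filter, Finset.mem_univ, true_and] at hv ⊢
      omega
    · have := hs (Finset.mem_filter.mpr ⟨Finset.mem_univ u, le_rfl⟩)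
      simp only [Finset.mem_filter, Finset.mem_univ, true_and] at this
      omega
  have hr : ∀ u y, r (R.first u) ≤ r y ↔ R.first u ≤ y := fun u y =>
    ⟨fun h => by by_contra h'; exact absurd (hlt u y (by omega)) (by omega), fun h => hmono h⟩
  refine ⟨⟨fun v => r (R.first v), fun v => r (R.last v), fun v => ?_,
    fun v => hmono (R.first_le_last v), fun v => ?_, hmono.comp R.sorted⟩, ⟨⟨Equiv.refl _, ?_⟩⟩⟩
  · exact Finset.card_pos.mpr ⟨v, by simp⟩
  · exact (Finset.card_le_univ _).trans (by simp)
  · intro u v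
    simp only [Equiv.refl_apply, CompactRep.graph, Set.Icc_inter_Icc, Set.nonempty_Icc]
    have a1 := R.first_le_last u
    have a2 := R.first_le_last v
    have b1 := hmono a1
    have b2 := hmono a2
    simp only [le_inf_iff, sup_le_iff, hr]

namespace JobIntervalSelection

/-- The only use of the minimality of `c`. It makes all end points fit into words of logarithmic
length and `n + 1` a start point larger than any other. -/
theorem c_le_n (I : JobIntervalSelection) : I.c ≤ I.n := I.c_minimum _ I.rep.isCompactGraph

theorem last_le_n (I : JobIntervalSelection) (v : Fin I.n) : I.rep.last v ≤ I.n :=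
  (I.rep.last_le v).trans I.c_le_n

theorem first_le_n (I : JobIntervalSelection) (v : Fin I.n) : I.rep.first v ≤ I.n :=
  (I.rep.first_le_last v).trans (I.last_le_n v)

/-- A list of intervals, each of which ends before all later ones start. -/
def Chain (I : JobIntervalSelection) (l : List (Fin I.n)) : Prop :=
  l.Pairwise fun a b => I.rep.last a < I.rep.first b

/-- Vertex numbers follow the start points, so of two disjoint intervals the one with the smaller
number ends before the other starts. Listing an independent set by number therefore gives a chain.
-/
theorem isYes_iff (I : JobIntervalSelection) :
    I.IsYes ↔ ∃ l, I.Chain l ∧ l.length = I.k ∧ (l.map I.col).Nodup := by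
  constructor
  · rintro ⟨S, hk, hS, hc⟩
    refine ⟨S.sort (· ≤ ·), ?_, by simpa using hk, ?_⟩
    · have h1 : (S.sort (· ≤ ·)).Pairwise (· < ·) := Finset.sortedLT_sort S |>.pairwise
      refine (List.Pairwise.and_mem.mp h1).imp ?_
      rintro a b ⟨ha, hb, hab⟩
      rw [Finset.mem_sort] at ha hb
      have hadj := hS ha hb hab.ne
      simp only [CompactRep.graph, Set.Icc_inter_Icc, Set.nonempty_Icc] at hadj
      have h2 := I.rep.sorted hab.le
      have h3 := I.rep.first_le_last a
      have h4 := I.rep.first_le_last b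
      by_contra hcon
      exact hadj ⟨hab.ne, by simp only [le_inf_iff, sup_le_iff]; omega⟩
    · refine (List.nodup_map_iff_inj_on (Finset.sort_nodup _ _)).mpr fun x hx y hy h => ?_
      rw [Finset.mem_sort] at hx hy
      exact hc hx hy h
  · rintro ⟨l, hl, hk, hc⟩
    have hnd : l.Nodup := hc.of_map
    refine ⟨l.toFinset, by rw [List.toFinset_card_of_nodup hnd, hk], ?_, ?_⟩
    · have key : ∀ a b, I.rep.last a < I.rep.first b →
          ¬ I.rep.graph.Adj a b ∧ ¬ I.rep.graph.Adj b a := fun a b h => by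
        have : ¬ I.rep.graph.Adj a b := by
          simp only [CompactRep.graph, Set.Icc_inter_Icc, Set.nonempty_Icc, le_inf_iff,
            sup_le_iff]
          omega
        exact ⟨this, fun h' => this h'.symm⟩
      intro a ha b hb hab
      simp only [List.coe_toFinset, Set.mem_ofPred_eq] at ha hb
      have : ∀ (l : List (Fin I.n)), I.Chain l → a ∈ l → b ∈ l → ¬ I.rep.graph.Adj a b := by
        intro l hl ha hb
        induction l with
        | nil => simp at ha
        | cons c l ih =>
          obtain ⟨h1, h2⟩ := List.pairwise_cons.mp hl
          rcases List.mem_cons.mp ha with ha' | ha' <;> rcases List.mem_cons.mp hb with hb' | hb'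
          · exact absurd (ha'.trans hb'.symm) hab
          · exact (key _ _ (ha' ▸ h1 _ hb')).1
          · exact (key _ _ (hb' ▸ h1 _ ha')).2
          · exact ih h2 ha' hb'
      exact this l hl ha hb
    · intro a ha b hb h
      simp only [List.coe_toFinset, Set.mem_ofPred_eq] at ha hb
      exact List.inj_on_of_nodup_map hc ha hb h

theorem chain_cons {I : JobIntervalSelection} {v : Fin I.n} {l : List (Fin I.n)} :
    I.Chain (v :: l) ↔ (∀ u ∈ l, I.rep.last v < I.rep.first u) ∧ I.Chain l :=
  List.pairwise_cons

/-- The numbers of the `i`-th interval in the encoding. -/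
def triple (I : JobIntervalSelection) (v : Fin I.n) : List ℕ :=
  [I.rep.first v, I.rep.last v, (I.col v : ℕ) + 1]

theorem getD_flatMap_triple (I : JobIntervalSelection) (l : List (Fin I.n)) (i j : ℕ) (hj : j < 3)
    (hi : i < l.length) : (l.flatMap I.triple).getD (3 * i + j) 0 = (I.triple l[i]).getD j 0 := by
  induction l generalizing i with
  | nil => simp at hi
  | cons v l ih =>
    rw [List.flatMap_cons]
    cases i with
    | zero =>
      rw [List.getD_append _ _ _ _ (by simp [triple]; omega)]
      simp
    | succ i =>
      rw [List.getD_append_right _ _ _ _ (by simp [triple]; omega)]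
      have : 3 * (i + 1) + j - (I.triple v).length = 3 * i + j := by simp [triple]; omega
      rw [this, ih i (by simpa using hi)]
      rfl

theorem getD_encode (I : JobIntervalSelection) (v : Fin I.n) (j : ℕ) (hj : j < 3) :
    I.encode.getD (3 + (3 * v + j)) 0 = (I.triple v).getD j 0 := by
  rw [encode, List.getD_append_right _ _ _ _ (by simp)]
  have := I.getD_flatMap_triple (List.finRange I.n) v j hj (by simp)
  rw [show (List.finRange I.n)[(v : ℕ)]'(by simp) = v by simp] at this
  rw [← this, List.length_cons, List.length_cons, List.length_cons, List.length_nil,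
    Nat.zero_add, Nat.add_sub_cancel_left]
  rfl

end JobIntervalSelection

/-! ## Sets of bits -/

theorem testBit_sum_two_pow (T : Finset ℕ) (i : ℕ) :
    (∑ j ∈ T, 2 ^ j).testBit i = true ↔ i ∈ T := by
  rw [← Nat.mem_bitIndices, ← List.mem_toFinset, Finset.toFinset_bitIndices_sum_two_pow]

theorem eq_range_of_sum_two_pow {T : Finset ℕ} {k : ℕ} (h : ∑ j ∈ T, 2 ^ j = 2 ^ k - 1) :
    T = Finset.range k := by
  ext i
  rw [← testBit_sum_two_pow, h, Nat.testBit_two_pow_sub_one]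
  simp

theorem sum_two_pow_range (k : ℕ) : ∑ j ∈ Finset.range k, 2 ^ j = 2 ^ k - 1 := by
  have := Nat.geomSum_eq (m := 2) le_rfl k
  simpa using this

theorem two_pow_div_mod_two (m j : ℕ) : m / 2 ^ j % 2 = if m.testBit j then 1 else 0 := by
  have := Nat.testBit_eq_decide_div_mod_eq (x := m) (i := j)
  rcases Nat.mod_two_eq_zero_or_one (m / 2 ^ j) with h | h <;> simp [this, h]

theorem testBit_map_two_pow_sum {l : List ℕ} (h : l.Nodup) (j : ℕ) :
    (l.map (2 ^ ·)).sum.testBit j = true ↔ j ∈ l := by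
  have : (l.map (2 ^ ·)).sum = ∑ i ∈ l.toFinset, 2 ^ i := by
    rw [List.sum_toFinset _ h]
  rw [this, testBit_sum_two_pow, List.mem_toFinset]

theorem length_eq_of_map_two_pow_sum {l : List ℕ} {k : ℕ} (h : l.Nodup)
    (hk : (l.map (2 ^ ·)).sum = 2 ^ k - 1) : l.length = k := by
  have : (l.map (2 ^ ·)).sum = ∑ i ∈ l.toFinset, 2 ^ i := by
    rw [List.sum_toFinset _ h]
  rw [this] at hk
  rw [← List.toFinset_card_of_nodup h, eq_range_of_sum_two_pow hk, Finset.card_range]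

theorem map_two_pow_sum_of_length {l : List ℕ} {k : ℕ} (h : l.Nodup) (hl : ∀ j ∈ l, j < k)
    (hk : l.length = k) : (l.map (2 ^ ·)).sum = 2 ^ k - 1 := by
  have h1 : (l.map (2 ^ ·)).sum = ∑ i ∈ l.toFinset, 2 ^ i := by
    rw [List.sum_toFinset _ h]
  have h2 : l.toFinset = Finset.range k := by
    refine Finset.eq_of_subset_of_card_le (fun j hj => ?_) ?_
    · simpa using hl j (by simpa using hj)
    · rw [List.toFinset_card_of_nodup h, hk, Finset.card_range]
  rw [h1, h2, sum_two_pow_range]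

/-! ### Chains of intervals and the recursion for their label sets -/

namespace JobIntervalSelection

variable (I : JobIntervalSelection)

/-- There is a chain of intervals with numbers at least `v` that starts after `e` and whose
`g`-colors are pairwise distinct and form the set with mask `m`. -/
def Reach (g : Fin I.n → ℕ) (v e m : ℕ) : Prop :=
  ∃ l, I.Chain l ∧ (∀ u ∈ l, v ≤ (u : ℕ) ∧ e < I.rep.first u) ∧ (l.map g).Nodup ∧
    ((l.map g).map (2 ^ ·)).sum = m

variable {I}

theorem chain_cons_lt {v : Fin I.n} {l : List (Fin I.n)} (h : I.Chain (v :: l)) :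
    ∀ u ∈ l, v < u := fun u hu => by
  by_contra h'
  have h1 := (chain_cons.mp h).1 u hu
  have h2 := I.rep.sorted (not_lt.mp h')
  have h3 := I.rep.first_le_last v
  omega

/-- Chains of intervals with numbers at least `v` either avoid `v` or start with `v`. -/
theorem chain_cases {v : Fin I.n} {l : List (Fin I.n)} (hl : I.Chain l)
    (hv : ∀ u ∈ l, (v : ℕ) ≤ u) :
    (∀ u ∈ l, (v : ℕ) + 1 ≤ u) ∨ ∃ l', l = v :: l' ∧ I.Chain l' ∧
      ∀ u ∈ l', (v : ℕ) + 1 ≤ u ∧ I.rep.last v < I.rep.first u := by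
  cases l with
  | nil => exact .inl (by simp)
  | cons a l =>
    have h1 := chain_cons_lt hl
    rcases (hv a (by simp)).eq_or_lt with h | h
    · obtain rfl : v = a := Fin.ext h
      exact .inr ⟨l, rfl, (chain_cons.mp hl).2, fun u hu => ⟨h1 u hu, (chain_cons.mp hl).1 u hu⟩⟩
    · refine .inl fun u hu => ?_
      rcases List.mem_cons.mp hu with rfl | hu
      · exact h
      · have := h1 u hu; rw [Fin.lt_def] at this; omega

/-- A chain of intervals numbered from `v` on contains `v` at most as its first element. Removing it
leaves a chain that starts after the end of `v` and misses the label of `v`, so that its mask lacks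
this bit. -/
theorem reach_step (g : Fin I.n → ℕ) (v : Fin I.n) (e m : ℕ) :
    I.Reach g v e m ↔ I.Reach g (v + 1) e m ∨ ∃ m', m = m' + 2 ^ g v ∧ m'.testBit (g v) = false ∧
      e < I.rep.first v ∧ I.Reach g (v + 1) (I.rep.last v) m' := by
  constructor
  · rintro ⟨l, h1, h2, h3, h4⟩
    rcases chain_cases h1 (fun u hu => (h2 u hu).1) with h | ⟨l, rfl, h5, h6⟩
    · exact .inl ⟨l, h1, fun u hu => ⟨h u hu, (h2 u hu).2⟩, h3, h4⟩
    · simp only [List.map_cons, List.nodup_cons] at h3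
      refine .inr ⟨((l.map g).map (2 ^ ·)).sum, ?_, ?_, (h2 v (by simp)).2, l, h5, h6, h3.2, rfl⟩
      · rw [← h4, List.map_cons, List.map_cons, List.sum_cons, Nat.add_comm]
      · rw [← Bool.not_eq_true, testBit_map_two_pow_sum h3.2]; exact h3.1
  · rintro (⟨l, h1, h2, h3, h4⟩ | ⟨m', rfl, h0, he, l, h1, h2, h3, h4⟩)
    · exact ⟨l, h1, fun u hu => ⟨by have := (h2 u hu).1; omega, (h2 u hu).2⟩, h3, h4⟩
    · refine ⟨v :: l, chain_cons.mpr ⟨fun u hu => (h2 u hu).2, h1⟩, fun u hu => ?_, ?_, ?_⟩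
      · rcases List.mem_cons.mp hu with rfl | hu
        · exact ⟨le_rfl, he⟩
        · have a1 := h2 u hu
          have a2 := I.rep.first_le_last v
          exact ⟨by omega, by omega⟩
      · rw [List.map_cons, List.nodup_cons]
        refine ⟨?_, h3⟩
        rw [← testBit_map_two_pow_sum h3, h4, h0]; simp
      · rw [List.map_cons, List.map_cons, List.sum_cons, h4, Nat.add_comm]

/-- The full mask forces exactly `k` members. Since `g` depends on the color only, distinct labels
imply distinct colors, so collisions of hash values or labels can never cause a false positive. -/
theorem reach_full {g : Fin I.n → ℕ} (hg : ∀ v u, I.col v = I.col u → g v = g u)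
    (h : I.Reach g 0 0 (2 ^ I.k - 1)) : I.IsYes := by
  obtain ⟨l, h1, -, h3, h4⟩ := h
  refine I.isYes_iff.mpr ⟨l, h1, by simpa using length_eq_of_map_two_pow_sum h3 h4, ?_⟩
  refine (List.nodup_map_iff_inj_on h3.of_map).mpr fun x hx y hy hxy => ?_
  exact List.inj_on_of_nodup_map h3 hx hy (hg _ _ hxy)

theorem reach_top (g : Fin I.n → ℕ) (e m : ℕ) : I.Reach g I.n e m ↔ m = 0 := by
  constructor
  · rintro ⟨l, -, h2, -, h4⟩
    cases l with
    | nil => simpa using h4.symm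
    | cons u l => have := (h2 u (by simp)).1; have := u.2; omega
  · rintro rfl
    exact ⟨[], List.Pairwise.nil, by simp, by simp, by simp⟩

end JobIntervalSelection

/-! ### Update of the table for one interval -/

namespace JobIntervalSelection

open WordRAM WordRAM.Exp

variable (I : JobIntervalSelection)

/-- The update of the table of the dynamic program for one interval `[start, end]`, given in cells
`23` and `24`, whose color has the mask in cell `25`. -/
def tableStep : Cmd :=
  .seq (.set 26 0) <| .loop (v 26) (v 10) <|
    .seq (.ite 0 (v 26 / v 25 % 2) .skip
      (.ite (v 24) (ld (v 13 + v 26))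
        (.ite (ld (v 13 + (v 26 + v 25))) (v 23) (.store (v 13 + (v 26 + v 25)) (v 23)) .skip)
        .skip))
    (.set 26 (v 26 + 1))

/-- The memory content that the randomized algorithm does not change after its initialization. -/
structure Static (μ : ℕ → ℕ) : Prop where
  c8 : μ 8 = I.n
  c9 : μ 9 = I.k
  c10 : μ 10 = 2 ^ I.k
  c11 : μ 11 = I.γ + 1
  c12 : μ 12 = (I.γ + 1) * (32 * 2 ^ I.k)
  c13 : μ 13 = 64 + I.k
  c14 : μ 14 = 64 + I.k + 2 ^ I.k
  pow : ∀ j < I.k, μ (64 + j) = 2 ^ j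

variable {I}

theorem Static.update {μ : ℕ → ℕ} (h : I.Static μ) {a b : ℕ}
    (ha : 15 ≤ a ∧ (a < 64 ∨ 64 + I.k ≤ a)) : I.Static (Function.update μ a b) := by
  have key : ∀ c, c < 15 ∨ (64 ≤ c ∧ c < 64 + I.k) → Function.update μ a b c = μ c := fun c hc =>
    Function.update_of_ne (by omega) _ _
  refine ⟨?_, ?_, ?_, ?_, ?_, ?_, ?_, fun j hj => ?_⟩ <;> rw [key _ (by omega)]
  exacts [h.c8, h.c9, h.c10, h.c11, h.c12, h.c13, h.c14, h.pow j hj]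

theorem Static.congr {μ ν : ℕ → ℕ} (h : I.Static μ)
    (hν : ∀ c, c < 15 ∨ (64 ≤ c ∧ c < 64 + I.k) → ν c = μ c) : I.Static ν := by
  refine ⟨?_, ?_, ?_, ?_, ?_, ?_, ?_, fun j hj => ?_⟩ <;> rw [hν _ (by omega)]
  exacts [h.c8, h.c9, h.c10, h.c11, h.c12, h.c13, h.c14, h.pow j hj]

end JobIntervalSelection

theorem add_two_pow_lt {m j k : ℕ} (hm : m < 2 ^ k) (hj : j < k) (h : m.testBit j = false) :
    m + 2 ^ j < 2 ^ k := by
  have h1 := two_pow_div_mod_two m j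
  rw [h] at h1
  simp only [Bool.false_eq_true, if_false] at h1
  obtain ⟨c, rfl⟩ : ∃ c, k = j + 1 + c := ⟨k - (j + 1), by omega⟩
  have h2 := Nat.div_add_mod m (2 ^ j)
  have h3 := Nat.mod_lt m (Nat.two_pow_pos j)
  have h4 := Nat.div_add_mod (m / 2 ^ j) 2
  rw [h1] at h4
  set a := m / 2 ^ j / 2
  rw [← h4] at h2
  have e : 2 ^ (j + 1 + c) = 2 ^ j * (2 * 2 ^ c) := by ring
  rw [e] at hm ⊢
  have h5 : a < 2 ^ c := by
    by_contra hc
    have : 2 ^ j * (2 * 2 ^ c) ≤ 2 ^ j * (2 * a + 0) := Nat.mul_le_mul_left _ (by omega)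
    omega
  have : 2 ^ j * (2 * a + 0 + 2) ≤ 2 ^ j * (2 * 2 ^ c) := Nat.mul_le_mul_left _ (by omega)
  rw [Nat.mul_add] at this
  omega

namespace JobIntervalSelection

open WordRAM WordRAM.Exp

variable {I : JobIntervalSelection}

/-- The environment of the randomized algorithm admits all cells that it needs, and its numbers fit
into a word. -/
structure RandEnv (I : JobIntervalSelection) (E : ℕ) (Γ : Env) : Prop where
  std : Γ.Std
  input : Γ.x = E :: I.encode
  cell : ∀ a < 64 + 34 * 2 ^ I.k, Γ.A a
  yes : Γ.Y ↔ I.IsYes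
  fit1 : 3 * I.n + 16 ≤ 2 ^ Γ.w
  fit2 : E < 2 ^ Γ.w
  fit3 : 4 * 11 ^ I.k * (E.size + 1) < 2 ^ Γ.w
  fit4 : (I.γ + 1) * (32 * 2 ^ I.k) * (I.γ + 1) < 2 ^ Γ.w
  fit5 : 64 + 34 * 2 ^ I.k < 2 ^ Γ.w

/-- The update can be done in place: only masks without the bit `j` serve as sources, and only masks
with this bit are changed, so new entries never feed into each other. Describing an entry by the
numbers `e` below it turns the maximum into a disjunction. -/
theorem tableStep_spec {E : ℕ} {Γ : Env} (hΓ : I.RandEnv E Γ) {μ : ℕ → ℕ} (hμ : I.Static μ)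
    {j : ℕ} (hj : j < I.k) (h25 : μ 25 = 2 ^ j) :
    HT Γ tableStep μ (60 * 2 ^ I.k + 10) fun μ' =>
      (∀ a, a ≠ 26 → (a < 64 + I.k ∨ 64 + I.k + 2 ^ I.k ≤ a) → μ' a = μ a) ∧
      ∀ m < 2 ^ I.k, ∀ e, e < μ' (64 + I.k + m) ↔ (e < μ (64 + I.k + m) ∨ ∃ m' < 2 ^ I.k,
        m = m' + 2 ^ j ∧ m'.testBit j = false ∧ μ 24 < μ (64 + I.k + m') ∧ e < μ 23) := by
  intro p
  have hS := hΓ.std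
  have hk : I.k < 2 ^ I.k := Nat.lt_two_pow_self
  have hw := hΓ.fit5
  refine .of_vc ?_
  simp [tableStep, vc_set hS, ok_ofNat hS]
  refine WP.loop (fun i ν p' => p' = p ∧ i ≤ 2 ^ I.k ∧ ν 26 = 2 ^ I.k - i ∧
    (∀ a, a ≠ 26 → (a < 64 + I.k ∨ 64 + I.k + 2 ^ I.k ≤ a) → ν a = μ a) ∧
      ∀ m < 2 ^ I.k, ∀ e, e < ν (64 + I.k + m) ↔ (e < μ (64 + I.k + m) ∨ ∃ m' < 2 ^ I.k - i,
        m = m' + 2 ^ j ∧ m'.testBit j = false ∧ μ 24 < μ (64 + I.k + m') ∧ e < μ 23))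
    (2 ^ I.k) 54 ?_ ?_ ?_ ?_ ?_
  · refine ⟨rfl, le_rfl, by simp, fun a ha _ => Function.update_of_ne ha _ _, fun m hm e => ?_⟩
    rw [Function.update_of_ne (by omega)]
    simp
  · rintro i ν p' ⟨-, hi, h26, hfr, -⟩
    have e10 : ν 10 = 2 ^ I.k := (hfr 10 (by omega) (by omega)).trans hμ.c10
    simp [ok_v hS, e10, h26]
  · simp; omega
  · rintro i ν p' ⟨rfl, hi, h26, hfr, hF⟩
    refine .of_vc ?_
    have e10 : ν 10 = 2 ^ I.k := (hfr 10 (by omega) (by omega)).trans hμ.c10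
    have e13 : ν 13 = 64 + I.k := (hfr 13 (by omega) (by omega)).trans hμ.c13
    have e25 : ν 25 = 2 ^ j := (hfr 25 (by omega) (by omega)).trans h25
    have e24 : ν 24 = μ 24 := (hfr 24 (by omega) (by omega))
    have e23 : ν 23 = μ 23 := (hfr 23 (by omega) (by omega))
    obtain ⟨m, hm⟩ : ∃ m, 2 ^ I.k - (i + 1) = m := ⟨_, rfl⟩
    have hm' : 2 ^ I.k - i = m + 1 := by omega
    rw [hm] at h26 hF
    -- A source mask still has its old entry, because every mask of the form `m' + 2 ^ j` changed so
    -- far contains the bit `j`.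
    have hFm : ν (64 + I.k + m) = μ (64 + I.k + m) ∨ m.testBit j = true := by
      by_cases hb : m.testBit j = true
      · exact .inr hb
      refine .inl (eq_of_forall_lt_iff fun e => ?_)
      rw [hF m (by omega)]
      refine ⟨fun h => h.resolve_right ?_, .inl⟩
      rintro ⟨m', h1, rfl, h2, -⟩
      rw [Nat.add_comm, Nat.testBit_two_pow_add_eq, h2] at hb
      simp at hb
    simp [vc_set hS, ok_ofNat hS, ok_v hS, e13, e25, e24, e23, h26, two_pow_div_mod_two]
    refine ⟨fun hb => ?_, fun hb => ⟨⟨by omega, by omega, hΓ.cell _ (by omega)⟩, ?_, ?_⟩⟩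
    · refine ⟨by omega, by omega, by omega, fun a h1 h2 => ?_, fun m1 hm1 e => ?_⟩
      · rw [Function.update_of_ne h1, hfr a h1 h2]
      · rw [Function.update_of_ne (by omega), hF m1 hm1, hm']
        refine or_congr_right ⟨fun ⟨m', h1, h2⟩ => ⟨m', by omega, h2⟩, fun ⟨m', h1, h2, h3, h4⟩ => ?_⟩
        refine ⟨m', ?_, h2, h3, h4⟩
        rcases Nat.lt_succ_iff_lt_or_eq.mp h1 with h1 | rfl
        · exact h1
        · rw [h3] at hb; simp at hb
    · have hlt := add_two_pow_lt (show m < 2 ^ I.k by omega) hj hb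
      rw [hb, Bool.false_eq_true, or_false] at hFm
      intro hlast
      rw [hFm] at hlast
      refine ⟨⟨⟨by omega, by omega⟩, by omega, hΓ.cell _ (by omega)⟩, fun h1 => ?_, fun h1 => ?_⟩
      · refine ⟨⟨by omega, by omega⟩, hΓ.cell _ (by omega), ?_⟩
        have e26 : ¬ 26 = 64 + I.k + (m + 2 ^ j) := by omega
        rw [Function.update_of_ne e26, h26]
        refine ⟨by omega, by omega, by omega, fun a h3 h4 => ?_, fun m1 hm1 e => ?_⟩
        · rw [Function.update_of_ne h3, Function.update_of_ne (by omega), hfr a h3 h4]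
        · rw [Function.update_of_ne (by omega), hm']
          by_cases hmm : m1 = m + 2 ^ j
          · subst hmm
            rw [Function.update_self]
            have h2 := hF _ hm1 e
            constructor
            · intro h5; exact .inr ⟨m, by omega, rfl, hb, hlast, h5⟩
            · rintro (h5 | ⟨m', -, -, -, -, h5⟩)
              · have := h2.mpr (.inl h5); omega
              · exact h5
          · rw [Function.update_of_ne (by omega), hF m1 hm1]
            refine or_congr_right ⟨fun ⟨m', h1, h2⟩ => ⟨m', by omega, h2⟩, fun ⟨m', h1, h2, h3⟩ => ?_⟩
            refine ⟨m', ?_, h2, h3⟩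
            rcases Nat.lt_succ_iff_lt_or_eq.mp h1 with h1 | rfl
            · exact h1
            · exact absurd h2 hmm
      · refine ⟨by omega, by omega, by omega, fun a h3 h4 => ?_, fun m1 hm1 e => ?_⟩
        · rw [Function.update_of_ne h3, hfr a h3 h4]
        · rw [Function.update_of_ne (by omega), hF m1 hm1, hm']
          constructor
          · rintro (h5 | ⟨m', h5, h6⟩)
            exacts [.inl h5, .inr ⟨m', by omega, h6⟩]
          · rintro (h5 | ⟨m', h5, h6, h7, h8, h9⟩)
            · exact .inl h5
            · rcases Nat.lt_succ_iff_lt_or_eq.mp h5 with h5 | rfl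
              · exact .inr ⟨m', h5, h6, h7, h8, h9⟩
              · refine (hF m1 hm1 e).mp ?_
                rw [h6]; omega
    · intro hlast
      rw [hb, Bool.false_eq_true, or_false] at hFm
      rw [hFm] at hlast
      refine ⟨by omega, by omega, by omega, fun a h3 h4 => ?_, fun m1 hm1 e => ?_⟩
      · rw [Function.update_of_ne h3, hfr a h3 h4]
      · rw [Function.update_of_ne (by omega), hF m1 hm1, hm']
        refine or_congr_right ⟨fun ⟨m', h1, h2⟩ => ⟨m', by omega, h2⟩,
          fun ⟨m', h1, h2, h3, h4, h5⟩ => ?_⟩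
        refine ⟨m', ?_, h2, h3, h4, h5⟩
        rcases Nat.lt_succ_iff_lt_or_eq.mp h1 with h1 | rfl
        · exact h1
        · omega
  · rintro ν p' ⟨rfl, -, -, hfr, hF⟩
    exact ⟨⟨hfr, by simpa using hF⟩, rfl⟩

end JobIntervalSelection

/-! ## A hash function -/

/-- The hash value of `x` under the multiplier `r`, with values below `m`. -/
def hashIdx (B m r x : ℕ) : ℕ := r * x % (B * m) / B

theorem hashIdx_lt {B m : ℕ} (hB : 0 < B) (hm : 0 < m) (r x : ℕ) : hashIdx B m r x < m := by
  exact Nat.div_lt_of_lt_mul (Nat.mod_lt _ (Nat.mul_pos hB hm))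

theorem card_le_of_dist_le {T : Finset ℕ} {d : ℕ} (h : ∀ a ∈ T, ∀ b ∈ T, a ≤ b + d) :
    T.card ≤ d + 1 := by
  rcases T.eq_empty_or_nonempty with rfl | hT
  · simp
  have : T ⊆ Finset.Icc (T.min' hT) (T.min' hT + d) := fun a ha =>
    Finset.mem_Icc.mpr ⟨T.min'_le a ha, h a ha _ (T.min'_mem hT)⟩
  have := Finset.card_le_card this
  rw [Nat.card_Icc] at this
  omega

/-- With `M = B * m`, equal hash values force `r * z` to lie within `B` of a multiple `q * M`, where
`q ≤ z`. For fixed `q` such `r` differ by at most `2 * B / z`, which leaves `(z + 1) * (2 * B / z +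
1) ≤ 5 * B` multipliers in all. The collision probability is thus at most `5 / m`, without any prime
modulus. -/
theorem card_hashIdx_eq_le {B m x z : ℕ} (hz : 0 < z) (hzB : z < B) (hm : 0 < m) :
    ((Finset.range (B * m)).filter fun r =>
      hashIdx B m r x = hashIdx B m r (x + z)).card ≤ 5 * B := by
  have hB : 0 < B := by omega
  set M := B * m with hM
  have hBM : B ≤ M := Nat.le_mul_of_pos_right B hm
  have hsub : ((Finset.range M).filter fun r => hashIdx B m r x = hashIdx B m r (x + z)) ⊆
      (Finset.range (z + 1)).biUnion fun q =>
        (Finset.range M).filter fun r => q * M < r * z + B ∧ r * z < q * M + B := by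
    intro r hr
    simp only [Finset.mem_filter, Finset.mem_range, hashIdx, ← hM] at hr
    obtain ⟨hr, he⟩ := hr
    have h1 := Nat.div_add_mod (r * x) M
    have h2 := Nat.div_add_mod (r * (x + z)) M
    have h3 := Nat.div_add_mod (r * x % M) B
    have h4 := Nat.div_add_mod (r * (x + z) % M) B
    have h5 := Nat.mod_lt (r * x % M) hB
    have h6 := Nat.mod_lt (r * (x + z) % M) hB
    rw [← he] at h4
    have h7 : r * x / M ≤ r * (x + z) / M := Nat.div_le_div_right (by nlinarith)
    obtain ⟨q, hq⟩ := Nat.exists_eq_add_of_le h7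
    have h8 : r * (x + z) = r * x + r * z := by ring
    have h9 : M * (r * (x + z) / M) = M * (r * x / M) + q * M := by rw [hq]; ring
    have h10 : q * M < r * z + B := by omega
    have h11 : r * z < q * M + B := by omega
    have h12 : q < z + 1 := by
      by_contra hc
      have : (z + 1) * M ≤ q * M := Nat.mul_le_mul_right _ (by omega)
      have : (r + 1) * z ≤ M * z := Nat.mul_le_mul_right _ (by omega)
      nlinarith
    simp only [Finset.mem_biUnion, Finset.mem_range, Finset.mem_filter]
    exact ⟨q, h12, hr, h10, h11⟩
  refine (Finset.card_le_card hsub).trans (Finset.card_biUnion_le.trans ?_)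
  have hq : ∀ q ∈ Finset.range (z + 1), ((Finset.range M).filter fun r =>
      q * M < r * z + B ∧ r * z < q * M + B).card ≤ 2 * B / z + 1 := by
    intro q _
    refine card_le_of_dist_le fun a ha b hb => ?_
    simp only [Finset.mem_filter] at ha hb
    by_contra hc
    have h1 : (b + 2 * B / z + 1) * z ≤ a * z := Nat.mul_le_mul_right _ (by omega)
    have h2 := Nat.div_add_mod (2 * B) z
    have h3 := Nat.mod_lt (2 * B) hz
    nlinarith [ha.2.1, ha.2.2, hb.2.1, hb.2.2]
  refine (Finset.sum_le_card_nsmul _ _ _ hq).trans ?_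
  rw [Finset.card_range, smul_eq_mul]
  have h1 : z * (2 * B / z) ≤ 2 * B := Nat.mul_div_le _ _
  have h2 : 2 * B / z ≤ 2 * B := Nat.div_le_self _ _
  nlinarith

theorem sq_le_two_pow_succ (k : ℕ) : k * k ≤ 2 ^ (k + 1) := by
  rcases lt_or_ge k 4 with h | h
  · interval_cases k <;> norm_num
  · induction k, h using Nat.le_induction with
    | base => norm_num
    | succ k hk ih => rw [pow_succ]; nlinarith

/-- At least half of the multipliers separate a given set of at most `k` numbers. -/
theorem card_injOn_hashIdx {γ k : ℕ} {X : Finset ℕ} (hX : ∀ x ∈ X, x ≤ γ) (hk : X.card ≤ k) :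
    (γ + 1) * (32 * 2 ^ k) ≤ 2 * ((Finset.range ((γ + 1) * (32 * 2 ^ k))).filter fun r =>
      ∀ x ∈ X, ∀ y ∈ X, hashIdx (γ + 1) (32 * 2 ^ k) r x = hashIdx (γ + 1) (32 * 2 ^ k) r y →
        x = y).card := by
  classical
  set m := 32 * 2 ^ k with hm
  set B := γ + 1 with hB
  have hm0 : 0 < m := by positivity
  have h1 := Finset.card_filter_add_card_filter_not (s := Finset.range (B * m))
    (fun r => ∀ x ∈ X, ∀ y ∈ X, hashIdx B m r x = hashIdx B m r y → x = y)
  have h2 : ((Finset.range (B * m)).filter fun r =>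
      ¬ ∀ x ∈ X, ∀ y ∈ X, hashIdx B m r x = hashIdx B m r y → x = y) ⊆
      (X.offDiag).biUnion fun q =>
        (Finset.range (B * m)).filter fun r => hashIdx B m r q.1 = hashIdx B m r q.2 := by
    intro r hr
    simp only [Finset.mem_filter, not_forall] at hr
    obtain ⟨hr, x, hx, y, hy, h, hne⟩ := hr
    simp only [Finset.mem_biUnion, Finset.mem_filter, Finset.mem_offDiag]
    exact ⟨(x, y), ⟨hx, hy, hne⟩, hr, h⟩
  have h3 : ∀ q ∈ X.offDiag, ((Finset.range (B * m)).filter fun r =>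
      hashIdx B m r q.1 = hashIdx B m r q.2).card ≤ 5 * B := by
    rintro ⟨x, y⟩ hq
    simp only [Finset.mem_offDiag] at hq
    obtain ⟨hx, hy, hne⟩ := hq
    have hx' := hX x hx
    have hy' := hX y hy
    rcases lt_or_gt_of_ne hne with h | h
    · have := card_hashIdx_eq_le (B := B) (m := m) (x := x) (z := y - x) (by omega) (by omega) hm0
      rwa [show x + (y - x) = y by omega] at this
    · have := card_hashIdx_eq_le (B := B) (m := m) (x := y) (z := x - y) (by omega) (by omega) hm0
      rw [show y + (x - y) = x by omega] at this
      simpa only [eq_comm] using this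
  have h4 := (Finset.card_le_card h2).trans (Finset.card_biUnion_le.trans
    (Finset.sum_le_card_nsmul _ _ _ h3))
  rw [smul_eq_mul, Finset.offDiag_card] at h4
  rw [Finset.card_range] at h1
  have h5 : X.card * X.card - X.card ≤ 2 ^ (k + 1) :=
    (Nat.sub_le _ _).trans ((Nat.mul_le_mul hk hk).trans (sq_le_two_pow_succ k))
  have h6 := Nat.mul_le_mul_right (5 * B) h5
  -- Union bound: at most `k * k ≤ 2 ^ (k + 1)` ordered pairs with `5 * B` bad multipliers each give
  -- `10 * 2 ^ k * B`, less than half of `32 * 2 ^ k * B`. The factor 32 is chosen for this.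
  have h7 : 2 ^ (k + 1) * (5 * B) * 2 ≤ B * m := by
    rw [hm, pow_succ]; nlinarith [Nat.zero_le (2 ^ k * B)]
  omega

/-! ## Numerical facts -/

/-- `k ^ k / k!` is a single term of the exponential series of `e ^ k`. -/
theorem exp_neg_le_factorial_div (k : ℕ) :
    Real.exp (-k) ≤ (k.factorial : ℝ) / (k : ℝ) ^ k := by
  rcases Nat.eq_zero_or_pos k with rfl | hk
  · simp
  have h := Real.pow_div_factorial_le_exp (x := (k : ℝ)) (by positivity) k
  have h1 : (0 : ℝ) < (k : ℝ) ^ k := by positivity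
  have h2 : (0 : ℝ) < k.factorial := by positivity
  rw [Real.exp_neg, ← inv_div]
  exact inv_anti₀ (by positivity) h

/-- The number of trials of the randomized algorithm. -/
def numTrials (k E : ℕ) : ℕ := 2 * (11 ^ k / 4 ^ k + 1) * E.size

/-- The success probability `q` of a trial is at least `e ^ (-k) / 2`, and the first factors of
`numTrials` exceed `2 * (11/4) ^ k ≥ 2 * e ^ k`, the summand 1 making up for the rounded quotient.
Hence `q * T ≥ E.size ≥ ln (1/ε)` for the number `T` of trials, and `(1 - q) ^ T ≤ exp (-q * T)`. -/
theorem pow_numTrials_le {k E : ℕ} {ε : ℝ} (hε : 0 < ε) (hE : 1 / ε ≤ E) :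
    (1 - 1 / 2 * ((k.factorial : ℝ) / (k : ℝ) ^ k)) ^ numTrials k E ≤ ε := by
  set q := 1 / 2 * ((k.factorial : ℝ) / (k : ℝ) ^ k) with hq
  have hq1 : q ≤ 1 := by
    have h1 : (k.factorial : ℝ) ≤ (k : ℝ) ^ k := by exact_mod_cast Nat.factorial_le_pow k
    have : (k.factorial : ℝ) / (k : ℝ) ^ k ≤ 1 := div_le_one_of_le₀ h1 (by positivity)
    linarith
  have hE0 : (0 : ℝ) < E := lt_of_lt_of_le (by positivity) hE
  have h1 : Real.exp k ≤ 11 ^ k / 4 ^ k := by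
    rw [← div_pow, ← mul_one (k : ℝ), Real.exp_nat_mul]
    refine pow_le_pow_left₀ (Real.exp_pos _).le ?_ k
    have := Real.exp_one_lt_d9
    linarith
  have h2 : (11 : ℝ) ^ k / 4 ^ k ≤ (11 ^ k / 4 ^ k + 1 : ℕ) := by
    have := Nat.lt_floor_add_one ((11 : ℝ) ^ k / 4 ^ k)
    have h3 : ⌊(11 : ℝ) ^ k / 4 ^ k⌋₊ = 11 ^ k / 4 ^ k := by
      have := Nat.floor_div_natCast ((11 ^ k : ℕ) : ℝ) (4 ^ k)
      rw [Nat.floor_natCast] at this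
      push_cast at this
      exact this
    rw [h3] at this
    push_cast
    exact this.le
  have h3 : Real.log E ≤ E.size := by
    have h4 : E ≤ 2 ^ E.size := (Nat.lt_size_self E).le
    have h5 : (E : ℝ) ≤ 2 ^ E.size := by exact_mod_cast h4
    refine (Real.log_le_log hE0 h5).trans ?_
    rw [Real.log_pow]
    have := Real.log_two_lt_d9
    have h6 : (0 : ℝ) ≤ E.size := by positivity
    nlinarith
  have h4 : -Real.log ε ≤ Real.log E := by
    rw [← Real.log_inv, ← one_div]
    exact Real.log_le_log (by positivity) hE
  have h5 : 1 ≤ Real.exp (-k) * (11 ^ k / 4 ^ k + 1 : ℕ) := by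
    rw [Real.exp_neg, inv_mul_eq_div, le_div_iff₀ (Real.exp_pos _), one_mul]
    exact h1.trans h2
  have h6 : (E.size : ℝ) ≤ q * numTrials k E := by
    have := exp_neg_le_factorial_div k
    have h7 : (0 : ℝ) ≤ E.size := by positivity
    have h8 : (0 : ℝ) ≤ (11 ^ k / 4 ^ k + 1 : ℕ) := by positivity
    have h9 : 1 ≤ ((k.factorial : ℝ) / (k : ℝ) ^ k) * (11 ^ k / 4 ^ k + 1 : ℕ) :=
      h5.trans (mul_le_mul_of_nonneg_right this h8)
    rw [numTrials, hq, Nat.cast_mul, Nat.cast_mul, Nat.cast_ofNat]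
    nlinarith
  calc (1 - q) ^ numTrials k E ≤ Real.exp (-q) ^ numTrials k E := by
        refine pow_le_pow_left₀ (by linarith) ?_ _
        have := Real.add_one_le_exp (-q)
        linarith
    _ = Real.exp (-(q * numTrials k E)) := by rw [← Real.exp_nat_mul]; congr 1; ring
    _ ≤ Real.exp (Real.log ε) := Real.exp_le_exp.mpr (by linarith)
    _ = ε := Real.exp_log hε

theorem numTrials_le (k E : ℕ) : (numTrials k E : ℝ) ≤ 4 * (11 / 4 : ℝ) ^ k * E.size := by
  have h1 : ((11 ^ k / 4 ^ k : ℕ) : ℝ) ≤ (11 / 4 : ℝ) ^ k := by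
    have := Nat.cast_div_le (α := ℝ) (m := 11 ^ k) (n := 4 ^ k)
    push_cast at this
    rwa [div_pow]
  have h2 : (1 : ℝ) ≤ (11 / 4 : ℝ) ^ k := one_le_pow₀ (by norm_num)
  have h3 : (0 : ℝ) ≤ E.size := by positivity
  rw [numTrials]
  push_cast
  nlinarith

/-- The bit length replaces the logarithm because a word RAM can compute it by halving. From `⌈1/ε⌉
≤ 2/ε` the bit length minus one is at most `1 + |ln ε| / ln 2`. -/
theorem size_le_max_one_log {ε : ℝ} (hε : 0 < ε) (h1 : ε < 1) :
    ((⌈1 / ε⌉₊).size : ℝ) ≤ 4 * max 1 |Real.log ε| := by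
  set E := ⌈1 / ε⌉₊ with hE
  have h2 : 1 < 1 / ε := by rw [lt_div_iff₀ hε]; linarith
  have h3 : (E : ℝ) < 1 / ε + 1 := Nat.ceil_lt_add_one (by positivity)
  have hE0 : 0 < E := Nat.ceil_pos.mpr (by positivity)
  obtain ⟨s, hs⟩ : ∃ s, E.size = s + 1 := ⟨E.size - 1, by have := Nat.size_pos.mpr hE0; omega⟩
  have h4 : 2 ^ s ≤ E := by
    rw [← Nat.lt_size, hs]; omega
  have h5 : (2 : ℝ) ^ s ≤ E := by exact_mod_cast h4
  have h6 : s * Real.log 2 ≤ Real.log 2 + |Real.log ε| := by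
    rw [← Real.log_pow, abs_of_neg (Real.log_neg hε h1), ← Real.log_inv, ← Real.log_mul (by norm_num)
      (by positivity)]
    refine Real.log_le_log (by positivity) ?_
    rw [← one_div]
    linarith
  have h7 := Real.log_two_gt_d9
  rw [hs]
  push_cast
  have h8 := le_max_left 1 |Real.log ε|
  have h9 := le_max_right 1 |Real.log ε|
  have h10 : 0 ≤ (s : ℝ) := by positivity
  by_contra hc
  push Not at hc
  nlinarith

/-! ### The dynamic program over all intervals -/

namespace JobIntervalSelection

open WordRAM WordRAM.Exp

/-- Process all intervals, from the last to the first, with the hash function given by the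
multiplier in cell `21` and the random table. -/
def tableLoop : Cmd :=
  .seq (.set 22 (v 8)) <| .loop 0 (v 22) <|
    .seq (.set 22 (v 22 - 1)) <|
    .seq (.set 23 (inp (4 + 3 * v 22))) <|
    .seq (.set 24 (inp (5 + 3 * v 22))) <|
    .seq (.set 25 (ld (v 14 + v 21 * inp (6 + 3 * v 22) % v 12 / v 11))) (.call tableStep)

variable {I : JobIntervalSelection}

/-- The table of the dynamic program is empty. -/
def TableInit (I : JobIntervalSelection) (μ : ℕ → ℕ) : Prop :=
  μ (64 + I.k) = I.n + 1 ∧ ∀ m < 2 ^ I.k, 0 < m → μ (64 + I.k + m) = 0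

/-- The random table contains powers of two, with exponents `τ`. -/
def RandTable (I : JobIntervalSelection) (τ : ℕ → ℕ) (i : ℕ) (μ : ℕ → ℕ) : Prop :=
  ∀ j < i, τ j < I.k ∧ μ (64 + I.k + 2 ^ I.k + j) = 2 ^ τ j

/-- The color of an interval in the dynamic program. -/
def hashColor (I : JobIntervalSelection) (τ : ℕ → ℕ) (r : ℕ) (u : Fin I.n) : ℕ :=
  τ (hashIdx (I.γ + 1) (32 * 2 ^ I.k) r (I.col u + 1))

theorem RandEnv.getD {E : ℕ} {Γ : Env} (hΓ : I.RandEnv E Γ) (u : Fin I.n) (j : ℕ) (hj : j < 3) :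
    Γ.x[4 + j + 3 * (u : ℕ)]?.getD 0 = (I.triple u).getD j 0 := by
  have : 4 + j + 3 * (u : ℕ) = (3 + (3 * u + j)) + 1 := by omega
  rw [hΓ.input, this, List.getElem?_cons_succ, ← I.getD_encode u j hj]
  simp

/-- With `i` intervals left, `e` lies below the entry of `m` exactly if `Reach` holds from `i` on;
`tableStep` performs the recursion `reach_step`. The empty mask has the entry `n + 1` in place of
infinity, whence the restriction `e ≤ n`, which all end points satisfy. -/
theorem tableLoop_spec {E : ℕ} {Γ : Env} (hΓ : I.RandEnv E Γ) {μ : ℕ → ℕ} (hμ : I.Static μ)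
    {r : ℕ} (hr : r < (I.γ + 1) * (32 * 2 ^ I.k)) (h21 : μ 21 = r) {τ : ℕ → ℕ}
    (hτ : I.RandTable τ (32 * 2 ^ I.k) μ) (hF : I.TableInit μ) :
    HT Γ tableLoop μ (I.n * (60 * 2 ^ I.k + 100) + 10) fun μ' =>
      (∀ a, (a < 22 ∨ 26 < a) → (a < 64 + I.k ∨ 64 + I.k + 2 ^ I.k ≤ a) → μ' a = μ a) ∧
      ∀ m < 2 ^ I.k, ∀ e ≤ I.n, e < μ' (64 + I.k + m) ↔ I.Reach (I.hashColor τ r) 0 e m := by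
  intro p
  have hS := hΓ.std
  have hk : I.k < 2 ^ I.k := Nat.lt_two_pow_self
  have hw := hΓ.fit5
  have hw1 := hΓ.fit1
  refine .of_vc ?_
  simp [tableLoop, vc_set hS, ok_v hS]
  refine WP.loop (fun i ν p' => p' = p ∧ i ≤ I.n ∧ ν 22 = i ∧
    (∀ a, (a < 22 ∨ 26 < a) → (a < 64 + I.k ∨ 64 + I.k + 2 ^ I.k ≤ a) → ν a = μ a) ∧
      ∀ m < 2 ^ I.k, ∀ e ≤ I.n, e < ν (64 + I.k + m) ↔ I.Reach (I.hashColor τ r) i e m)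
    I.n (60 * 2 ^ I.k + 90) ?_ ?_ ?_ ?_ ?_
  · refine ⟨rfl, le_rfl, by simp [hμ.c8], fun a ha _ => Function.update_of_ne (by omega) _ _,
      fun m hm e he => ?_⟩
    rw [Function.update_of_ne (by omega), reach_top]
    rcases Nat.eq_zero_or_pos m with rfl | h0
    · rw [Nat.add_zero, hF.1]; simp; omega
    · rw [hF.2 m hm h0]; simp; omega
  · rintro i ν p' ⟨-, hi, h22, -, -⟩
    simp [ok_v hS, ok_ofNat hS, h22]
  · have : I.n * (60 * 2 ^ I.k + 100) = I.n * (60 * 2 ^ I.k + 90 + 5) + I.n * 5 := by ring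
    simp only [cost_ofNat, cost_v, Nat.reduceAdd]; omega
  · rintro i ν p' ⟨rfl, hi, h22, hfr, hF⟩
    refine .of_vc ?_
    have hν : I.Static ν := hμ.congr fun c hc => hfr c (by omega) (by omega)
    have e21 : ν 21 = r := (hfr 21 (by omega) (by omega)).trans h21
    set u : Fin I.n := ⟨i, by omega⟩ with hu
    have hi' : i = (u : ℕ) := rfl
    have x4 : Γ.x[4 + 3 * i]?.getD 0 = I.rep.first u := hΓ.getD u 0 (by omega)
    have x5 : Γ.x[5 + 3 * i]?.getD 0 = I.rep.last u := hΓ.getD u 1 (by omega)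
    have x6 : Γ.x[6 + 3 * i]?.getD 0 = I.col u + 1 := hΓ.getD u 2 (by omega)
    have hf := I.first_le_n u
    have hl := I.last_le_n u
    have hc := (I.col u).2
    have b1 : r * ((I.col u : ℕ) + 1) < 2 ^ Γ.w :=
      lt_of_le_of_lt (Nat.mul_le_mul hr.le (by omega)) hΓ.fit4
    have b2 : (I.col u : ℕ) + 1 < 2 ^ Γ.w :=
      lt_of_le_of_lt (by nlinarith [Nat.two_pow_pos I.k]) hΓ.fit4
    have hidx : r * ((I.col u : ℕ) + 1) % ((I.γ + 1) * (32 * 2 ^ I.k)) / (I.γ + 1) < 32 * 2 ^ I.k :=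
      hashIdx_lt (by omega) (by positivity) r (I.col u + 1)
    have hg : I.hashColor τ r u =
      τ (r * ((I.col u : ℕ) + 1) % ((I.γ + 1) * (32 * 2 ^ I.k)) / (I.γ + 1)) := rfl
    simp [vc_set hS, ok_ofNat hS, ok_v hS, h22, e21, hν.c14, hν.c12, hν.c11, x4, x5, x6]
    generalize r * ((I.col u : ℕ) + 1) % ((I.γ + 1) * (32 * 2 ^ I.k)) / (I.γ + 1) = q at *
    obtain ⟨hτ1, hτ2⟩ := hτ _ hidx
    have hcell := hfr (64 + I.k + 2 ^ I.k + q) (by omega) (by omega)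
    rw [hτ2] at hcell
    refine ⟨by omega, by omega, by omega, ⟨by omega, by omega, hΓ.cell _ (by omega)⟩, ?_⟩
    have ht := tableStep_spec hΓ (((((hν.update (a := 22) (b := i) (by omega)).update (a := 23)
      (b := I.rep.first u) (by omega)).update (a := 24) (b := I.rep.last u) (by omega)).update
      (a := 25) (b := 2 ^ τ q) (by omega))) hτ1 (by simp)
    have e5 : Function.update (Function.update (Function.update ν 22 i) 23 (I.rep.first u)) 24
        (I.rep.last u) (64 + I.k + 2 ^ I.k + q) = 2 ^ τ q := by
      rw [Function.update_of_ne (by omega), Function.update_of_ne (by omega),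
        Function.update_of_ne (by omega), hcell]
    rw [e5]
    refine ht.wp (by omega) fun ν' _ ⟨hfr', hF'⟩ _ => ⟨rfl, by omega, ?_, fun a h1 h2 => ?_, ?_⟩
    · rw [hfr' 22 (by omega) (by omega)]; simp
    · rw [hfr' a (by omega) h2, Function.update_of_ne (by omega), Function.update_of_ne (by omega),
        Function.update_of_ne (by omega), Function.update_of_ne (by omega), hfr a h1 h2]
    · intro m hm e he
      have e6 : ∀ m, Function.update (Function.update (Function.update (Function.update ν 22 i) 23
          (I.rep.first u)) 24 (I.rep.last u)) 25 (2 ^ τ q) (64 + I.k + m) = ν (64 + I.k + m) := by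
        intro m
        rw [Function.update_of_ne (by omega), Function.update_of_ne (by omega),
          Function.update_of_ne (by omega), Function.update_of_ne (by omega)]
      rw [hF' m hm e, hi', reach_step, hg]
      simp only [e6, ← hi']
      refine or_congr (hF m hm e he) ⟨?_, ?_⟩
      · rintro ⟨m', h1, h2, h3, h4, h5⟩
        exact ⟨m', h2, h3, by simpa using h5, (hF m' h1 _ hl).mp (by simpa using h4)⟩
      · rintro ⟨m', h2, h3, h5, h4⟩
        have h1 : m' < 2 ^ I.k := by omega
        exact ⟨m', h1, h2, h3, by simpa using (hF m' h1 _ hl).mpr h4, by simpa using h5⟩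
  · rintro ν p' ⟨rfl, -, -, hfr, hF⟩
    exact ⟨⟨hfr, hF⟩, rfl⟩

end JobIntervalSelection

/-! ### Random labels for the hash cells -/

namespace JobIntervalSelection

open WordRAM WordRAM.Exp

/-- Fill the random table. -/
def fillTable : Cmd :=
  .seq (.set 18 0) <| .seq (.set 19 (32 * v 10)) <| .loop (v 18) (v 19) <|
    .seq (.rnd 20 (v 9)) <| .seq (.store (v 14 + v 18) (ld (64 + v 20))) (.set 18 (v 18 + 1))

variable {I : JobIntervalSelection}

/-- Here `b` is the acceptance probability guaranteed in any case, and 1 the one guaranteed if the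
labels are injective on `S`; `H` records that this second alternative is claimed at all. While the
labels are injective on the part of `S` seen so far and `j` cells of `S` are still to come, the
guarantee is `b + (1 - b) * j! / k ^ j`. Its mean over the next draw is unchanged, since exactly `j`
of the `k` labels are fresh. -/
theorem fillTable_spec {E : ℕ} {Γ : Env} (hΓ : I.RandEnv E Γ) {μ : ℕ → ℕ} (hμ : I.Static μ)
    (hk : 0 < I.k) {S : Finset ℕ} (hSr : S ⊆ Finset.range (32 * 2 ^ I.k)) (hSc : S.card = I.k)
    {b p : ℝ} (H : Prop)
    (hp : p = b ∨ (H ∧ p = b + (1 - b) * ((I.k.factorial : ℝ) / (I.k : ℝ) ^ I.k))) :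
    WP Γ fillTable (fun ν _ p' =>
      (∀ a, (a < 18 ∨ 20 < a) →
        (a < 64 + I.k + 2 ^ I.k ∨ 64 + I.k + 2 ^ I.k + 32 * 2 ^ I.k ≤ a) → ν a = μ a) ∧
      ∃ τ, I.RandTable τ (32 * 2 ^ I.k) ν ∧
        (p' = b ∨ (H ∧ (∀ x ∈ S, ∀ y ∈ S, τ x = τ y → x = y) ∧ p' = 1)))
      μ (32 * 2 ^ I.k * 40 + 30) p := by
  classical
  have hS := hΓ.std
  have hkk : I.k < 2 ^ I.k := Nat.lt_two_pow_self
  have hw := hΓ.fit5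
  refine .of_vc ?_
  simp [fillTable, vc_set hS, ok_v hS, ok_ofNat hS, hμ.c10]
  refine ⟨by omega, ?_⟩
  refine WP.loop (fun i ν p' => i ≤ 32 * 2 ^ I.k ∧ ν 18 = 32 * 2 ^ I.k - i ∧
    ν 19 = 32 * 2 ^ I.k ∧
    (∀ a, (a < 18 ∨ 20 < a) →
      (a < 64 + I.k + 2 ^ I.k ∨ 64 + I.k + 2 ^ I.k + 32 * 2 ^ I.k ≤ a) → ν a = μ a) ∧
    ∃ τ, I.RandTable τ (32 * 2 ^ I.k - i) ν ∧
      (p' = b ∨ (H ∧ (∀ x ∈ S, ∀ y ∈ S, x < 32 * 2 ^ I.k - i → y < 32 * 2 ^ I.k - i →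
        τ x = τ y → x = y) ∧ ∃ j, (S.filter (· < 32 * 2 ^ I.k - i)).card + j = I.k ∧
          p' = b + (1 - b) * ((j.factorial : ℝ) / (I.k : ℝ) ^ j))))
    (32 * 2 ^ I.k) 30 ?_ ?_ ?_ ?_ ?_
  · refine ⟨le_rfl, by simp, by simp, fun a h1 _ => ?_, fun _ => 0, fun j hj => ?_, ?_⟩
    · rw [Function.update_of_ne (by omega), Function.update_of_ne (by omega)]
    · omega
    · refine hp.imp_right fun h => ⟨h.1, fun x _ y _ hx => by omega, I.k, by simp, h.2⟩
  · rintro i ν p' ⟨hi, h18, h19, -⟩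
    simp [ok_v hS, h18, h19]
  · simp only [cost_v, Nat.reduceAdd]; omega
  · rintro i ν p' ⟨hi, h18, h19, hfr, τ, hτ, hp'⟩
    obtain ⟨n0, hn0⟩ : ∃ n0, 32 * 2 ^ I.k - (i + 1) = n0 := ⟨_, rfl⟩
    have hn1 : 32 * 2 ^ I.k - i = n0 + 1 := by omega
    rw [hn0] at h18 hτ hp'
    have e9 : ν 9 = I.k := (hfr 9 (by omega) (by omega)).trans hμ.c9
    have e14 : ν 14 = 64 + I.k + 2 ^ I.k := (hfr 14 (by omega) (by omega)).trans hμ.c14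
    refine .of_vc ?_
    simp only [vc_seq, vc_rnd]
    have hmain : ∀ r < I.k, ∀ p'' : ℝ,
        (p'' = b ∨ (H ∧ (∀ x ∈ S, ∀ y ∈ S, x < n0 + 1 → y < n0 + 1 →
          Function.update τ n0 r x = Function.update τ n0 r y → x = y) ∧
          ∃ j, (S.filter (· < n0 + 1)).card + j = I.k ∧
          p'' = b + (1 - b) * ((j.factorial : ℝ) / (I.k : ℝ) ^ j))) →
        vc Γ (.store (v 14 + v 18) (ld (64 + v 20))) (vc Γ (.set 18 (v 18 + 1))
          fun μ' _ p' => i ≤ 32 * 2 ^ I.k ∧ μ' 18 = 32 * 2 ^ I.k - i ∧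
            μ' 19 = 32 * 2 ^ I.k ∧ (∀ a, (a < 18 ∨ 20 < a) →
              (a < 64 + I.k + 2 ^ I.k ∨ 64 + I.k + 2 ^ I.k + 32 * 2 ^ I.k ≤ a) → μ' a = μ a) ∧
            ∃ τ, I.RandTable τ (32 * 2 ^ I.k - i) μ' ∧
              (p' = b ∨ (H ∧ (∀ x ∈ S, ∀ y ∈ S, x < 32 * 2 ^ I.k - i → y < 32 * 2 ^ I.k - i →
                τ x = τ y → x = y) ∧ ∃ j, (S.filter (· < 32 * 2 ^ I.k - i)).card + j = I.k ∧
                  p' = b + (1 - b) * ((j.factorial : ℝ) / (I.k : ℝ) ^ j))))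
          (Function.update ν 20 r) 25 p'' := by
      intro r hr p'' hp''
      have e64 : Function.update ν 20 r (64 + r) = 2 ^ r := by
        rw [Function.update_of_ne (by omega), hfr _ (by omega) (by omega), hμ.pow r hr]
      simp [vc_set hS, ok_v hS, ok_ofNat hS, e14, h18, e64]
      have n18 : ¬ 18 = 64 + I.k + 2 ^ I.k + n0 := by omega
      have n19 : ¬ 19 = 64 + I.k + 2 ^ I.k + n0 := by omega
      refine ⟨by omega, ⟨by omega, by omega, hΓ.cell _ (by omega)⟩, hΓ.cell _ (by omega), ?_⟩
      simp only [Function.update_of_ne n18, Function.update_of_ne n19]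
      simp only [Function.update_of_ne (show (18 : ℕ) ≠ 20 by omega),
        Function.update_of_ne (show (19 : ℕ) ≠ 20 by omega), h18, h19]
      refine ⟨by omega, by omega, by omega, trivial, fun a h1 h2 => ?_, Function.update τ n0 r,
        fun j hj => ?_, ?_⟩
      · rw [Function.update_of_ne (by omega), Function.update_of_ne (by omega),
          Function.update_of_ne (by omega), hfr a h1 h2]
      · rw [hn1] at hj
        have n18' : 64 + I.k + 2 ^ I.k + j ≠ 18 := by omega
        have n20' : 64 + I.k + 2 ^ I.k + j ≠ 20 := by omega
        by_cases hjn : j = n0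
        · subst hjn
          simpa only [Function.update_self, Function.update_of_ne n18', and_true] using hr
        · have n0' : 64 + I.k + 2 ^ I.k + j ≠ 64 + I.k + 2 ^ I.k + n0 := by omega
          rw [Function.update_of_ne n18', Function.update_of_ne n0', Function.update_of_ne n20',
            Function.update_of_ne hjn]
          exact hτ j (by omega)
      · rw [hn1]; exact hp''
    rcases hp' with rfl | ⟨hH, hinj, j, hj, rfl⟩
    · refine WP.rnd (by simp [ok_ofNat hS]) (by simp [ok_v hS]) (by simpa using hS.cell 20 (by omega))
        (by simp) (by simpa [e9] using hk) (fun _ => p') 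
          (by rw [Finset.sum_const, Finset.card_range, nsmul_eq_mul, mul_comm]) fun r hr => ?_
      simp only [val_v, e9] at hr
      exact hmain r hr p' (.inl rfl)
    · by_cases hn : n0 ∈ S
      · have hcard : (S.filter (· < n0 + 1)).card = (S.filter (· < n0)).card + 1 := by
          have : S.filter (· < n0 + 1) = insert n0 (S.filter (· < n0)) := by
            ext x
            simp only [Finset.mem_filter, Finset.mem_insert]
            constructor
            · rintro ⟨h1, h2⟩
              by_cases hx : x = n0
              exacts [.inl hx, .inr ⟨h1, by omega⟩]
            · rintro (rfl | ⟨h1, h2⟩)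
              exacts [⟨hn, by omega⟩, ⟨h1, by omega⟩]
          rw [this, Finset.card_insert_of_notMem (by simp)]
        have hle : (S.filter (· < n0 + 1)).card ≤ I.k := hSc ▸ Finset.card_filter_le _ _
        obtain ⟨j', rfl⟩ : ∃ j', j = j' + 1 := ⟨j - 1, by omega⟩
        set U := (S.filter (· < n0)).image τ with hU
        have hUc : U.card = (S.filter (· < n0)).card := by
          refine Finset.card_image_of_injOn fun x hx y hy h => ?_
          simp only [Finset.coe_filter, Set.mem_ofPred_eq] at hx hy
          exact hinj x hx.1 y hy.1 hx.2 hy.2 h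
        have hUr : U ⊆ Finset.range I.k := by
          intro x hx
          obtain ⟨y, hy, rfl⟩ := Finset.mem_image.mp hx
          exact Finset.mem_range.mpr (hτ y (Finset.mem_filter.mp hy).2).1
        -- A label in `U` repeats an earlier one on `S` and leaves only `b`; each of the `j' + 1`
        -- other labels preserves injectivity.
        refine WP.rnd (by simp [ok_ofNat hS]) (by simp [ok_v hS])
          (by simpa using hS.cell 20 (by omega)) (by simp) (by simpa [e9] using hk)
          (fun r => if r ∈ U then b else b + (1 - b) * ((j'.factorial : ℝ) / (I.k : ℝ) ^ j'))
          ?_ fun r hr => ?_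
        · simp only [val_v, e9]
          rw [Finset.sum_ite, Finset.sum_const, Finset.sum_const, Finset.filter_mem_eq_inter,
            Finset.inter_eq_right.mpr hUr, ← Finset.sdiff_eq_filter,
            Finset.card_sdiff_of_subset hUr, hUc, Finset.card_range]
          have e1 : I.k - (S.filter (· < n0)).card = j' + 1 := by omega
          rw [e1, nsmul_eq_mul, nsmul_eq_mul]
          have e2 : ((S.filter (· < n0)).card : ℝ) + (j' + 1) = I.k := by exact_mod_cast hj
          have hk0 : (I.k : ℝ) ≠ 0 := by positivity
          rw [Nat.factorial_succ, pow_succ, ← e2] at *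
          push_cast
          apply le_of_eq
          field_simp
          ring
        · simp only [val_v, e9] at hr
          refine hmain r hr _ ?_
          split_ifs with hrU
          · exact .inl rfl
          · refine .inr ⟨hH, fun x hx y hy hxn hyn h => ?_, j', by omega, rfl⟩
            have key : ∀ z ∈ S, z < n0 → τ z ≠ r := fun z hz hzn h =>
              hrU (Finset.mem_image.mpr ⟨z, Finset.mem_filter.mpr ⟨hz, hzn⟩, h⟩)
            rcases Nat.lt_succ_iff_lt_or_eq.mp hxn with hx1 | rfl <;>
              rcases Nat.lt_succ_iff_lt_or_eq.mp hyn with hy1 | rfl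
            · rw [Function.update_of_ne hx1.ne, Function.update_of_ne hy1.ne] at h
              exact hinj x hx y hy hx1 hy1 h
            · rw [Function.update_of_ne hx1.ne, Function.update_self] at h
              exact absurd h (key x hx hx1)
            · rw [Function.update_of_ne hy1.ne, Function.update_self] at h
              exact absurd h.symm (key y hy hy1)
            · rfl
      · have hne : ∀ x ∈ S, x < n0 + 1 → x < n0 := fun x hx h => by
          rcases Nat.lt_succ_iff_lt_or_eq.mp h with h | rfl
          exacts [h, absurd hx hn]
        refine WP.rnd (by simp [ok_ofNat hS]) (by simp [ok_v hS])
          (by simpa using hS.cell 20 (by omega)) (by simp) (by simpa [e9] using hk)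
          (fun _ => b + (1 - b) * ((j.factorial : ℝ) / (I.k : ℝ) ^ j)) 
          (by rw [Finset.sum_const, Finset.card_range, nsmul_eq_mul, mul_comm])
          fun r hr => ?_
        simp only [val_v, e9] at hr
        refine hmain r hr _ (.inr ⟨hH, fun x hx y hy hxn hyn h => ?_, j, ?_, rfl⟩)
        · have hx1 := hne x hx hxn
          have hy1 := hne y hy hyn
          rw [Function.update_of_ne hx1.ne, Function.update_of_ne hy1.ne] at h
          exact hinj x hx y hy hx1 hy1 h
        · rw [← hj]
          congr 2
          exact Finset.filter_congr fun x hx => ⟨hne x hx, fun h => by omega⟩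
  · rintro ν p' ⟨-, -, -, hfr, τ, hτ, hp'⟩
    refine ⟨hfr, τ, hτ, hp'.imp_right fun ⟨hH, h1, j, h2, h3⟩ => ⟨hH, fun x hx y hy => ?_, ?_⟩⟩
    · exact h1 x hx y hy (by simpa using hSr hx) (by simpa using hSr hy)
    · have : S.filter (· < 32 * 2 ^ I.k - 0) = S :=
        Finset.filter_true_of_mem fun x hx => by simpa using hSr hx
      rw [this, hSc] at h2
      obtain rfl : j = 0 := by omega
      rw [h3]; simp

/-- Clear the table of the dynamic program. -/
def clearTable : Cmd :=
  .seq (.store (v 13) (v 8 + 1)) <| .seq (.set 18 1) <| .loop (v 18) (v 10) <|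
    .seq (.store (v 13 + v 18) 0) (.set 18 (v 18 + 1))

/-- The loop starts at mask 1, because the entry of the empty mask has to keep the value `n + 1`. -/
theorem clearTable_spec {E : ℕ} {Γ : Env} (hΓ : I.RandEnv E Γ) {μ : ℕ → ℕ} (hμ : I.Static μ) :
    HT Γ clearTable μ (2 ^ I.k * 40 + 30) fun ν =>
      (∀ a, a ≠ 18 → (a < 64 + I.k ∨ 64 + I.k + 2 ^ I.k ≤ a) → ν a = μ a) ∧ I.TableInit ν := by
  have hS := hΓ.std
  have hkk : I.k < 2 ^ I.k := Nat.lt_two_pow_self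
  have hw := hΓ.fit5
  have hw1 := hΓ.fit1
  intro p
  refine .of_vc ?_
  simp [clearTable, vc_set hS, ok_v hS, ok_ofNat hS, hμ.c13, hμ.c8]
  refine ⟨by omega, hΓ.cell _ (by omega), ?_⟩
  refine WP.loop (fun i ν p' => p' = p ∧ i + 1 ≤ 2 ^ I.k ∧ ν 18 = 2 ^ I.k - i ∧
    (∀ a, a ≠ 18 → (a < 64 + I.k ∨ 64 + I.k + 2 ^ I.k ≤ a) → ν a = μ a) ∧
      ν (64 + I.k) = I.n + 1 ∧ ∀ m < 2 ^ I.k - i, 0 < m → ν (64 + I.k + m) = 0)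
    (2 ^ I.k - 1) 24 ?_ ?_ ?_ ?_ ?_
  · refine ⟨rfl, by omega, by simp; omega, fun a h1 h2 => ?_, ?_, fun m h1 h2 => by omega⟩
    · rw [Function.update_of_ne h1, Function.update_of_ne (by omega)]
    · rw [Function.update_of_ne (by omega), Function.update_self]
  · rintro i ν p' ⟨-, hi, h18, hfr, -⟩
    have e10 : ν 10 = 2 ^ I.k := (hfr 10 (by omega) (by omega)).trans hμ.c10
    simp [ok_v hS, h18, e10]
  · simp only [cost_v, Nat.reduceAdd]; omega
  · rintro i ν p' ⟨rfl, hi, h18, hfr, h0, hF⟩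
    have e13 : ν 13 = 64 + I.k := (hfr 13 (by omega) (by omega)).trans hμ.c13
    refine .of_vc ?_
    obtain ⟨n0, hn0⟩ : ∃ n0, 2 ^ I.k - (i + 1) = n0 := ⟨_, rfl⟩
    have hn1 : 2 ^ I.k - i = n0 + 1 := by omega
    rw [hn0] at h18 hF
    simp [vc_set hS, ok_v hS, ok_ofNat hS, e13, h18]
    have e18 : ¬ 18 = 64 + I.k + n0 := by omega
    rw [Function.update_of_ne e18, h18]
    refine ⟨by omega, hΓ.cell _ (by omega), by omega, by omega, by omega, fun a h1 h2 => ?_, ?_,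
      fun m h1 h2 => ?_⟩
    · rw [Function.update_of_ne h1, Function.update_of_ne (by omega), hfr a h1 h2]
    · rw [Function.update_of_ne (by omega), Function.update_of_ne (by omega), h0]
    · rw [Function.update_of_ne (by omega)]
      by_cases hm : m = n0
      · rw [hm, Function.update_self]
      · rw [Function.update_of_ne (by omega), hF m (by omega) h2]
  · rintro ν p' ⟨rfl, -, -, hfr, h0, hF⟩
    exact ⟨⟨hfr, h0, hF⟩, rfl⟩

end JobIntervalSelection

/-! ### One trial of the randomized algorithm -/

namespace JobIntervalSelection

open WordRAM WordRAM.Exp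

/-- One trial of the randomized algorithm. -/
def trial : Cmd :=
  .seq (.set 16 (v 16 - 1)) <| .seq (.rnd 21 (v 12)) <| .seq (.call fillTable) <|
    .seq (.call clearTable) <| .seq (.call tableLoop) <|
    .ite 0 (ld (v 13 + (v 10 - 1))) .accept .skip

variable {I : JobIntervalSelection}

/-- A lower bound on the success probability of a trial on a yes-instance. -/
noncomputable def successProb (k : ℕ) : ℝ := 1 / 2 * ((k.factorial : ℝ) / (k : ℝ) ^ k)

/-- If the remaining program accepts with probability at least `b`, a successful trial replaces `b`
by 1. Success needs a multiplier that separates the colors of a fixed solution (probability at least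
1/2) and then labels that are injective on the resulting `k` cells (probability `k! / k ^ k`). -/
theorem trial_spec {E : ℕ} {Γ : Env} (hΓ : I.RandEnv E Γ) {μ : ℕ → ℕ} (hμ : I.Static μ)
    (hn : 0 < I.n) (hk : 0 < I.k) {j : ℕ} (h16 : μ 16 = j + 1) (hj : j + 1 < 2 ^ Γ.w) {b p : ℝ}
    (hb : b ≤ 1) (hp : p = b ∨ (I.IsYes ∧ p = b + (1 - b) * successProb I.k)) :
    WP Γ trial (fun ν _ p' => I.Static ν ∧ ν 16 = j ∧ p' = b) μ (1700 * (I.n * 2 ^ I.k)) p := by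
  classical
  have hS := hΓ.std
  have hkk : I.k < 2 ^ I.k := Nat.lt_two_pow_self
  have hw := hΓ.fit5
  have hN : 2 ^ I.k ≤ I.n * 2 ^ I.k := Nat.le_mul_of_pos_left _ hn
  have hM : 0 < (I.γ + 1) * (32 * 2 ^ I.k) := by positivity
  have hcost : I.n * (60 * 2 ^ I.k + 100) = 60 * (I.n * 2 ^ I.k) + 100 * I.n := by ring
  have hcost' : I.n ≤ I.n * 2 ^ I.k := Nat.le_mul_of_pos_right _ (by positivity)
  refine .of_vc ?_
  simp [trial, vc_set hS, ok_v hS, ok_ofNat hS, h16]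
  refine ⟨by omega, by omega, ?_⟩
  have hμ' := hμ.update (a := 16) (b := j) (by omega)
  -- The part after the draw of the multiplier `r`: `S` consists of the hash cells of a solution,
  -- and `H` allows one to conclude that injective labels on `S` lead to acceptance.
  have hmain : ∀ r < (I.γ + 1) * (32 * 2 ^ I.k), ∀ (H : Prop) (S : Finset ℕ),
      S ⊆ Finset.range (32 * 2 ^ I.k) → S.card = I.k →
      (H → ∀ τ, (∀ x ∈ S, ∀ y ∈ S, τ x = τ y → x = y) → (∀ i < 32 * 2 ^ I.k, τ i < I.k) →
        I.Reach (I.hashColor τ r) 0 0 (2 ^ I.k - 1)) → ∀ q,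
      (q = b ∨ (H ∧ q = b + (1 - b) * ((I.k.factorial : ℝ) / (I.k : ℝ) ^ I.k))) →
      vc Γ (Cmd.seq (.call fillTable) <|
        .seq (.call clearTable) <| .seq (.call tableLoop) <|
        .ite 0 (ld (v 13 + (v 10 - 1))) .accept .skip)
        (fun ν _ p' => I.Static ν ∧ ν 16 = j ∧ p' = b)
        (Function.update (Function.update μ 16 j) 21 r) (1700 * (I.n * 2 ^ I.k) - 11) q := by
    intro r hr H S hSr hSc hH q hq
    simp only [vc_seq, vc_call]
    have hμ2 := hμ'.update (a := 21) (b := r) (by omega)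
    refine (fillTable_spec hΓ hμ2 hk hSr hSc H hq).mono (by omega) ?_
    rintro ν n' p' ⟨hfr, τ, hτ, hp'⟩
    have hν : I.Static ν := hμ2.congr fun c hc => hfr c (by omega) (by omega)
    refine (clearTable_spec hΓ hν).wp (by omega) ?_
    rintro ν' n' ⟨hfr', hinit⟩ hn'
    have hν' : I.Static ν' := hν.congr fun c hc => hfr' c (by omega) (by omega)
    have hτ' : I.RandTable τ (32 * 2 ^ I.k) ν' := fun i hi => by
      obtain ⟨h1, h2⟩ := hτ i hi
      exact ⟨h1, by rw [hfr' _ (by omega) (by omega), h2]⟩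
    have e21 : ν' 21 = r := by
      rw [hfr' 21 (by omega) (by omega), hfr 21 (by omega) (by omega), Function.update_self]
    refine (tableLoop_spec hΓ hν' hr e21 hτ' hinit).wp (by omega) ?_
    rintro ν'' n'' ⟨hfr'', hF⟩ hn''
    have hν'' : I.Static ν'' := hν'.congr fun c hc => hfr'' c (by omega) (by omega)
    -- Start points are at least 1, so starting after 0 is no restriction.
    have hFl := hF (2 ^ I.k - 1) (by omega) 0 (by omega)
    have e16 : ν'' 16 = j := by
      rw [hfr'' 16 (by omega) (by omega), hfr' 16 (by omega) (by omega),
        hfr 16 (by omega) (by omega)]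
      simp
    simp [ok_v hS, ok_ofNat hS, hν''.c13, hν''.c10]
    refine ⟨⟨by omega, by omega, hΓ.cell _ (by omega)⟩, by omega, fun h => ?_, fun h => ?_⟩
    · refine ⟨hΓ.yes.mpr (reach_full (fun u u' h => ?_) (hFl.mp h)), ?_, by omega⟩
      · simp only [hashColor, h]
      · rcases hp' with rfl | ⟨-, -, rfl⟩
        exacts [hb, le_rfl]
    · refine ⟨hν'', e16, ?_⟩
      rcases hp' with h' | ⟨h1, h2, -⟩
      · exact h'
      · have := hFl.mpr (hH h1 τ h2 fun i hi => (hτ i hi).1)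
        omega
  have hA : Γ.A (val Γ.x (Function.update μ 16 j) 21) := by simpa using hS.cell 21 (by omega)
  have e12 : val Γ.x (Function.update μ 16 j) (v 12) = (I.γ + 1) * (32 * 2 ^ I.k) := hμ'.c12
  rcases hp with rfl | ⟨hyes, rfl⟩
  · refine WP.rnd (by simp [ok_ofNat hS]) (by simp [ok_v hS]) hA
      (by simp; omega) (by rw [e12]; exact hM) (fun _ => p)
      (by rw [Finset.sum_const, Finset.card_range, nsmul_eq_mul, mul_comm]) fun r hr => ?_
    rw [e12] at hr
    -- With `H` false nothing is claimed about `S`; any `k` cells will do.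
    exact hmain r hr False (Finset.range I.k) (fun i hi => by
      rw [Finset.mem_range] at hi ⊢; omega) (by simp) False.elim p (.inl rfl)
  · obtain ⟨l, hl1, hl2, hl3⟩ := I.isYes_iff.mp hyes
    set X : Finset ℕ := (l.map fun u => (I.col u : ℕ) + 1).toFinset with hX
    have hXnd : (l.map fun u => (I.col u : ℕ) + 1).Nodup := by
      have := hl3.map (f := fun c : Fin I.γ => (c : ℕ) + 1) fun a b h => Fin.ext (by simpa using h)
      rwa [List.map_map] at this
    have hXc : X.card = I.k := by
      rw [hX, List.toFinset_card_of_nodup hXnd, List.length_map, hl2]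
    have hXγ : ∀ x ∈ X, x ≤ I.γ := by
      intro x hx
      rw [hX, List.mem_toFinset, List.mem_map] at hx
      obtain ⟨u, -, rfl⟩ := hx
      exact (I.col u).2
    have hhalf := card_injOn_hashIdx hXγ hXc.le
    set G : ℕ → Prop := fun r => ∀ x ∈ X, ∀ y ∈ X,
      hashIdx (I.γ + 1) (32 * 2 ^ I.k) r x = hashIdx (I.γ + 1) (32 * 2 ^ I.k) r y → x = y with hG
    refine WP.rnd (by simp [ok_ofNat hS]) (by simp [ok_v hS]) hA
      (by simp; omega) (by rw [e12]; exact hM)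
      (fun r => if G r then b + (1 - b) * ((I.k.factorial : ℝ) / (I.k : ℝ) ^ I.k) else b)
      ?_ fun r hr => ?_
    · rw [e12]
      have h1 : ∀ r, (if G r then b + (1 - b) * ((I.k.factorial : ℝ) / (I.k : ℝ) ^ I.k) else b) =
          b + if G r then (1 - b) * ((I.k.factorial : ℝ) / (I.k : ℝ) ^ I.k) else 0 := by
        intro r; split_ifs <;> simp
      simp only [h1]
      rw [Finset.sum_add_distrib, Finset.sum_const, Finset.card_range, ← Finset.sum_filter,
        Finset.sum_const, nsmul_eq_mul, nsmul_eq_mul]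
      have h2 : (((I.γ + 1) * (32 * 2 ^ I.k) : ℕ) : ℝ) ≤ 2 * ((Finset.range
          ((I.γ + 1) * (32 * 2 ^ I.k))).filter G).card := by exact_mod_cast hhalf
      have h3 : 0 ≤ (1 - b) * ((I.k.factorial : ℝ) / (I.k : ℝ) ^ I.k) :=
        mul_nonneg (by linarith) (by positivity)
      rw [successProb]
      nlinarith
    · rw [e12] at hr
      split_ifs with hGr
      · refine hmain r hr True (X.image (hashIdx (I.γ + 1) (32 * 2 ^ I.k) r)) ?_ ?_ ?_ _
          (.inr ⟨trivial, rfl⟩)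
        · intro i hi
          obtain ⟨x, -, rfl⟩ := Finset.mem_image.mp hi
          exact Finset.mem_range.mpr (hashIdx_lt (by omega) (by positivity) _ _)
        · rw [Finset.card_image_of_injOn fun x hx y hy h => hGr x hx y hy h, hXc]
        · intro _ τ hτ hτk
          have hnd : (l.map (I.hashColor τ r)).Nodup := by
            refine (List.nodup_map_iff_inj_on hl3.of_map).mpr fun u hu u' hu' h => ?_
            have hm : ∀ u ∈ l, (I.col u : ℕ) + 1 ∈ X := fun u hu => by
              rw [hX, List.mem_toFinset]; exact List.mem_map_of_mem hu
            have := hτ _ (Finset.mem_image_of_mem _ (hm u hu)) _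
              (Finset.mem_image_of_mem _ (hm u' hu')) h
            have := hGr _ (hm u hu) _ (hm u' hu') this
            exact List.inj_on_of_nodup_map hl3 hu hu' (Fin.ext (by omega))
          refine ⟨l, hl1, fun u _ => ⟨Nat.zero_le _, ?_⟩, hnd, ?_⟩
          · have := I.rep.one_le_first u; omega
          · refine map_two_pow_sum_of_length hnd (fun i hi => ?_) (by simpa using hl2)
            obtain ⟨u, -, rfl⟩ := List.mem_map.mp hi
            exact hτk _ (hashIdx_lt (by omega) (by positivity) _ _)
      · exact hmain r hr False (Finset.range I.k) (fun i hi => by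
          rw [Finset.mem_range] at hi ⊢; omega) (by simp) False.elim b (.inl rfl)

/-- The initialization of the randomized algorithm. -/
def randInit : Cmd :=
  .seq (.set 8 (inp 1)) <| .seq (.set 9 (inp 3)) <| .seq (.ite (v 9) 1 .accept .skip) <|
  .seq (.set 10 1) <| .seq (.set 16 1) <| .seq (.set 17 1) <| .seq (.set 18 0) <|
  .seq (.call <| .loop (v 18) (v 9) <|
    .seq (.store (64 + v 18) (v 10)) <| .seq (.set 10 (v 10 + v 10)) <|
    .seq (.set 16 (v 16 * 11)) <| .seq (.set 17 (v 17 * 4)) (.set 18 (v 18 + 1))) <|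
  .seq (.set 19 (inp 0)) <| .seq (.set 20 0) <|
  .seq (.call <| .loop 0 (v 19) <| .seq (.set 19 (v 19 / 2)) (.set 20 (v 20 + 1))) <|
  .seq (.set 16 (2 * (v 16 / v 17 + 1) * v 20)) <| .seq (.set 11 (inp 2 + 1)) <|
  .seq (.set 12 (v 11 * (32 * v 10))) <| .seq (.set 13 (64 + v 9)) (.set 14 (v 13 + v 10))

theorem size_div_two (e : ℕ) (he : 0 < e) : e.size = (e / 2).size + 1 := by
  rw [← Nat.div2_val]
  conv_lhs => rw [← Nat.bit_bodd_div2 e]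
  rw [Nat.size_bit]
  rw [Nat.bit_bodd_div2]
  omega

theorem randInit_spec {E : ℕ} {Γ : Env} (hΓ : I.RandEnv E Γ) {p : ℝ} (hp : p ≤ 1) :
    WP Γ randInit (fun ν _ p' => 0 < I.k ∧ I.Static ν ∧ ν 16 = numTrials I.k E ∧ p' = p)
      (fun _ => 0) (100 * (I.k + E.size) + 200) p := by
  have hS := hΓ.std
  have hkk : I.k < 2 ^ I.k := Nat.lt_two_pow_self
  have hw := hΓ.fit5
  have hw1 := hΓ.fit1
  have hw2 := hΓ.fit2
  have hw3 := hΓ.fit3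
  have hw4 := hΓ.fit4
  have x0 : Γ.x[0]?.getD 0 = E := by simp [hΓ.input]
  have x1 : Γ.x[1]?.getD 0 = I.n := by simp [hΓ.input, encode]
  have x2 : Γ.x[2]?.getD 0 = I.γ := by simp [hΓ.input, encode]
  have x3 : Γ.x[3]?.getD 0 = I.k := by simp [hΓ.input, encode]
  refine .of_vc ?_
  simp [randInit, vc_set hS, ok_v hS, ok_ofNat hS, x1, x3]
  -- For `k = 0` the empty chain is a solution and the program accepts at once; afterwards `0 < k`,
  -- as draws of labels below `k` require.
  refine ⟨by omega, by omega, fun hk0 => ⟨?_, hp⟩, fun hk => ?_⟩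
  · refine hΓ.yes.mpr (I.isYes_iff.mpr ⟨[], List.Pairwise.nil, by simp [hk0], by simp⟩)
  have hfirst : HT Γ (.loop (v 18) (v 9) <|
      .seq (.store (64 + v 18) (v 10)) <| .seq (.set 10 (v 10 + v 10)) <|
      .seq (.set 16 (v 16 * 11)) <| .seq (.set 17 (v 17 * 4)) (.set 18 (v 18 + 1)))
      (Function.update (Function.update (Function.update (Function.update (Function.update
        (Function.update (fun _ => 0) 8 I.n) 9 I.k) 10 1) 16 1) 17 1) 18 0) (60 * I.k + 10)
      fun ν => ν 8 = I.n ∧ ν 9 = I.k ∧ ν 10 = 2 ^ I.k ∧ ν 16 = 11 ^ I.k ∧ ν 17 = 4 ^ I.k ∧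
        ∀ i < I.k, ν (64 + i) = 2 ^ i := by
    refine HT.loop (fun j ν => j ≤ I.k ∧ ν 18 = I.k - j ∧ ν 8 = I.n ∧ ν 9 = I.k ∧
      ν 10 = 2 ^ (I.k - j) ∧ ν 16 = 11 ^ (I.k - j) ∧ ν 17 = 4 ^ (I.k - j) ∧
        ∀ i < I.k - j, ν (64 + i) = 2 ^ i) I.k 45 ?_ ?_ ?_ ?_ ?_
    · simp
    · rintro j ν ⟨hj, h18, -, h9, -⟩
      simp [ok_v hS, h18, h9]
      omega
    · simp only [cost_v, Nat.reduceAdd]; omega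
    · rintro j ν ⟨hj, h18, h8, h9, h10, h16, h17, hpow⟩ q
      refine .of_vc ?_
      obtain ⟨i0, hi0⟩ : ∃ i0, I.k - (j + 1) = i0 := ⟨_, rfl⟩
      have hi1 : I.k - j = i0 + 1 := by omega
      rw [hi0] at h18 h10 h16 h17 hpow
      have n1 : ¬ 8 = 64 + i0 := by omega
      have n2 : ¬ 9 = 64 + i0 := by omega
      have n3 : ¬ 10 = 64 + i0 := by omega
      have n4 : ¬ 16 = 64 + i0 := by omega
      have n5 : ¬ 17 = 64 + i0 := by omega
      have n6 : ¬ 18 = 64 + i0 := by omega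
      have p2 : 2 ^ (i0 + 1) ≤ 2 ^ I.k := Nat.pow_le_pow_right (by omega) (by omega)
      have p11 : 11 ^ (i0 + 1) ≤ 11 ^ I.k := Nat.pow_le_pow_right (by omega) (by omega)
      have p4 : 4 ^ (i0 + 1) ≤ 11 ^ (i0 + 1) := Nat.pow_le_pow_left (by omega) _
      have p0 : 4 * 11 ^ I.k ≤ 4 * 11 ^ I.k * (E.size + 1) := Nat.le_mul_of_pos_right _ (by omega)
      rw [pow_succ] at p2 p11 p4
      rw [pow_succ] at p4
      simp [vc_set hS, ok_v hS, ok_ofNat hS, h18, h10, h16, h17, Function.update_of_ne n1,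
        Function.update_of_ne n2, Function.update_of_ne n3, Function.update_of_ne n4,
        Function.update_of_ne n5, Function.update_of_ne n6, h8, h9]
      refine ⟨by omega, hΓ.cell _ (by omega), by omega, by omega, by omega, by omega, by omega,
        by omega, ?_, ?_, ?_, fun i hi => ?_⟩
      · rw [hi1, pow_succ]; omega
      · rw [hi1, pow_succ]
      · rw [hi1, pow_succ]
      · rw [Function.update_of_ne (by omega), Function.update_of_ne (by omega),
          Function.update_of_ne (by omega), Function.update_of_ne (by omega)]
        by_cases hii : i = i0
        · rw [hii, Function.update_self]
        · rw [Function.update_of_ne (by omega), hpow i (by omega)]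
    · rintro ν ⟨-, -, h8, h9, h10, h16, h17, hpow⟩
      exact ⟨h8, h9, h10, h16, h17, hpow⟩
  refine hfirst.wp (by omega) ?_
  rintro ν n' ⟨h8, h9, h10, h16, h17, hpow⟩ hn'
  simp [vc_set hS, ok_ofNat hS, x0]
  refine ⟨by omega, by omega, by omega, ?_⟩
  have hsecond : HT Γ (.loop 0 (v 19) <| .seq (.set 19 (v 19 / 2)) (.set 20 (v 20 + 1)))
      (Function.update (Function.update ν 19 E) 20 0) (30 * E.size + 10)
      fun ν' => (∀ a, a ≠ 19 → a ≠ 20 → ν' a = ν a) ∧ ν' 20 = E.size := by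
    refine HT.loop (fun j ν' => (∀ a, a ≠ 19 → a ≠ 20 → ν' a = ν a) ∧ (ν' 19).size = j ∧
      ν' 20 + j = E.size) E.size 20 ?_ ?_ ?_ ?_ ?_
    · refine ⟨fun a h1 h2 => ?_, by simp, by simp⟩
      rw [Function.update_of_ne h2, Function.update_of_ne h1]
    · rintro j ν' ⟨hfr, h19, h20⟩
      simp [ok_v hS, ok_ofNat hS, ← h19, Nat.size_pos]
    · simp only [cost_v, cost_ofNat, Nat.reduceAdd]; omega
    · rintro j ν' ⟨hfr, h19, h20⟩ q
      refine .of_vc ?_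
      have hpos : 0 < ν' 19 := Nat.size_pos.mp (by omega)
      have := size_div_two _ hpos
      have hs : E.size < 2 ^ Γ.w := by
        have : E.size + 1 ≤ 4 * 11 ^ I.k * (E.size + 1) := Nat.le_mul_of_pos_left _ (by positivity)
        omega
      simp [vc_set hS, ok_v hS, ok_ofNat hS]
      refine ⟨by omega, fun a h1 h2 => ?_, by omega, by omega⟩
      rw [Function.update_of_ne h2, Function.update_of_ne h1, hfr a h1 h2]
    · rintro ν' ⟨hfr, -, h20⟩
      exact ⟨hfr, by simpa using h20⟩
  refine hsecond.wp (by omega) ?_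
  rintro ν' n'' ⟨hfr, h20⟩ hn''
  have e8 := (hfr 8 (by omega) (by omega)).trans h8
  have e9 := (hfr 9 (by omega) (by omega)).trans h9
  have e10 := (hfr 10 (by omega) (by omega)).trans h10
  have e16 := (hfr 16 (by omega) (by omega)).trans h16
  have e17 := (hfr 17 (by omega) (by omega)).trans h17
  simp [vc_set hS, ok_v hS, ok_ofNat hS, x2, e9, e10, e16, e17, h20]
  have hdiv : 11 ^ I.k / 4 ^ I.k ≤ 11 ^ I.k := Nat.div_le_self _ _
  have h11 : 0 < 11 ^ I.k := by positivity
  have hs1 : 4 * 11 ^ I.k * (E.size + 1) = 4 * 11 ^ I.k * E.size + 4 * 11 ^ I.k := by ring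
  have hs2 : 2 * (11 ^ I.k / 4 ^ I.k + 1) * E.size ≤ 4 * 11 ^ I.k * E.size :=
    Nat.mul_le_mul_right _ (by omega)
  have hs3 : (I.γ + 1) * (32 * 2 ^ I.k) ≤ (I.γ + 1) * (32 * 2 ^ I.k) * (I.γ + 1) :=
    Nat.le_mul_of_pos_right _ (by omega)
  have hs4 : I.γ + 1 ≤ (I.γ + 1) * (32 * 2 ^ I.k) := Nat.le_mul_of_pos_right _ (by positivity)
  have hpos : 0 < I.k := Nat.pos_of_ne_zero hk
  have hT : 2 * (11 ^ I.k / 4 ^ I.k + 1) * E.size = numTrials I.k E := rfl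
  rw [hT] at hs2 ⊢
  generalize 11 ^ I.k / 4 ^ I.k = q at *
  refine ⟨⟨⟨by omega, by omega⟩, by omega⟩, by omega, ⟨by omega, by omega⟩, by omega,
    ⟨by omega, by omega⟩, by omega, by omega, by omega, by omega, by omega, hpos, ?_, rfl⟩
  refine ⟨by simpa using e8, by simpa using e9, by simpa using e10, by simp, by simp, by simp,
    by simp, fun i hi => ?_⟩
  rw [Function.update_of_ne (by omega), Function.update_of_ne (by omega),
    Function.update_of_ne (by omega), Function.update_of_ne (by omega),
    Function.update_of_ne (by omega), hfr _ (by omega) (by omega), hpow i hi]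

end JobIntervalSelection

/-! ### The complete randomized algorithm -/

namespace JobIntervalSelection

open WordRAM WordRAM.Exp

/-- The randomized algorithm. -/
def randAlg : Cmd := .seq (.call randInit) <| .seq (.call <| .loop 0 (v 16) trial) .reject

variable {I : JobIntervalSelection}

-- With `j` trials left the guarantee on a yes-instance is `1 - (1 - q) ^ j`, where `q` is
-- `successProb`. Passing from `j` to `j + 1` turns `b` into `b + (1 - b) * q`, exactly the change
-- that `trial_spec` provides.
open Classical in
theorem randAlg_spec {E : ℕ} {Γ : Env} (hΓ : I.RandEnv E Γ) (hn : 0 < I.n) :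
    WP Γ randAlg (fun _ _ _ => False) (fun _ => 0)
      (100 * (I.k + E.size) + 300 + numTrials I.k E * (1700 * (I.n * 2 ^ I.k) + 10))
      (if I.IsYes then 1 - (1 - successProb I.k) ^ numTrials I.k E else 0) := by
  have hS := hΓ.std
  have hq : successProb I.k ≤ 1 := by
    have h1 : (I.k.factorial : ℝ) ≤ (I.k : ℝ) ^ I.k := by exact_mod_cast Nat.factorial_le_pow I.k
    have : (I.k.factorial : ℝ) / (I.k : ℝ) ^ I.k ≤ 1 := div_le_one_of_le₀ h1 (by positivity)
    rw [successProb]; linarith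
  set pr : ℕ → ℝ := fun j => if I.IsYes then 1 - (1 - successProb I.k) ^ j else 0 with hpr
  have hpr1 : ∀ j, pr j ≤ 1 := fun j => by
    simp only [hpr]
    split_ifs
    · have := pow_nonneg (sub_nonneg.mpr hq) j; linarith
    · exact zero_le_one
  have hT : numTrials I.k E < 2 ^ Γ.w := by
    refine lt_of_le_of_lt ?_ hΓ.fit3
    have : 11 ^ I.k / 4 ^ I.k ≤ 11 ^ I.k := Nat.div_le_self _ _
    have h11 : 0 < 11 ^ I.k := by positivity
    exact Nat.mul_le_mul (by omega) (by omega)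
  refine .of_vc ?_
  simp only [randAlg, vc_seq, vc_call]
  refine (randInit_spec hΓ (hpr1 (numTrials I.k E))).mono (by omega) ?_
  rintro ν n' p' ⟨hk, hν, h16, rfl⟩
  refine WP.loop (fun j ν p' => I.Static ν ∧ ν 16 = j ∧ p' = pr j ∧ j ≤ numTrials I.k E)
    (numTrials I.k E) (1700 * (I.n * 2 ^ I.k)) ⟨hν, h16, rfl, le_rfl⟩ ?_ ?_ ?_ ?_
  · rintro j ν p' ⟨-, h16, -, -⟩
    simp [ok_v hS, ok_ofNat hS, h16]
  · have : numTrials I.k E * (1700 * (I.n * 2 ^ I.k) + 10) =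
        numTrials I.k E * (1700 * (I.n * 2 ^ I.k) + 5) + numTrials I.k E * 5 := by ring
    simp only [cost_v, cost_ofNat, Nat.reduceAdd]
    omega
  · rintro j ν p' ⟨hν, h16, rfl, hj⟩
    refine (trial_spec hΓ hν hn hk h16 (by omega) (hpr1 j) ?_).imp ?_
    · by_cases hyes : I.IsYes
      · refine .inr ⟨hyes, ?_⟩
        simp only [hpr, if_pos hyes]
        ring
      · left
        simp only [hpr, if_neg hyes]
    · rintro ν' n' p' ⟨h1, h2, h3⟩
      exact ⟨h1, h2, h3, by omega⟩
  · rintro ν p' ⟨-, -, rfl, -⟩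
    refine ⟨by simp [hpr], ?_⟩
    have : numTrials I.k E * (1700 * (I.n * 2 ^ I.k) + 10) =
        numTrials I.k E * (1700 * (I.n * 2 ^ I.k) + 5) + numTrials I.k E * 5 := by ring
    simp only [cost_v, cost_ofNat, Nat.reduceAdd]
    omega

theorem size_le (E : ℕ) : E.size ≤ E := by
  rw [Nat.size_le]; exact Nat.lt_two_pow_self

/-- Word lengths that are large enough for the randomized algorithm. -/
theorem randEnv_of_le {E w : ℕ} (hE : 0 < E) (hn : 0 < I.n)
    (hw : 20 * (I.k + Nat.clog 2 (I.n + I.γ + E + 1)) ≤ w) :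
    I.RandEnv E ⟨w, E :: I.encode, fun a => a < 64 + 34 * 2 ^ I.k, I.IsYes, fun a ha => by omega⟩ := by
  set Z := I.n + I.γ + E + 1 with hZ
  -- All quantities that must fit into a word are at most `V ^ 8`, because small constants are
  -- absorbed by powers of `V ≥ 3`, while the word length allows `V ^ 20`.
  set V := 2 ^ I.k * Z with hV
  have hZ2 : Z ≤ 2 ^ Nat.clog 2 Z := Nat.le_pow_clog (by omega) _
  have hVw : V ^ 20 ≤ 2 ^ w := by
    calc V ^ 20 ≤ (2 ^ I.k * 2 ^ Nat.clog 2 Z) ^ 20 :=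
          Nat.pow_le_pow_left (Nat.mul_le_mul_left _ hZ2) _
      _ = 2 ^ (20 * (I.k + Nat.clog 2 Z)) := by rw [← pow_add, ← pow_mul, Nat.mul_comm]
      _ ≤ 2 ^ w := Nat.pow_le_pow_right (by omega) hw
  have hk1 : 1 ≤ 2 ^ I.k := Nat.one_le_two_pow
  have hZV : Z ≤ V := Nat.le_mul_of_pos_left _ hk1
  have hkV : 2 ^ I.k ≤ V := Nat.le_mul_of_pos_right _ (by omega)
  have hV3 : 3 ≤ V := by omega
  have h11 : 11 ^ I.k ≤ V ^ 4 := by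
    calc 11 ^ I.k ≤ 16 ^ I.k := Nat.pow_le_pow_left (by omega) _
      _ = (2 ^ I.k) ^ 4 := by rw [← pow_mul, Nat.mul_comm, pow_mul]; norm_num
      _ ≤ V ^ 4 := Nat.pow_le_pow_left hkV _
  have hp : ∀ a b : ℕ, a ≤ b → V ^ a ≤ V ^ b := fun a b h => Nat.pow_le_pow_right (by omega) h
  have h5 : 3 ^ 5 ≤ V ^ 5 := Nat.pow_le_pow_left hV3 _
  have h7 : V ^ 7 < V ^ 20 := Nat.pow_lt_pow_right (by omega) (by omega)
  have h6 : 243 * V ≤ V ^ 6 := by rw [pow_succ]; exact Nat.mul_le_mul_right _ h5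
  have h67 := hp 6 7 (by omega)
  have hs := size_le E
  refine ⟨⟨fun a ha => ?_, ?_⟩, rfl, fun a ha => ha, Iff.rfl, ?_, ?_, ?_, ?_, ?_⟩
  · change a < _; omega
  · change 128 ≤ 2 ^ w; omega
  · change 3 * I.n + 16 ≤ 2 ^ w; omega
  · change E < 2 ^ w; omega
  · change _ < 2 ^ w
    calc 4 * 11 ^ I.k * (E.size + 1) ≤ V ^ 2 * V ^ 4 * V :=
          Nat.mul_le_mul (Nat.mul_le_mul (by nlinarith) h11) (by omega)
      _ = V ^ 7 := by ring
      _ < V ^ 20 := h7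
      _ ≤ _ := hVw
  · change _ < 2 ^ w
    calc (I.γ + 1) * (32 * 2 ^ I.k) * (I.γ + 1) ≤ V * (V ^ 5 * V) * V :=
          Nat.mul_le_mul (Nat.mul_le_mul (by omega) (Nat.mul_le_mul (by omega) hkV)) (by omega)
      _ = V ^ 8 := by ring
      _ < V ^ 20 := Nat.pow_lt_pow_right (by omega) (by omega)
      _ ≤ _ := hVw
  · change 64 + 34 * 2 ^ I.k < 2 ^ w; omega

theorem successProb_eq (k : ℕ) :
    successProb k = 1 / 2 * ((k.factorial : ℝ) / (k : ℝ) ^ k) := rfl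

theorem rand_time_le {k n E : ℕ} {L : ℝ} (hn : 0 < n) (hL : 1 ≤ L) (hE : (E.size : ℝ) ≤ 4 * L) :
    ((100 * (k + E.size) + 300 + numTrials k E * (1700 * (n * 2 ^ k) + 10) : ℕ) : ℝ) ≤
      (30000 : ℕ) * (5.5 : ℝ) ^ k * L * n := by
  have h1 := numTrials_le k E
  have hn1 : (1 : ℝ) ≤ n := by exact_mod_cast hn
  have e55 : (5.5 : ℝ) ^ k = (11 / 4) ^ k * 2 ^ k := by rw [← mul_pow]; norm_num
  have h2 : (1 : ℝ) ≤ 2 ^ k := one_le_pow₀ (by norm_num)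
  have h3 : (1 : ℝ) ≤ (11 / 4) ^ k := one_le_pow₀ (by norm_num)
  have h4 : (k : ℝ) ≤ 2 ^ k := by exact_mod_cast Nat.lt_two_pow_self.le
  set A : ℝ := (11 / 4) ^ k
  set B : ℝ := 2 ^ k
  have hs : (0 : ℝ) ≤ E.size := by positivity
  have hnB : 1 ≤ (n : ℝ) * B := one_le_mul_of_one_le_of_one_le hn1 h2
  have hT : (numTrials k E : ℝ) ≤ 16 * (A * L) := by nlinarith
  have hAL : 1 ≤ A * L := one_le_mul_of_one_le_of_one_le h3 hL
  have hLAL : L ≤ A * L := le_mul_of_one_le_left (by linarith) h3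
  have hX : A * L ≤ A * L * (n * B) := le_mul_of_one_le_right (by linarith) hnB
  have hB : B ≤ A * L * (n * B) := by
    have : B ≤ n * B := le_mul_of_one_le_left (by linarith) hn1
    exact this.trans (le_mul_of_one_le_left (by linarith) hAL)
  push_cast
  rw [e55]
  have e1 : (numTrials k E : ℝ) * (1700 * (n * B) + 10) ≤ 16 * (A * L) * (1710 * (n * B)) := by
    refine mul_le_mul hT (by linarith) (by positivity) (by positivity)
  have e2 : (30000 : ℝ) * (A * B) * L * n = 30000 * (A * L * (n * B)) := by ring
  rw [e2]
  nlinarith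

theorem randomized :
    ∃ (P : WordRAM.Program) (C : ℕ),
      ∀ (I : JobIntervalSelection), 0 < I.n → ∀ ε : ℝ, 0 < ε → ε < 1 →
      ∀ w : ℕ, C * (I.k + Nat.clog 2 (I.n + I.γ + ⌈1 / ε⌉₊ + 1)) ≤ w →
      ∃ t s : ℕ,
        (t : ℝ) ≤ C * (5.5 : ℝ) ^ I.k * max 1 |Real.log ε| * I.n ∧
        s ≤ C * 2 ^ I.k * (I.rep.maxLength + 1) ∧
        WordRAM.HaltsWithin P w (⌈1 / ε⌉₊ :: I.encode) t ∧
        WordRAM.SpaceWithin P w (⌈1 / ε⌉₊ :: I.encode) s ∧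
        (¬ I.IsYes → WordRAM.acceptProb P w (⌈1 / ε⌉₊ :: I.encode) t = 0) ∧
        (I.IsYes →
          ENNReal.ofReal (1 - ε) ≤ WordRAM.acceptProb P w (⌈1 / ε⌉₊ :: I.encode) t) := by
  classical
  refine ⟨randAlg.program, 30000, fun I hn ε hε hε1 w hw => ?_⟩
  set E := ⌈1 / ε⌉₊ with hEdef
  have hE0 : 0 < E := Nat.ceil_pos.mpr (by positivity)
  have hΓ := randEnv_of_le (I := I) hE0 hn (le_trans (Nat.mul_le_mul_right _ (by norm_num)) hw)
  obtain ⟨h1, h2, h3, h4⟩ := (randAlg_spec hΓ hn).good.run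
  refine ⟨_, 64 + 34 * 2 ^ I.k, rand_time_le hn (le_max_left _ _) (size_le_max_one_log hε hε1), ?_, h1,
    h2 _ fun a ha => ha, fun hno => ?_, fun hyes => ?_⟩
  -- The table and the hash cells need `O(2 ^ k)` words only; the factor `maxLength + 1` is slack.
  · have : 1 ≤ 2 ^ I.k := Nat.one_le_two_pow
    calc 64 + 34 * 2 ^ I.k ≤ 30000 * 2 ^ I.k := by omega
      _ ≤ _ := Nat.le_mul_of_pos_right _ (by omega)
  · rw [acceptProb, PMF.toOuterMeasure_apply_eq_zero_iff, Set.disjoint_left]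
    exact fun σ hσ hacc => hno (h3 σ hσ hacc)
  · rw [if_pos hyes] at h4
    refine le_trans (ENNReal.ofReal_le_ofReal ?_) h4
    have := pow_numTrials_le (k := I.k) hε (Nat.le_ceil (1 / ε))
    rw [← successProb_eq] at this
    linarith

end JobIntervalSelection

/-! ## Wedge products on bit masks -/

theorem testBit_sub_two_pow {m j : ℕ} (h : m.testBit j = true) (i : ℕ) :
    (m - 2 ^ j).testBit i = (m.testBit i && decide (i ≠ j)) := by
  obtain ⟨T, rfl⟩ : ∃ T : Finset ℕ, ∑ i ∈ T, 2 ^ i = m :=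
    ⟨m.bitIndices.toFinset, by
      rw [List.sum_toFinset _ Nat.bitIndices_sorted.nodup, Nat.sum_map_two_pow_bitIndices]⟩
  have hj := (testBit_sum_two_pow T j).mp h
  have e : ∑ i ∈ T, 2 ^ i - 2 ^ j = ∑ i ∈ T.erase j, 2 ^ i := by
    rw [← Finset.add_sum_erase _ _ hj]; omega
  rw [e, Bool.eq_iff_iff, testBit_sum_two_pow, Bool.and_eq_true, testBit_sum_two_pow]
  simp [and_comm]

theorem two_pow_le_sub_two_pow {m j k : ℕ} (h : m.testBit j = true) (hj : j < k)
    (hm : 2 ^ k ≤ m) : 2 ^ k ≤ m - 2 ^ j := by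
  obtain ⟨i, hi, hb⟩ := Nat.exists_ge_and_testBit_of_ge_two_pow hm
  refine le_trans (Nat.pow_le_pow_right (by omega) hi) (Nat.ge_two_pow_of_testBit ?_)
  rw [testBit_sub_two_pow h, hb]
  simp; omega

namespace Wedge

variable {F : Type*} [Field F]

/-- Removal of the bit `j`. -/
def del (j : ℕ) : Module.End F (ℕ → F) where
  toFun x m := if m.testBit j then x (m - 2 ^ j) else 0
  map_add' x y := by ext m; simp only [Pi.add_apply]; split_ifs <;> simp
  map_smul' c x := by ext m; simp

/-- Change of sign at the masks with bit `j`. -/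
def sgn (j : ℕ) : Module.End F (ℕ → F) where
  toFun x m := if m.testBit j then - x m else x m
  map_add' x y := by ext m; simp only [Pi.add_apply]; split_ifs <;> ring
  map_smul' c x := by ext m; simp

theorem del_apply (j : ℕ) (x : ℕ → F) (m : ℕ) :
    del j x m = if m.testBit j then x (m - 2 ^ j) else 0 := rfl

theorem sgn_apply (j : ℕ) (x : ℕ → F) (m : ℕ) :
    sgn j x m = if m.testBit j then - x m else x m := rfl

theorem del_mul_del (j : ℕ) : del j * del j = (0 : Module.End F (ℕ → F)) := by
  ext x m
  simp only [Module.End.mul_apply, del_apply, LinearMap.zero_apply, Pi.zero_apply]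
  split_ifs with h1 h2 <;> try rfl
  rw [testBit_sub_two_pow h1] at h2
  simp at h2

theorem sgn_mul_del (j : ℕ) : sgn j * del j = -(del j : Module.End F (ℕ → F)) := by
  ext x m
  simp only [Module.End.mul_apply, sgn_apply, del_apply, LinearMap.neg_apply, Pi.neg_apply]
  split_ifs <;> simp

theorem del_mul_sgn (j : ℕ) : del j * sgn j = (del j : Module.End F (ℕ → F)) := by
  ext x m
  simp only [Module.End.mul_apply, sgn_apply, del_apply]
  split_ifs with h1 h2 <;> try rfl
  rw [testBit_sub_two_pow h1] at h2
  simp at h2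

theorem commute_del_del {i j : ℕ} (h : i ≠ j) :
    Commute (del i) (del j : Module.End F (ℕ → F)) := by
  ext x m
  simp only [Module.End.mul_apply, del_apply]
  by_cases h1 : m.testBit i = true <;> by_cases h2 : m.testBit j = true
  · simp [h1, h2, testBit_sub_two_pow h1, testBit_sub_two_pow h2, h, h.symm, Nat.sub_right_comm]
  · simp [h1, h2, testBit_sub_two_pow h1]
  · simp [h1, h2, testBit_sub_two_pow h2]
  · simp [h1, h2]

theorem commute_del_sgn {i j : ℕ} (h : i ≠ j) :
    Commute (del i) (sgn j : Module.End F (ℕ → F)) := by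
  ext x m
  simp only [Module.End.mul_apply, del_apply, sgn_apply]
  by_cases h1 : m.testBit i = true
  · simp [h1, testBit_sub_two_pow h1, h.symm]
  · simp [h1]

theorem commute_sgn_sgn (i j : ℕ) :
    Commute (sgn i) (sgn j : Module.End F (ℕ → F)) := by
  ext x m
  simp only [Module.End.mul_apply, sgn_apply]
  split_ifs <;> rfl

/-- Multiplication from the left by the vector of the first `j` entries of `u` in the exterior
algebra, whose basis is indexed by masks. -/
def mul : ℕ → (ℕ → F) →ₗ[F] Module.End F (ℕ → F)
  | 0 => 0
  | j + 1 => (LinearMap.proj j).smulRight (del j) + LinearMap.mulLeft F (sgn j) ∘ₗ mul j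

theorem mul_succ (j : ℕ) (u : ℕ → F) : mul (j + 1) u = u j • del j + sgn j * mul j u := rfl

theorem mul_zero_apply (u x : ℕ → F) (m : ℕ) : mul 0 u x m = 0 := rfl

/-- Masks stand for products of unit vectors in decreasing order of their indices, so a new factor
at bit `i` has to pass the larger indices. Negating the accumulated value at each later bit of `m`
produces this sign, and an entry costs only `O(k)` operations. -/
theorem mul_succ_apply (j : ℕ) (u x : ℕ → F) (m : ℕ) : mul (j + 1) u x m =
    if m.testBit j then u j * x (m - 2 ^ j) - mul j u x m else mul j u x m := by
  rw [mul_succ, LinearMap.add_apply, Pi.add_apply, Module.End.mul_apply, sgn_apply,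
    LinearMap.smul_apply, Pi.smul_apply, del_apply, smul_eq_mul]
  split_ifs <;> ring

theorem commute_mul {j i : ℕ} (h : j ≤ i) (u : ℕ → F) :
    Commute (mul j u) (del i) ∧ Commute (mul j u) (sgn i) := by
  induction j with
  | zero => exact ⟨Commute.zero_left _, Commute.zero_left _⟩
  | succ j ih =>
    obtain ⟨h1, h2⟩ := ih (by omega)
    have hij : j ≠ i := by omega
    rw [mul_succ]
    exact ⟨((commute_del_del hij).smul_left _).add_left
      (((commute_del_sgn hij.symm).symm).mul_left h1),
      ((commute_del_sgn hij).smul_left _).add_left ((commute_sgn_sgn j i).mul_left h2)⟩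

/-- By induction on the bits: `del j` squares to zero, and since `sgn j * del j = -del j` but `del j
* sgn j = del j`, the mixed terms cancel. This relation is what lifts `mul k` to the exterior
algebra. -/
theorem mul_mul_self (j : ℕ) (u : ℕ → F) : mul j u * mul j u = 0 := by
  induction j with
  | zero => rfl
  | succ j ih =>
    obtain ⟨h1, h2⟩ := commute_mul (le_refl j) u
    have e1 : u j • del j * (sgn j * mul j u) = u j • (del j * mul j u) := by
      rw [smul_mul_assoc, ← mul_assoc, del_mul_sgn]
    have e2 : sgn j * mul j u * (u j • del j) = - (u j • (del j * mul j u)) := by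
      have e0 : sgn j * (del j * mul j u) = -(del j * mul j u) := by
        rw [← mul_assoc, sgn_mul_del]; rfl
      rw [mul_smul_comm, mul_assoc, h1.eq, e0, smul_neg]
    have e3 : sgn j * mul j u * (sgn j * mul j u) = 0 := by
      rw [mul_assoc, ← mul_assoc (mul j u), h2.eq, mul_assoc, ih, mul_zero, mul_zero]
    rw [mul_succ, add_mul, mul_add, mul_add, e1, e2, e3, smul_mul_smul_comm, del_mul_del, smul_zero]
    abel

theorem mul_apply_eq_zero {k : ℕ} {x : ℕ → F} (hx : ∀ m, 2 ^ k ≤ m → x m = 0) (u : ℕ → F) {j : ℕ}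
    (hj : j ≤ k) {m : ℕ} (hm : 2 ^ k ≤ m) : mul j u x m = 0 := by
  induction j with
  | zero => rfl
  | succ j ih =>
    rw [mul_succ_apply, ih (by omega)]
    split_ifs with h
    · rw [hx _ (two_pow_le_sub_two_pow h hj hm)]; simp
    · rfl

theorem exists_of_mul_apply_ne_zero {j : ℕ} {u x : ℕ → F} {m : ℕ} (h : mul j u x m ≠ 0) :
    ∃ i < j, m.testBit i = true ∧ x (m - 2 ^ i) ≠ 0 := by
  induction j with
  | zero => exact absurd rfl h
  | succ j ih =>
    rw [mul_succ_apply] at h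
    by_cases h0 : mul j u x m = 0
    · split_ifs at h with hb
      · rw [h0, sub_zero] at h
        exact ⟨j, by omega, hb, right_ne_zero_of_mul h⟩
      · exact absurd h0 h
    · obtain ⟨i, hi, h'⟩ := ih h0
      exact ⟨i, by omega, h'⟩

/-- The exterior product of a list of vectors of length `k`. -/
def prod (k : ℕ) (l : List (ℕ → F)) : ℕ → F := (l.map (mul k)).prod (Pi.single 0 1)

theorem prod_nil (k : ℕ) : prod k [] = (Pi.single 0 1 : ℕ → F) := rfl

theorem prod_cons (k : ℕ) (u : ℕ → F) (l : List (ℕ → F)) :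
    prod k (u :: l) = mul k u (prod k l) := rfl

/-- The grading: every factor adds one new bit to the mask. -/
theorem exists_of_prod_ne_zero {k : ℕ} {l : List (ℕ → F)} {m : ℕ} (h : prod k l m ≠ 0) :
    ∃ T : Finset ℕ, T ⊆ Finset.range k ∧ T.card = l.length ∧ m = ∑ i ∈ T, 2 ^ i := by
  induction l generalizing m with
  | nil =>
    refine ⟨∅, by simp, by simp, ?_⟩
    by_contra hm
    exact h (by rw [prod_nil, Pi.single_eq_of_ne (by simpa using hm)])
  | cons u l ih =>
    rw [prod_cons] at h
    obtain ⟨i, hi, hb, h'⟩ := exists_of_mul_apply_ne_zero h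
    obtain ⟨T, hT, hc, hs⟩ := ih h'
    have hiT : i ∉ T := fun hiT => by
      rw [← testBit_sum_two_pow, ← hs, testBit_sub_two_pow hb] at hiT
      simp at hiT
    refine ⟨insert i T, ?_, by rw [Finset.card_insert_of_notMem hiT, hc]; simp, ?_⟩
    · exact Finset.insert_subset (Finset.mem_range.mpr hi) hT
    · have := Nat.ge_two_pow_of_testBit hb
      rw [Finset.sum_insert hiT, ← hs]; omega

/-- Extension of a vector by zeros. -/
def extend (k : ℕ) : (Fin k → F) →ₗ[F] (ℕ → F) where
  toFun x j := if h : j < k then x ⟨j, h⟩ else 0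
  map_add' x y := by ext j; simp only [Pi.add_apply]; split_ifs <;> simp
  map_smul' c x := by ext j; simp

theorem mul_congr {j : ℕ} {u u' : ℕ → F} (h : ∀ i < j, u i = u' i) : mul j u = mul j u' := by
  induction j with
  | zero => rfl
  | succ j ih => rw [mul_succ, mul_succ, h j (by omega), ih fun i hi => h i (by omega)]

/-- The coordinate at the full mask of the exterior product of `k` vectors of length `k`. -/
noncomputable def full (k : ℕ) : (Fin k → F) [⋀^Fin k]→ₗ[F] F :=
  (LinearMap.proj (2 ^ k - 1) ∘ₗ LinearMap.applyₗ (Pi.single 0 1 : ℕ → F) ∘ₗ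
    (ExteriorAlgebra.lift F ⟨mul k ∘ₗ extend k, fun _ => mul_mul_self _ _⟩).toLinearMap).compAlternatingMap
    (ExteriorAlgebra.ιMulti F k)

theorem full_apply (k : ℕ) (u : Fin k → Fin k → F) :
    full k u = prod k (List.ofFn fun i => extend k (u i)) (2 ^ k - 1) := by
  change (ExteriorAlgebra.lift F ⟨mul k ∘ₗ extend k, fun _ => mul_mul_self _ _⟩
    (ExteriorAlgebra.ιMulti F k u) : Module.End F (ℕ → F)) (Pi.single 0 1) (2 ^ k - 1) = _
  rw [ExteriorAlgebra.ιMulti_apply, map_list_prod, prod, List.map_ofFn, List.map_ofFn]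
  congr! 4
  ext1 i
  simp

/-- The factor has a larger index than all those already present, so no sign appears. -/
theorem mul_single_apply {k i : ℕ} (hi : i < k) :
    mul k (Pi.single i 1 : ℕ → F) (Pi.single (2 ^ i - 1) 1) = Pi.single (2 ^ (i + 1) - 1) 1 := by
  induction k with
  | zero => omega
  | succ k ih =>
    ext m
    rw [mul_succ_apply]
    rcases (Nat.lt_succ_iff.mp hi).eq_or_lt with rfl | hlt
    · have e0 : mul i (Pi.single i 1 : ℕ → F) = 0 := by
        rw [mul_congr (u' := 0) fun j hj => Pi.single_eq_of_ne (show j ≠ i by omega) _, map_zero]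
      have h1 := Nat.two_pow_pos i
      rw [e0, Pi.single_eq_same, one_mul, LinearMap.zero_apply, Pi.zero_apply, sub_zero, pow_succ]
      split_ifs with h
      · have h2 := Nat.ge_two_pow_of_testBit h
        by_cases hm : m = 2 ^ i * 2 - 1
        · rw [hm, Pi.single_eq_same, show 2 ^ i * 2 - 1 - 2 ^ i = 2 ^ i - 1 by omega,
            Pi.single_eq_same]
        · rw [Pi.single_eq_of_ne hm, Pi.single_eq_of_ne (by omega)]
      · rw [Pi.single_eq_of_ne]
        rintro rfl
        rw [← pow_succ, Nat.testBit_two_pow_sub_one] at h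
        simp at h
    · rw [ih hlt, Pi.single_eq_of_ne (by omega), zero_mul, zero_sub]
      split_ifs with h
      · rw [Pi.single_eq_of_ne, neg_zero]
        rintro rfl
        rw [Nat.testBit_two_pow_sub_one] at h
        simp at h; omega
      · rfl

theorem extend_single {k : ℕ} (i : Fin k) :
    extend k (Pi.single i 1 : Fin k → F) = Pi.single (i : ℕ) 1 := by
  ext j
  change (if h : j < k then (Pi.single i 1 : Fin k → F) ⟨j, h⟩ else 0) = _
  by_cases hj : j = i
  · subst hj
    rw [dif_pos i.2]; simp
  · rw [Pi.single_eq_of_ne hj]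
    split_ifs with h
    · exact Pi.single_eq_of_ne (fun h' => hj (by rw [← h'])) _
    · rfl

theorem full_ne_zero (k : ℕ) : (full k : (Fin k → F) [⋀^Fin k]→ₗ[F] F) ≠ 0 := by
  intro h
  -- The unit vectors are multiplied in decreasing order, which is the order of the factors in the
  -- basis, so the coordinate is exactly 1.
  have h1 : full k (fun i => (Pi.single i.rev 1 : Fin k → F)) = 1 := by
    rw [full_apply]
    simp only [extend_single]
    have key : ∀ j ≤ k, prod k (List.ofFn fun i : Fin j => (Pi.single (i.rev : ℕ) 1 : ℕ → F)) =
        Pi.single (2 ^ j - 1) 1 := by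
      intro j hj
      induction j with
      | zero => rfl
      | succ j ih =>
        rw [List.ofFn_succ, prod_cons]
        have := ih (by omega)
        simp only [Fin.rev_succ, Fin.val_castSucc, Fin.rev_zero, Fin.val_last]
        rw [this, mul_single_apply (by omega)]
    rw [key k le_rfl, Pi.single_eq_same]
  rw [h] at h1
  exact zero_ne_one h1

/-- The vector of the powers of `c`. -/
def powers (c : F) : ℕ → F := fun j => c ^ j

/-- A repeated number kills an alternating map. Distinct numbers give the rows of an invertible
Vandermonde matrix, that is, a basis, and a nonzero alternating map of top degree does not vanish on
a basis. -/
theorem prod_powers_ne_zero_iff {k : ℕ} {l : List F} (hl : l.length = k) :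
    prod k (l.map powers) (2 ^ k - 1) ≠ 0 ↔ l.Nodup := by
  subst hl
  have e : prod l.length (l.map powers) (2 ^ l.length - 1) =
      full l.length fun (i j : Fin l.length) => l.get i ^ (j : ℕ) := by
    rw [full_apply, prod, prod, List.map_ofFn, List.map_map]
    congr! 3
    refine List.ext_getElem (by simp) fun i hi _ => ?_
    rw [List.length_map] at hi
    rw [List.getElem_map, List.getElem_ofFn]
    refine mul_congr (F := F) fun j hj => ?_
    change _ = if h : j < l.length then _ else _
    rw [dif_pos hj]
    rfl
  rw [e]
  constructor
  · intro h
    rw [List.nodup_iff_injective_get]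
    intro i j hij
    by_contra hne
    exact h ((full _).map_eq_zero_of_eq _ (by simp only [hij]) hne)
  · intro h
    have hdet := Matrix.det_vandermonde_ne_zero_iff.mpr (List.nodup_iff_injective_get.mp h)
    have hli : LinearIndependent F fun i : Fin l.length => (fun j : Fin l.length =>
        l.get i ^ (j : ℕ)) :=
      Matrix.linearIndependent_rows_iff_isUnit.mpr
        ((Matrix.isUnit_iff_isUnit_det (Matrix.vandermonde l.get)).mpr hdet.isUnit)
    have := (AlternatingMap.map_basis_ne_zero_iff
      (basisOfLinearIndependentOfCardEqFinrank' _ hli (by simp)) (full l.length)).mpr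
      (full_ne_zero _)
    rwa [coe_basisOfLinearIndependentOfCardEqFinrank'] at this

/-- Only products of `k` vectors reach the full mask. Therefore products of chains of all lengths
may share one span. -/
theorem prod_powers_ne_zero {k : ℕ} {l : List F} (h : prod k (l.map powers) (2 ^ k - 1) ≠ 0) :
    l.length = k ∧ l.Nodup := by
  obtain ⟨T, -, hc, hs⟩ := exists_of_prod_ne_zero h
  have hk : l.length = k := by
    rw [eq_range_of_sum_two_pow hs.symm, Finset.card_range, List.length_map] at hc
    exact hc.symm
  exact ⟨hk, (prod_powers_ne_zero_iff hk).mp h⟩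

theorem prod_apply_eq_zero {k : ℕ} {l : List (ℕ → F)} (hl : l.length = k) {m : ℕ}
    (hm : m ≠ 2 ^ k - 1) : prod k l m = 0 := by
  by_contra h
  obtain ⟨T, hT, hc, hs⟩ := exists_of_prod_ne_zero h
  have : T = Finset.range k := Finset.eq_of_subset_of_card_le hT (by simp [hc, hl])
  rw [this, sum_two_pow_range] at hs
  exact hm hs

/-- A combination of rows in echelon form that vanishes at all pivots is zero. -/
theorem eq_zero_of_mem_span_echelon {row : ℕ → ℕ → F} {J : Finset ℕ}
    (hrow : ∀ j ∈ J, row j j ≠ 0 ∧ ∀ i < j, row j i = 0) {x : ℕ → F}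
    (hx : x ∈ Submodule.span F (row '' J)) (h0 : ∀ j ∈ J, x j = 0) : x = 0 := by
  induction J using Finset.induction_on_min generalizing x with
  | empty => simpa using hx
  | insert a J ha ih =>
    rw [Finset.coe_insert, Set.image_insert_eq, Submodule.mem_span_insert] at hx
    obtain ⟨c, y, hy, rfl⟩ := hx
    -- At the smallest pivot `a` all other rows vanish, so the coefficient of the row `a` must be
    -- zero.
    have hya : y a = 0 := by
      have : Submodule.span F (row '' (J : Set ℕ)) ≤ LinearMap.ker (LinearMap.proj a) := by
        rw [Submodule.span_le]
        rintro _ ⟨j, hj, rfl⟩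
        exact (hrow j (Finset.mem_insert_of_mem hj)).2 a (ha j hj)
      exact this hy
    have hc : c = 0 := by
      have := h0 a (Finset.mem_insert_self _ _)
      rw [Pi.add_apply, hya, add_zero, Pi.smul_apply, smul_eq_mul] at this
      exact (mul_eq_zero.mp this).resolve_right (hrow a (Finset.mem_insert_self _ _)).1
    subst hc
    rw [zero_smul, zero_add] at h0 ⊢
    exact ih (fun j hj => hrow j (Finset.mem_insert_of_mem hj)) hy
      fun j hj => h0 j (Finset.mem_insert_of_mem hj)

end Wedge

/-! ## Linear algebra modulo a prime on the word RAM -/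

namespace Wedge

open WordRAM WordRAM.Exp

/-- The constants that the program uses: `k`, the prime `q`, and the address `U` at which the arrays
start, namely the powers of the color (`k` cells), a vector, the start points that belong to the
rows (`2 ^ k` cells each), and the rows (`2 ^ k * 2 ^ k` cells). -/
structure Layout (k q U : ℕ) (Γ : Env) : Prop where
  std : Γ.Std
  cell : ∀ a, Γ.A a
  base : 64 ≤ U
  fit : U + k + 2 * 2 ^ k + 2 ^ k * 2 ^ k < 2 ^ Γ.w
  fitq : q * q + q * q < 2 ^ Γ.w
  prime : q.Prime

/-- The cells with the constants. -/
structure Consts (k q U : ℕ) (μ : ℕ → ℕ) : Prop where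
  c9 : μ 9 = k
  c10 : μ 10 = 2 ^ k
  c11 : μ 11 = U
  c12 : μ 12 = U + k
  c13 : μ 13 = U + k + 2 ^ k
  c14 : μ 14 = U + k + 2 * 2 ^ k
  c15 : μ 15 = q

theorem Consts.congr {k q U : ℕ} {μ ν : ℕ → ℕ} (h : Consts k q U μ)
    (hν : ∀ a, 8 < a → a < 16 → ν a = μ a) : Consts k q U ν := by
  refine ⟨?_, ?_, ?_, ?_, ?_, ?_, ?_⟩ <;> rw [hν _ (by omega) (by omega)]
  exacts [h.c9, h.c10, h.c11, h.c12, h.c13, h.c14, h.c15]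

/-- The vector with `n` entries modulo `q` at the address `a`. -/
def vecAt (q : ℕ) (μ : ℕ → ℕ) (n a : ℕ) : ℕ → ZMod q := fun i => if i < n then (μ (a + i) : ZMod q) else 0

theorem vecAt_congr {q n a : ℕ} {μ ν : ℕ → ℕ} (h : ∀ i < n, ν (a + i) = μ (a + i)) :
    vecAt q ν n a = vecAt q μ n a := by
  ext i
  simp only [vecAt]
  split_ifs with hi
  · rw [h i hi]
  · rfl

theorem vecAt_of_lt {q n a i : ℕ} {μ : ℕ → ℕ} (h : i < n) : vecAt q μ n a i = μ (a + i) :=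
  if_pos h

theorem vecAt_of_le {q n a i : ℕ} {μ : ℕ → ℕ} (h : n ≤ i) : vecAt q μ n a i = 0 :=
  if_neg (by omega)

/-- Machine words are nonnegative, so a subtraction modulo `q` is carried out by adding the
complement `q - c`. -/
theorem natCast_mul_add_sub_mul_mod {q a b c d : ℕ} (hc : c ≤ q) :
    (((a * b + (q - c) * d) % q : ℕ) : ZMod q) = a * b - c * d := by
  rw [ZMod.natCast_mod]
  push_cast [Nat.cast_sub hc]
  simp [sub_eq_add_neg]

/-- Computes the entry of a wedge product whose mask is in cell `22`; the address of the factor is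
in cell `21`. -/
def mulEntry : Cmd :=
  .seq (.set 23 0) <| .seq (.set 24 1) <| .seq (.set 25 0) <| .loop (v 23) (v 9) <|
    .seq (.ite 0 (v 22 / v 24 % 2)
      (.set 25 ((ld (v 11 + v 23) * ld (v 21 + (v 22 - v 24)) + (v 15 - v 25)) % v 15)) .skip) <|
    .seq (.set 24 (v 24 + v 24)) (.set 23 (v 23 + 1))

variable {k q U : ℕ} {Γ : Env}

/-- The loop is the recursion `mul_succ_apply`: after `j` rounds cell 25 contains the entry of the
product with the first `j` entries of `u`, and cell 24 the bit `2 ^ j`. -/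
theorem mulEntry_spec [Fact q.Prime] (hΓ : Layout k q U Γ) {μ : ℕ → ℕ} (hμ : Consts k q U μ)
    {a m : ℕ} (h21 : μ 21 = a) (h22 : μ 22 = m) (ha : 64 ≤ a) (haw : a + 2 ^ k < 2 ^ Γ.w)
    (hm : m < 2 ^ k) (hsmall : ∀ i < 2 ^ k, μ (a + i) < q) {u : ℕ → ZMod q}
    (hu : ∀ j < k, μ (U + j) < q ∧ (μ (U + j) : ZMod q) = u j) :
    HT Γ mulEntry μ (60 * k + 15) fun ν => (∀ b, b < 23 ∨ 25 < b → ν b = μ b) ∧ ν 25 < q ∧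
      (ν 25 : ZMod q) = mul k u (vecAt q μ (2 ^ k) a) m := by
  intro p
  have hS := hΓ.std
  have hq := hΓ.prime.pos
  have hbase := hΓ.base
  have hfit := hΓ.fit
  have hfitq := hΓ.fitq
  have hqq : q ≤ q * q := Nat.le_mul_of_pos_left _ hq
  refine .of_vc ?_
  simp [mulEntry, vc_set hS, ok_ofNat hS]
  refine WP.loop (fun i ν p' => p' = p ∧ i ≤ k ∧ ν 23 = k - i ∧ ν 24 = 2 ^ (k - i) ∧
    (∀ b, b < 23 ∨ 25 < b → ν b = μ b) ∧ ν 25 < q ∧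
      (ν 25 : ZMod q) = mul (k - i) u (vecAt q μ (2 ^ k) a) m) k 54 ?_ ?_ ?_ ?_ ?_
  · refine ⟨rfl, le_rfl, by simp, by simp, fun b hb => ?_, by simpa using hq, ?_⟩
    · rw [Function.update_of_ne (by omega), Function.update_of_ne (by omega),
        Function.update_of_ne (by omega)]
    · simp [mul_zero_apply]
  · rintro i ν p' ⟨-, hi, h23, -, hfr, -⟩
    have e9 : ν 9 = k := (hfr 9 (by omega)).trans hμ.c9
    simp [ok_v hS, e9, h23]
    omega
  · simp; omega
  · rintro i ν p' ⟨rfl, hi, h23, h24, hfr, h25, hval⟩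
    refine .of_vc ?_
    have e9 : ν 9 = k := (hfr 9 (by omega)).trans hμ.c9
    have e11 : ν 11 = U := (hfr 11 (by omega)).trans hμ.c11
    have e15 : ν 15 = q := (hfr 15 (by omega)).trans hμ.c15
    have e21 : ν 21 = a := (hfr 21 (by omega)).trans h21
    have e22 : ν 22 = m := (hfr 22 (by omega)).trans h22
    obtain ⟨j, hj⟩ : ∃ j, k - (i + 1) = j := ⟨_, rfl⟩
    have hj' : k - i = j + 1 := by omega
    have hjk : j < k := by omega
    rw [hj] at h23 h24 hval
    rw [hj']
    have hpow : 2 ^ (j + 1) ≤ 2 ^ k := Nat.pow_le_pow_right (by omega) (by omega)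
    have hp1 : 2 ^ (j + 1) = 2 ^ j + 2 ^ j := by rw [pow_succ]; omega
    obtain ⟨hu1, hu2⟩ := hu j hjk
    have eu : ν (U + j) = μ (U + j) := hfr _ (by omega)
    simp [vc_set hS, ok_ofNat hS, ok_v hS, e11, e15, e21, e22, h23, h24,
      two_pow_div_mod_two]
    refine ⟨fun hb => ?_, fun hb => ?_⟩
    · replace hb : m.testBit j = true := by
        by_contra h
        simp [h] at hb
      have hmj := Nat.ge_two_pow_of_testBit hb
      have ea : ν (a + (m - 2 ^ j)) = μ (a + (m - 2 ^ j)) := hfr _ (by omega)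
      have hs := hsmall (m - 2 ^ j) (by omega)
      rw [eu, ea]
      have hprod := Nat.mul_le_mul hu1.le hs.le
      and_intros
      all_goals first | omega | exact hΓ.cell _ | exact Nat.mod_lt _ hq | skip
      · intro b hb
        rw [Function.update_of_ne (by omega), Function.update_of_ne (by omega),
          Function.update_of_ne (by omega), hfr b hb]
      · rw [Nat.cast_sub h25.le, ZMod.natCast_self, hu2, hval, mul_succ_apply, if_pos hb,
          vecAt_of_lt (by omega), zero_sub, sub_eq_add_neg]
    · refine ⟨by omega, by omega, by omega, by omega, ?_, h25, ?_⟩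
      · intro b hb
        rw [Function.update_of_ne (by omega), Function.update_of_ne (by omega), hfr b hb]
      · rw [hval, mul_succ_apply, if_neg (by simp [hb])]
  · rintro ν p' ⟨rfl, -, -, -, hfr, h25, hval⟩
    exact ⟨⟨hfr, h25, by simpa using hval⟩, rfl⟩

/-- Computes a wedge product. -/
def mulVec : Cmd :=
  .seq (.set 22 0) <| .loop (v 22) (v 10) <|
    .seq (.call mulEntry) <| .seq (.store (v 12 + v 22) (v 25)) (.set 22 (v 22 + 1))

theorem mulVec_spec [Fact q.Prime] (hΓ : Layout k q U Γ) {μ : ℕ → ℕ} (hμ : Consts k q U μ)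
    {a : ℕ} (h21 : μ 21 = a) (ha : U + k + 2 ^ k ≤ a) (haw : a + 2 ^ k < 2 ^ Γ.w)
    (hsmall : ∀ i < 2 ^ k, μ (a + i) < q) {u : ℕ → ZMod q}
    (hu : ∀ j < k, μ (U + j) < q ∧ (μ (U + j) : ZMod q) = u j) :
    HT Γ mulVec μ (2 ^ k * (60 * k + 50) + 10) fun ν =>
      (∀ b, b < 22 ∨ (25 < b ∧ b < U + k) ∨ U + k + 2 ^ k ≤ b → ν b = μ b) ∧
      (∀ i < 2 ^ k, ν (U + k + i) < q) ∧
      vecAt q ν (2 ^ k) (U + k) = mul k u (vecAt q μ (2 ^ k) a) := by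
  intro p
  have hS := hΓ.std
  have hbase := hΓ.base
  have hfit := hΓ.fit
  refine .of_vc ?_
  simp [mulVec, vc_set hS, ok_ofNat hS]
  refine WP.loop (fun i ν p' => p' = p ∧ i ≤ 2 ^ k ∧ ν 22 = 2 ^ k - i ∧
    (∀ b, b < 22 ∨ (25 < b ∧ b < U + k) ∨ U + k + 2 ^ k ≤ b → ν b = μ b) ∧
    ∀ m < 2 ^ k - i, ν (U + k + m) < q ∧
      (ν (U + k + m) : ZMod q) = mul k u (vecAt q μ (2 ^ k) a) m) (2 ^ k) (60 * k + 35) ?_ ?_ ?_ ?_ ?_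
  · refine ⟨rfl, le_rfl, by simp, fun b hb => Function.update_of_ne (by omega) _ _, ?_⟩
    intro m hm; omega
  · rintro i ν p' ⟨-, hi, h22, hfr, -⟩
    have e10 : ν 10 = 2 ^ k := (hfr 10 (by omega)).trans hμ.c10
    simp [ok_v hS, e10, h22]
  · have : 2 ^ k * (60 * k + 50) = 2 ^ k * (60 * k + 35 + (2 + 2 + 2)) + 2 ^ k * 9 := by ring
    simp only [cost_v]
    have := Nat.one_le_two_pow (n := k)
    omega
  · rintro i ν p' ⟨rfl, hi, h22, hfr, hval⟩
    obtain ⟨m, hm⟩ : ∃ m, 2 ^ k - (i + 1) = m := ⟨_, rfl⟩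
    have hm' : 2 ^ k - i = m + 1 := by omega
    rw [hm] at h22 hval
    rw [hm']
    refine .of_vc ?_
    simp only [vc_seq, vc_call]
    have hav : vecAt q ν (2 ^ k) a = vecAt q μ (2 ^ k) a :=
      vecAt_congr fun i hi => hfr _ (by omega)
    refine (mulEntry_spec hΓ (hμ.congr fun b h1 h2 => hfr b (by omega)) ((hfr 21 (by omega)).trans h21)
      h22 (by omega) haw (by omega) (fun i hi => by rw [hfr _ (by omega)]; exact hsmall i hi)
      (fun j hj => by rw [hfr _ (by omega)]; exact hu j hj)).wp (by omega) ?_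
    rintro ν' n' ⟨hfr', h25, hval'⟩ hn'
    rw [hav] at hval'
    have e12 : ν' 12 = U + k := by rw [hfr' 12 (by omega), hfr 12 (by omega), hμ.c12]
    have e22 : ν' 22 = m := (hfr' 22 (by omega)).trans h22
    have e22' : ¬ 22 = U + k + m := by omega
    simp [vc_set hS, ok_v hS, ok_ofNat hS, e12, e22, Function.update_of_ne e22']
    refine ⟨by omega, hΓ.cell _, by omega, by omega, by omega, by omega, fun b hb => ?_,
      fun m1 hm1 => ?_⟩
    · rw [Function.update_of_ne (by omega), Function.update_of_ne (by omega), hfr' b (by omega),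
        hfr b hb]
    · rw [Function.update_of_ne (by omega)]
      by_cases h : m1 = m
      · subst h
        rw [Function.update_self]
        exact ⟨h25, hval'⟩
      · rw [Function.update_of_ne (by omega), hfr' _ (by omega)]
        exact hval m1 (by omega)
  · rintro ν p' ⟨rfl, -, -, hfr, hval⟩
    refine ⟨⟨hfr, fun i hi => (hval i (by omega)).1, ?_⟩, rfl⟩
    ext m
    by_cases hm : m < 2 ^ k
    · rw [vecAt_of_lt hm]; exact (hval m (by omega)).2
    · rw [vecAt_of_le (by omega),
        mul_apply_eq_zero (fun m hm => vecAt_of_le hm) u le_rfl (by omega)]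

end Wedge

/-! ### Elimination with a row and insertion of a row -/

namespace Wedge

open WordRAM WordRAM.Exp

/-- Replaces the vector by its multiple with the factor in cell `28` minus the multiple of the row
at the address in cell `27` with the factor in cell `29`. -/
def elim : Cmd :=
  .seq (.set 30 0) <| .loop (v 30) (v 10) <|
    .seq (.store (v 12 + v 30)
      ((ld (v 12 + v 30) * v 28 + (v 15 - v 29) * ld (v 27 + v 30)) % v 15))
    (.set 30 (v 30 + 1))

/-- Moves the vector to the row at the address in cell `27`. -/
def moveVec : Cmd :=
  .seq (.set 30 0) <| .loop (v 30) (v 10) <|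
    .seq (.store (v 27 + v 30) (ld (v 12 + v 30))) <|
    .seq (.store (v 12 + v 30) 0) (.set 30 (v 30 + 1))

variable {k q U : ℕ} {Γ : Env}

theorem elim_spec (hΓ : Layout k q U Γ) {μ : ℕ → ℕ} (hμ : Consts k q U μ)
    {b c d : ℕ} (h27 : μ 27 = b) (h28 : μ 28 = c) (h29 : μ 29 = d) (hb : U + k + 2 ^ k ≤ b)
    (hbw : b + 2 ^ k < 2 ^ Γ.w) (hc : c < q) (hd : d < q)
    (hx : ∀ i < 2 ^ k, μ (U + k + i) < q) (hrow : ∀ i < 2 ^ k, μ (b + i) < q) :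
    HT Γ elim μ (50 * 2 ^ k + 10) fun ν =>
      (∀ a, a ≠ 30 → a < U + k ∨ U + k + 2 ^ k ≤ a → ν a = μ a) ∧
      (∀ i < 2 ^ k, ν (U + k + i) < q) ∧
      vecAt q ν (2 ^ k) (U + k) = (c : ZMod q) • vecAt q μ (2 ^ k) (U + k) -
        (d : ZMod q) • vecAt q μ (2 ^ k) b := by
  intro p
  have hS := hΓ.std
  have hq := hΓ.prime.pos
  have hbase := hΓ.base
  have hfit := hΓ.fit
  have hfitq := hΓ.fitq
  have hqq : q ≤ q * q := Nat.le_mul_of_pos_left _ hq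
  refine .of_vc ?_
  simp [elim, vc_set hS, ok_ofNat hS]
  refine WP.loop (fun i ν p' => p' = p ∧ i ≤ 2 ^ k ∧ ν 30 = 2 ^ k - i ∧
    (∀ a, a ≠ 30 → a < U + k ∨ U + k + (2 ^ k - i) ≤ a → ν a = μ a) ∧
    ∀ m < 2 ^ k - i, ν (U + k + m) < q ∧
      (ν (U + k + m) : ZMod q) = (c : ZMod q) * (μ (U + k + m) : ZMod q) - d * (μ (b + m) : ZMod q))
    (2 ^ k) 40 ?_ ?_ ?_ ?_ ?_
  · refine ⟨rfl, le_rfl, by simp, fun a ha _ => Function.update_of_ne ha _ _, fun m hm => by omega⟩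
  · rintro i ν p' ⟨-, hi, h30, hfr, -⟩
    have e10 : ν 10 = 2 ^ k := (hfr 10 (by omega) (by omega)).trans hμ.c10
    simp [ok_v hS, e10, h30]
  · simp; omega
  · rintro i ν p' ⟨rfl, hi, h30, hfr, hval⟩
    obtain ⟨m, hm⟩ : ∃ m, 2 ^ k - (i + 1) = m := ⟨_, rfl⟩
    have hm' : 2 ^ k - i = m + 1 := by omega
    rw [hm] at h30 hval hfr
    rw [hm']
    refine .of_vc ?_
    have e12 : ν 12 = U + k := (hfr 12 (by omega) (by omega)).trans hμ.c12
    have e15 : ν 15 = q := (hfr 15 (by omega) (by omega)).trans hμ.c15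
    have e27 : ν 27 = b := (hfr 27 (by omega) (by omega)).trans h27
    have e28 : ν 28 = c := (hfr 28 (by omega) (by omega)).trans h28
    have e29 : ν 29 = d := (hfr 29 (by omega) (by omega)).trans h29
    have ex : ν (U + k + m) = μ (U + k + m) := hfr _ (by omega) (by omega)
    have er : ν (b + m) = μ (b + m) := hfr _ (by omega) (by omega)
    have hxm := hx m (by omega)
    have hrm := hrow m (by omega)
    have e30 : ¬ 30 = U + k + m := by omega
    simp [vc_set hS, ok_v hS, ok_ofNat hS, e12, e15, e27, e28, e29, h30, ex, er,
      Function.update_of_ne e30]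
    have h1 := Nat.mul_le_mul hxm.le hc.le
    have h2 : (q - d) * μ (b + m) ≤ q * q := Nat.mul_le_mul (Nat.sub_le _ _) hrm.le
    and_intros
    all_goals first | omega | exact hΓ.cell _ | skip
    · intro a ha1 ha2
      rw [Function.update_of_ne ha1, Function.update_of_ne (by omega), hfr a ha1 (by omega)]
    · intro m1 hm1
      rw [Function.update_of_ne (by omega)]
      by_cases h : m1 = m
      · subst h
        rw [Function.update_self]
        exact ⟨Nat.mod_lt _ hq, by rw [natCast_mul_add_sub_mul_mod hd.le, mul_comm (c : ZMod q)]⟩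
      · rw [Function.update_of_ne (by omega)]
        exact hval m1 (by omega)
  · rintro ν p' ⟨rfl, -, -, hfr, hval⟩
    refine ⟨⟨fun a h1 h2 => hfr a h1 (by omega), fun i hi => (hval i (by omega)).1, ?_⟩, rfl⟩
    ext m
    by_cases hm : m < 2 ^ k
    · simp only [vecAt_of_lt hm, Pi.sub_apply, Pi.smul_apply, smul_eq_mul]
      exact (hval m (by omega)).2
    · simp [vecAt_of_le (not_lt.mp hm)]

/-- The vector is cleared while it is moved, so the remaining passes of the reduction meet only
zeros and change nothing. -/
theorem moveVec_spec (hΓ : Layout k q U Γ) {μ : ℕ → ℕ} (hμ : Consts k q U μ)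
    {b : ℕ} (h27 : μ 27 = b) (hb : U + k + 2 ^ k ≤ b) (hbw : b + 2 ^ k < 2 ^ Γ.w) :
    HT Γ moveVec μ (50 * 2 ^ k + 10) fun ν =>
      (∀ a, a ≠ 30 → (a < U + k ∨ U + k + 2 ^ k ≤ a) → (a < b ∨ b + 2 ^ k ≤ a) → ν a = μ a) ∧
      (∀ i < 2 ^ k, ν (U + k + i) = 0) ∧ ∀ i < 2 ^ k, ν (b + i) = μ (U + k + i) := by
  intro p
  have hS := hΓ.std
  have hbase := hΓ.base
  have hfit := hΓ.fit
  refine .of_vc ?_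
  simp [moveVec, vc_set hS, ok_ofNat hS]
  refine WP.loop (fun i ν p' => p' = p ∧ i ≤ 2 ^ k ∧ ν 30 = 2 ^ k - i ∧
    (∀ a, a ≠ 30 → (a < U + k ∨ U + k + (2 ^ k - i) ≤ a) → (a < b ∨ b + (2 ^ k - i) ≤ a) →
      ν a = μ a) ∧
    ∀ m < 2 ^ k - i, ν (U + k + m) = 0 ∧ ν (b + m) = μ (U + k + m))
    (2 ^ k) 40 ?_ ?_ ?_ ?_ ?_
  · refine ⟨rfl, le_rfl, by simp, fun a ha _ _ => Function.update_of_ne ha _ _, fun m hm => by omega⟩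
  · rintro i ν p' ⟨-, hi, h30, hfr, -⟩
    have e10 : ν 10 = 2 ^ k := (hfr 10 (by omega) (by omega) (by omega)).trans hμ.c10
    simp [ok_v hS, e10, h30]
  · simp; omega
  · rintro i ν p' ⟨rfl, hi, h30, hfr, hval⟩
    obtain ⟨m, hm⟩ : ∃ m, 2 ^ k - (i + 1) = m := ⟨_, rfl⟩
    have hm' : 2 ^ k - i = m + 1 := by omega
    rw [hm] at h30 hval hfr
    rw [hm']
    refine .of_vc ?_
    have e12 : ν 12 = U + k := (hfr 12 (by omega) (by omega) (by omega)).trans hμ.c12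
    have e27 : ν 27 = b := (hfr 27 (by omega) (by omega) (by omega)).trans h27
    have ex : ν (U + k + m) = μ (U + k + m) := hfr _ (by omega) (by omega) (by omega)
    have e30 : ¬ 30 = U + k + m := by omega
    have e30' : ¬ 30 = b + m := by omega
    have e12' : ¬ 12 = b + m := by omega
    simp [vc_set hS, ok_v hS, ok_ofNat hS, e12, e27, h30, ex,
      Function.update_of_ne e30, Function.update_of_ne e30', Function.update_of_ne e12']
    and_intros
    all_goals first | omega | exact hΓ.cell _ | skip
    · intro a ha1 ha2 ha3
      rw [Function.update_of_ne ha1, Function.update_of_ne (by omega),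
        Function.update_of_ne (by omega), hfr a ha1 (by omega) (by omega)]
    · intro m1 hm1
      rw [Function.update_of_ne (by omega), Function.update_of_ne (by omega : b + m1 ≠ 30),
        Function.update_of_ne (by omega : b + m1 ≠ U + k + m)]
      by_cases h : m1 = m
      · subst h
        rw [Function.update_self, Function.update_self]
        exact ⟨rfl, rfl⟩
      · rw [Function.update_of_ne (by omega), Function.update_of_ne (by omega),
          Function.update_of_ne (by omega)]
        exact hval m1 (by omega)
  · rintro ν p' ⟨rfl, -, -, hfr, hval⟩
    exact ⟨⟨fun a h1 h2 h3 => hfr a h1 (by omega) (by omega), fun i hi => (hval i (by omega)).1,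
      fun i hi => (hval i (by omega)).2⟩, rfl⟩

end Wedge

/-! ### Echelon form and reduction of a vector -/

namespace Wedge

open WordRAM WordRAM.Exp

/-- The start point that belongs to the row `j`, or `0` if the row is not used. -/
def start (k U : ℕ) (μ : ℕ → ℕ) (j : ℕ) : ℕ := μ (U + k + 2 ^ k + j)

/-- The row `j`. -/
def row (k q U : ℕ) (μ : ℕ → ℕ) (j : ℕ) : ℕ → ZMod q :=
  vecAt q μ (2 ^ k) (U + k + 2 * 2 ^ k + 2 ^ k * j)

/-- The vector. -/
def vec (k q U : ℕ) (μ : ℕ → ℕ) : ℕ → ZMod q := vecAt q μ (2 ^ k) (U + k)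

/-- The span of the rows with start points greater than `e`. -/
def rowSpan (k q U : ℕ) (μ : ℕ → ℕ) (e : ℕ) : Submodule (ZMod q) (ℕ → ZMod q) :=
  Submodule.span _ (row k q U μ '' {j | j < 2 ^ k ∧ e < start k U μ j})

/-- The rows in use are in echelon form. -/
structure Ech (k q U : ℕ) (μ : ℕ → ℕ) : Prop where
  small : ∀ j < 2 ^ k, ∀ i < 2 ^ k, μ (U + k + 2 * 2 ^ k + 2 ^ k * j + i) < q
  lead : ∀ j < 2 ^ k, 0 < start k U μ j → row k q U μ j j ≠ 0 ∧ ∀ i < j, row k q U μ j i = 0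

/-- The rows in use are kept, and new rows belong to the start point `s`. -/
structure Ext (k q U s : ℕ) (μ ν : ℕ → ℕ) : Prop where
  old : ∀ j < 2 ^ k, 0 < start k U μ j → start k U ν j = start k U μ j ∧
    row k q U ν j = row k q U μ j
  new : ∀ j < 2 ^ k, start k U μ j = 0 → start k U ν j = 0 ∨ start k U ν j = s

variable {k q U s : ℕ} {Γ : Env} {μ ν τ : ℕ → ℕ}

theorem Ext.refl (μ : ℕ → ℕ) : Ext k q U s μ μ := ⟨fun _ _ _ => ⟨rfl, rfl⟩, fun _ _ h => .inl h⟩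

/-- Positivity of `s` makes a row created in the first stage count as used, hence as fixed, in the
second. -/
theorem Ext.trans (hs : 0 < s) (h : Ext k q U s μ ν) (h' : Ext k q U s ν τ) : Ext k q U s μ τ := by
  refine ⟨fun j hj h0 => ?_, fun j hj h0 => ?_⟩
  · obtain ⟨h1, h2⟩ := h.old j hj h0
    obtain ⟨h3, h4⟩ := h'.old j hj (by omega)
    exact ⟨h3.trans h1, h4.trans h2⟩
  · rcases h.new j hj h0 with h1 | h1
    · exact h'.new j hj h1
    · exact .inr ((h'.old j hj (by omega)).1.trans h1)

section

variable (h : ∀ a, U + k + 2 ^ k ≤ a → ν a = μ a)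
include h

theorem start_congr : start k U ν = start k U μ := funext fun j => h _ (by omega)

theorem row_congr : row k q U ν = row k q U μ :=
  funext fun j => vecAt_congr fun i _ => h _ (by have := Nat.zero_le (2 ^ k * j); omega)

theorem Ech.congr (hμ : Ech k q U μ) : Ech k q U ν := by
  refine ⟨fun j hj i hi => ?_, fun j hj h0 => ?_⟩
  · rw [h _ (by have := Nat.zero_le (2 ^ k * j); omega)]; exact hμ.small j hj i hi
  · rw [row_congr h]; rw [start_congr h] at h0; exact hμ.lead j hj h0

theorem rowSpan_congr : rowSpan k q U ν = rowSpan k q U μ := by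
  funext e
  rw [rowSpan, row_congr h, start_congr h, rowSpan]

theorem Ext.of_congr : Ext k q U s μ ν := by
  refine ⟨fun j _ _ => ?_, fun j _ h0 => ?_⟩
  · rw [start_congr h, row_congr h]; exact ⟨rfl, rfl⟩
  · rw [start_congr h]; exact .inl h0

end

theorem natCast_eq_zero_iff_of_lt {q a : ℕ} (h : a < q) : (a : ZMod q) = 0 ↔ a = 0 := by
  rw [ZMod.natCast_eq_zero_iff]
  exact ⟨fun h' => Nat.eq_zero_of_dvd_of_lt h' h, fun h' => h' ▸ dvd_zero _⟩

/-- As `c` is invertible, `x` can be recovered modulo `W`. Scaling by the pivot `c` instead of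
dividing by it spares the program the computation of inverses. -/
theorem sup_span_smul_sub_smul {F V : Type*} [Field F] [AddCommGroup V] [Module F V]
    {W : Submodule F V} {x r : V} {c d : F} (hr : r ∈ W) (hc : c ≠ 0) :
    W ⊔ Submodule.span F {c • x - d • r} = W ⊔ Submodule.span F {x} := by
  refine le_antisymm (sup_le le_sup_left ?_) (sup_le le_sup_left ?_) <;>
    rw [Submodule.span_singleton_le_iff_mem]
  · refine sub_mem ?_ ?_
    · exact Submodule.smul_mem _ _
        (Submodule.mem_sup_right (Submodule.mem_span_singleton_self x))
    · exact Submodule.mem_sup_left (Submodule.smul_mem _ _ hr)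
  · have : x = c⁻¹ • (c • x - d • r) + c⁻¹ • d • r := by
      rw [smul_sub, inv_smul_smul₀ hc, sub_add_cancel]
    have hm : c⁻¹ • (c • x - d • r) + c⁻¹ • d • r ∈ W ⊔ Submodule.span F {c • x - d • r} :=
      add_mem (Submodule.smul_mem _ _
        (Submodule.mem_sup_right (Submodule.mem_span_singleton_self _)))
        (Submodule.mem_sup_left (Submodule.smul_mem _ _ (Submodule.smul_mem _ _ hr)))
    rwa [← this] at hm

/-- Eliminates the entry of the vector with the number in cell `26` by means of the row with this
number, or takes the vector as this row. -/
def reduceEntry : Cmd :=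
  .seq (.set 29 (ld (v 12 + v 26))) <| .ite 0 (v 29)
    (.seq (.set 27 (v 14 + v 10 * v 26)) <| .ite 0 (ld (v 13 + v 26))
      (.seq (.set 28 (ld (v 27 + v 26))) (.call elim))
      (.seq (.store (v 13 + v 26) (v 17)) (.call moveVec)))
    .skip

theorem block_le {n j j' : ℕ} (h : j < j') : n * j + n ≤ n * j' := by
  calc n * j + n = n * (j + 1) := by ring
    _ ≤ n * j' := Nat.mul_le_mul_left _ h

/-- If row `j` is in use, it vanishes before its pivot, so subtracting it clears the entry `j`
without spoiling the earlier zeros. If it is free and the entry is nonzero, the vector already has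
the shape of a row with pivot `j`. Both operations keep the span of the rows and the vector
together. -/
theorem reduceEntry_spec [Fact q.Prime] (hΓ : Layout k q U Γ) (hμ : Consts k q U μ)
    (hE : Ech k q U μ) (hx : ∀ i < 2 ^ k, μ (U + k + i) < q) {j : ℕ} (hj : j < 2 ^ k)
    (h26 : μ 26 = j) (hlow : ∀ i < j, vec k q U μ i = 0) (h17 : μ 17 = s) (hs : 0 < s) :
    HT Γ reduceEntry μ (50 * 2 ^ k + 70) fun ν =>
      (∀ a, a < 27 ∨ (30 < a ∧ a < U + k) → ν a = μ a) ∧ Ech k q U ν ∧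
      (∀ i < 2 ^ k, ν (U + k + i) < q) ∧ (∀ i < j + 1, vec k q U ν i = 0) ∧ Ext k q U s μ ν ∧
      rowSpan k q U ν 0 ⊔ Submodule.span _ {vec k q U ν} =
        rowSpan k q U μ 0 ⊔ Submodule.span _ {vec k q U μ} := by
  intro p
  have hS := hΓ.std
  have hq := hΓ.prime.pos
  have hbase := hΓ.base
  have hfit := hΓ.fit
  have hblk := block_le (n := 2 ^ k) hj
  refine .of_vc ?_
  have hvj : vec k q U μ j = μ (U + k + j) := vecAt_of_lt hj
  obtain ⟨b, hb⟩ : ∃ b, U + k + 2 * 2 ^ k + 2 ^ k * j = b := ⟨_, rfl⟩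
  have hb1 : U + k + 2 * 2 ^ k ≤ b := by omega
  have hb2 : b + 2 ^ k < 2 ^ Γ.w := by omega
  have e13 : ¬ U + k + 2 ^ k + j = 29 := by omega
  have e13' : ¬ U + k + 2 ^ k + j = 27 := by omega
  have eb : ¬ b + j = 29 := by omega
  have eb' : ¬ b + j = 27 := by omega
  have hfits : U + k + 2 * 2 ^ k + 2 ^ k * j < 2 ^ Γ.w := by omega
  have hmulfit : 2 ^ k * j < 2 ^ Γ.w := by omega
  simp [reduceEntry, vc_set hS, ok_v hS, ok_ofNat hS, hμ.c10, hμ.c12, hμ.c13, hμ.c14, h26, h17,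
    Function.update_of_ne e13, Function.update_of_ne e13', Function.update_of_ne eb,
    Function.update_of_ne eb', hb, hmulfit]
  refine ⟨⟨by omega, by omega, hΓ.cell _⟩, fun hxj => ?_, fun hxj => ?_⟩
  · refine ⟨by omega, ⟨by omega, by omega, hΓ.cell _⟩, fun hst => ?_, fun hst => ?_⟩
    · refine ⟨⟨by omega, by omega, hΓ.cell _⟩, ?_⟩
      set c := μ (b + j) with hc
      set d := μ (U + k + j) with hd
      set μ1 := Function.update (Function.update (Function.update μ 29 d) 27 b) 28 c with hμ1
      have hfr1 : ∀ a, a < 27 ∨ 29 < a → μ1 a = μ a := fun a ha => by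
        rw [hμ1, Function.update_of_ne (by omega), Function.update_of_ne (by omega),
          Function.update_of_ne (by omega)]
      have hrowj : row k q U μ j = vecAt q μ (2 ^ k) b := by rw [row, hb]
      refine (elim_spec (b := b) (c := c) (d := d) hΓ (hμ.congr fun a _ h2 => hfr1 a (by omega))
        (by simp [hμ1]) (by simp [hμ1]) (by simp [hμ1]) (by omega) hb2 ?_ (hx j hj) ?_ ?_).wp
        (by omega) ?_
      · rw [hc, ← hb]; exact hE.small j hj j hj
      · intro i hi
        rw [hfr1 _ (by omega)]; exact hx i hi
      · intro i hi
        rw [hfr1 _ (by omega), ← hb]; exact hE.small j hj i hi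
      rintro ν n' ⟨hfr, hsm, hv⟩ hn'
      have hfr' : ∀ a, U + k + 2 ^ k ≤ a → ν a = μ a := fun a ha => by
        rw [hfr a (by omega) (by omega), hfr1 a (by omega)]
      have hv' : vec k q U ν = (c : ZMod q) • vec k q U μ - (d : ZMod q) • row k q U μ j := by
        rw [vec, hv, vec, hrowj, vecAt_congr fun i hi => hfr1 (U + k + i) (by omega),
          vecAt_congr fun i hi => hfr1 (b + i) (by omega)]
      obtain ⟨hl1, hl2⟩ := hE.lead j hj hst
      have hcc : row k q U μ j j = c := by rw [hrowj, vecAt_of_lt hj]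
      refine ⟨⟨fun a ha => ?_, hE.congr hfr', hsm, fun i hi => ?_, Ext.of_congr hfr', ?_⟩, rfl⟩
      · rw [hfr a (by omega) (by omega), hfr1 a]
        omega
      · rw [hv', Pi.sub_apply, Pi.smul_apply, Pi.smul_apply]
        rcases hi.lt_or_eq with hi | rfl
        · rw [hlow i hi, hl2 i hi]; simp
        · rw [hvj, hcc, smul_eq_mul, smul_eq_mul]; ring
      · rw [rowSpan_congr hfr', hv']
        refine sup_span_smul_sub_smul (Submodule.subset_span ⟨j, ⟨hj, hst⟩, rfl⟩) ?_
        rw [← hcc]; exact hl1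
    · refine ⟨by omega, hΓ.cell _, ?_⟩
      set μ1 := Function.update (Function.update (Function.update μ 29 (μ (U + k + j))) 27 b)
        (U + k + 2 ^ k + j) s with hμ1
      have hfr1 : ∀ a, a ≠ 29 → a ≠ 27 → a ≠ U + k + 2 ^ k + j → μ1 a = μ a :=
        fun a h1 h2 h3 => by
          rw [hμ1, Function.update_of_ne h3, Function.update_of_ne h2, Function.update_of_ne h1]
      refine (moveVec_spec (b := b) hΓ
        (hμ.congr fun a _ h2 => hfr1 a (by omega) (by omega) (by omega)) ?_ (by omega) hb2).wp
        (by omega) ?_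
      · rw [hμ1, Function.update_of_ne (by omega), Function.update_self]
      rintro ν n' ⟨hfr, hv0, hvb⟩ hn'
      have hrowj : row k q U ν j = vec k q U μ := by
        rw [row, hb]
        ext i
        by_cases hi : i < 2 ^ k
        · rw [vecAt_of_lt hi, vec, vecAt_of_lt hi, hvb i hi,
            hfr1 _ (by omega) (by omega) (by omega)]
        · rw [vecAt_of_le (by omega), vec, vecAt_of_le (by omega)]
      have hvec : vec k q U ν = 0 := by
        ext i
        by_cases hi : i < 2 ^ k
        · rw [vec, vecAt_of_lt hi, hv0 i hi]; simp
        · rw [vec, vecAt_of_le (by omega)]; rfl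
      have hstj : start k U ν j = s := by
        rw [start, hfr _ (by omega) (by omega) (by omega), hμ1, Function.update_self]
      have hrow : ∀ j', j' ≠ j → ∀ i < 2 ^ k, ν (U + k + 2 * 2 ^ k + 2 ^ k * j' + i) =
          μ (U + k + 2 * 2 ^ k + 2 ^ k * j' + i) := fun j' hne i hi => by
        have : 2 ^ k * j' + 2 ^ k ≤ 2 ^ k * j ∨ 2 ^ k * j + 2 ^ k ≤ 2 ^ k * j' := by
          rcases Nat.lt_or_gt_of_ne hne with h | h
          · exact .inl (block_le h)
          · exact .inr (block_le h)
        rw [hfr _ (by omega) (by omega) (by omega), hfr1 _ (by omega) (by omega) (by omega)]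
      have hrow' : ∀ j', j' ≠ j → row k q U ν j' = row k q U μ j' := fun j' hne =>
        vecAt_congr (hrow j' hne)
      have hst' : ∀ j' < 2 ^ k, j' ≠ j → start k U ν j' = start k U μ j' := fun j' h hne => by
        rw [start, hfr _ (by omega) (by omega) (by omega), hfr1 _ (by omega) (by omega) (by omega)]
        rfl
      have hst0 : start k U μ j = 0 := hst
      refine ⟨⟨fun a ha => ?_, ⟨fun j' hj' i hi => ?_, fun j' hj' h0 => ?_⟩, fun i hi => ?_,
        fun i hi => ?_, ⟨fun j' hj' h0 => ?_, fun j' hj' h0 => ?_⟩, ?_⟩, rfl⟩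
      · rw [hfr a (by omega) (by omega) (by omega), hfr1 a (by omega) (by omega) (by omega)]
      · by_cases hne : j' = j
        · subst hne
          rw [hb, hvb i hi, hfr1 _ (by omega) (by omega) (by omega)]
          exact hx i hi
        · rw [hrow j' hne i hi]; exact hE.small j' hj' i hi
      · by_cases hne : j' = j
        · subst hne
          rw [hrowj]
          refine ⟨?_, hlow⟩
          rw [hvj, Ne, natCast_eq_zero_iff_of_lt (hx j' hj)]
          omega
        · rw [hrow' j' hne]
          rw [hst' j' hj' hne] at h0
          exact hE.lead j' hj' h0
      · rw [hv0 i hi]; exact hq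
      · rw [hvec]; rfl
      · have hne : j' ≠ j := fun h => by subst h; omega
        exact ⟨hst' j' hj' hne, hrow' j' hne⟩
      · by_cases hne : j' = j
        · subst hne; exact .inr hstj
        · rw [hst' j' hj' hne]; exact .inl h0
      · have hset : {j' | j' < 2 ^ k ∧ 0 < start k U ν j'} =
            insert j {j' | j' < 2 ^ k ∧ 0 < start k U μ j'} := by
          ext j'
          simp only [Set.mem_insert_iff, Set.mem_ofPred_eq]
          by_cases hne : j' = j
          · subst hne; simp [hj, hstj, hs]
          · constructor
            · rintro ⟨h1, h2⟩; rw [hst' j' h1 hne] at h2; exact .inr ⟨h1, h2⟩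
            · rintro (h | ⟨h1, h2⟩)
              · exact absurd h hne
              · rw [hst' j' h1 hne]; exact ⟨h1, h2⟩
        have himg : row k q U ν '' {j' | j' < 2 ^ k ∧ 0 < start k U μ j'} =
            row k q U μ '' {j' | j' < 2 ^ k ∧ 0 < start k U μ j'} := by
          refine Set.image_congr fun j' hj' => hrow' j' fun h => ?_
          subst h
          have := hj'.2
          omega
        rw [hvec, Submodule.span_zero_singleton, sup_bot_eq, rowSpan, hset, Set.image_insert_eq,
          himg, hrowj, Submodule.span_insert, sup_comm]
        rfl
  · have hfr1 : ∀ a, a ≠ 29 → Function.update μ 29 (μ (U + k + j)) a = μ a := fun a h =>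
      Function.update_of_ne h _ _
    have hvec : vec k q U (Function.update μ 29 (μ (U + k + j))) = vec k q U μ :=
      vecAt_congr fun i hi => hfr1 _ (by omega)
    rw [← hxj]
    refine ⟨fun a ha => hfr1 a (by omega), hE.congr fun a ha => hfr1 a (by omega), fun i hi => ?_,
      fun i hi => ?_, Ext.of_congr fun a ha => hfr1 a (by omega), ?_⟩
    · rw [hfr1 _ (by omega)]; exact hx i hi
    · rw [hvec]
      rcases hi.lt_or_eq with hi | rfl
      · exact hlow i hi
      · rw [hvj, hxj]; simp
    · rw [hvec, rowSpan_congr fun a ha => hfr1 a (by omega)]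

/-- Reduces the vector and adds it to the rows. -/
def reduce : Cmd :=
  .seq (.set 26 0) <| .loop (v 26) (v 10) <| .seq (.call reduceEntry) (.set 26 (v 26 + 1))

/-- After all entries have been treated the vector is zero, so the rows alone span what they spanned
together with the vector at the outset. -/
theorem reduce_spec [Fact q.Prime] (hΓ : Layout k q U Γ) (hμ : Consts k q U μ)
    (hE : Ech k q U μ) (hx : ∀ i < 2 ^ k, μ (U + k + i) < q) (h17 : μ 17 = s) (hs : 0 < s) :
    HT Γ reduce μ (2 ^ k * (50 * 2 ^ k + 90) + 10) fun ν =>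
      (∀ a, a < 26 ∨ (30 < a ∧ a < U + k) → ν a = μ a) ∧ Ech k q U ν ∧ Ext k q U s μ ν ∧
      rowSpan k q U ν 0 = rowSpan k q U μ 0 ⊔ Submodule.span _ {vec k q U μ} := by
  intro p
  have hS := hΓ.std
  have hbase := hΓ.base
  have hfit := hΓ.fit
  refine .of_vc ?_
  simp [reduce, vc_set hS, ok_ofNat hS]
  refine WP.loop (fun i ν p' => p' = p ∧ i ≤ 2 ^ k ∧ ν 26 = 2 ^ k - i ∧
    (∀ a, a < 26 ∨ (30 < a ∧ a < U + k) → ν a = μ a) ∧ Ech k q U ν ∧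
      (∀ i < 2 ^ k, ν (U + k + i) < q) ∧ (∀ m < 2 ^ k - i, vec k q U ν m = 0) ∧ Ext k q U s μ ν ∧
      rowSpan k q U ν 0 ⊔ Submodule.span _ {vec k q U ν} =
        rowSpan k q U μ 0 ⊔ Submodule.span _ {vec k q U μ})
    (2 ^ k) (50 * 2 ^ k + 80) ?_ ?_ ?_ ?_ ?_
  · have hfr1 : ∀ a, a ≠ 26 → Function.update μ 26 0 a = μ a := fun a h =>
      Function.update_of_ne h _ _
    have hvec : vec k q U (Function.update μ 26 0) = vec k q U μ :=
      vecAt_congr fun i hi => hfr1 _ (by omega)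
    refine ⟨rfl, le_rfl, by simp, fun a ha => hfr1 a (by omega),
      hE.congr fun a ha => hfr1 a (by omega), fun i hi => ?_, fun m hm => by omega,
      Ext.of_congr fun a ha => hfr1 a (by omega), ?_⟩
    · rw [hfr1 _ (by omega)]; exact hx i hi
    · rw [hvec, rowSpan_congr fun a ha => hfr1 a (by omega)]
  · rintro i ν p' ⟨-, hi, h26, hfr, -⟩
    have e10 : ν 10 = 2 ^ k := (hfr 10 (by omega)).trans hμ.c10
    simp [ok_v hS, e10, h26]
  · simp only [cost_v, Nat.reduceAdd]
    have : 2 ^ k * (50 * 2 ^ k + 90) = 2 ^ k * (50 * 2 ^ k + 80 + 6) + 4 * 2 ^ k := by ring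
    have := Nat.one_le_two_pow (n := k)
    omega
  · rintro i ν p' ⟨rfl, hi, h26, hfr, hE', hx', hlow, hext, hspan⟩
    obtain ⟨m, hm⟩ : ∃ m, 2 ^ k - (i + 1) = m := ⟨_, rfl⟩
    have hm' : 2 ^ k - i = m + 1 := by omega
    rw [hm] at h26 hlow
    rw [hm']
    refine .of_vc ?_
    simp only [vc_seq, vc_call]
    refine (reduceEntry_spec hΓ (hμ.congr fun a _ h => hfr a (by omega)) hE' hx' (by omega) h26 hlow
      ((hfr 17 (by omega)).trans h17) hs).wp (by omega) ?_
    rintro ν' n' ⟨hfr', hE'', hx'', hlow', hext', hspan'⟩ hn'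
    have e26 : ν' 26 = m := (hfr' 26 (by omega)).trans h26
    simp [vc_set hS, ok_v hS, ok_ofNat hS, e26]
    have hfr1 : ∀ a, a ≠ 26 → Function.update ν' 26 (m + 1) a = ν' a := fun a h =>
      Function.update_of_ne h _ _
    have hvec : vec k q U (Function.update ν' 26 (m + 1)) = vec k q U ν' :=
      vecAt_congr fun i hi => hfr1 _ (by omega)
    refine ⟨by omega, by omega, by omega, fun a ha => ?_,
      hE''.congr fun a ha => hfr1 a (by omega), fun i hi => ?_, ?_,
      (hext.trans hs hext').trans hs (Ext.of_congr fun a ha => hfr1 a (by omega)), ?_⟩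
    · rw [hfr1 a (by omega), hfr' a (by omega), hfr a ha]
    · rw [hfr1 _ (by omega)]; exact hx'' i hi
    · rw [hvec]; exact fun i hi => hlow' i (by omega)
    · rw [hvec, rowSpan_congr fun a ha => hfr1 a (by omega), hspan', hspan]
  · rintro ν p' ⟨rfl, -, -, hfr, hE', hx', hlow, hext, hspan⟩
    refine ⟨⟨hfr, hE', hext, ?_⟩, rfl⟩
    have hvec : vec k q U ν = 0 := by
      ext i
      by_cases hi : i < 2 ^ k
      · exact hlow i hi
      · rw [vec, vecAt_of_le (by omega)]; rfl
    rwa [hvec, Submodule.span_zero_singleton, sup_bot_eq] at hspan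

end Wedge

/-! ### Multiplication of the rows by the vector of an interval -/

namespace Wedge

open WordRAM WordRAM.Exp

/-- Adds the product with the row whose number is in cell `20` to the rows, provided that its start
point is greater than the number in cell `18`. -/
def addProduct : Cmd :=
  .ite (v 18) (ld (v 13 + v 20)) (.seq (.set 21 (v 14 + v 10 * v 20)) <| .seq (.call mulVec)
    (.call reduce)) .skip

/-- Adds the products with all rows whose start points are greater than the number in cell `18`. -/
def addProducts : Cmd :=
  .seq (.set 20 0) <| .loop (v 20) (v 10) <| .seq (.call addProduct) (.set 20 (v 20 + 1))

variable {k q U s : ℕ} {Γ : Env} {μ ν : ℕ → ℕ}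

theorem addProduct_spec [Fact q.Prime] (hΓ : Layout k q U Γ) (hμ : Consts k q U μ)
    (hE : Ech k q U μ) (h17 : μ 17 = s) (hs : 0 < s) {e r : ℕ} (h18 : μ 18 = e) (h20 : μ 20 = r)
    (hr : r < 2 ^ k) {u : ℕ → ZMod q} (hu : ∀ j < k, μ (U + j) < q ∧ (μ (U + j) : ZMod q) = u j) :
    HT Γ addProduct μ (2 ^ k * (60 * k + 50) + 2 ^ k * (50 * 2 ^ k + 90) + 50) fun ν =>
      (∀ a, a < 21 ∨ (30 < a ∧ a < U + k) → ν a = μ a) ∧ Ech k q U ν ∧ Ext k q U s μ ν ∧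
      rowSpan k q U ν 0 = rowSpan k q U μ 0 ⊔
        Submodule.span _ {x | e < start k U μ r ∧ x = mul k u (row k q U μ r)} := by
  intro p
  have hS := hΓ.std
  have hbase := hΓ.base
  have hfit := hΓ.fit
  have hblk := block_le (n := 2 ^ k) hr
  have hst : μ (U + k + 2 ^ k + r) = start k U μ r := rfl
  have hfits : U + k + 2 * 2 ^ k + 2 ^ k * r < 2 ^ Γ.w := by omega
  have hmulfit : 2 ^ k * r < 2 ^ Γ.w := by omega
  refine .of_vc ?_
  simp [addProduct, vc_set hS, ok_v hS, hμ.c10, hμ.c13, hμ.c14, h18, h20, hst, hmulfit,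
    hfits]
  refine ⟨⟨by omega, by omega, hΓ.cell _⟩, fun hlt => ?_, fun hle => ?_⟩
  · set a := U + k + 2 * 2 ^ k + 2 ^ k * r with ha
    have hfr1 : ∀ b, b ≠ 21 → Function.update μ 21 a b = μ b := fun b h =>
      Function.update_of_ne h _ _
    have hμ1 : Consts k q U (Function.update μ 21 a) := hμ.congr fun b _ _ => hfr1 b (by omega)
    refine (mulVec_spec (u := u) hΓ hμ1 (Function.update_self ..) (by omega) (by omega) (fun i hi => ?_)
      (fun j hj => ?_)).wp (by omega) ?_
    · rw [hfr1 _ (by omega)]; exact hE.small r hr i hi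
    · rw [hfr1 _ (by omega)]; exact hu j hj
    rintro ν n ⟨hfr, hsm, hv⟩ hn
    have hfr' : ∀ b, U + k + 2 ^ k ≤ b → ν b = μ b := fun b hb => by
      rw [hfr b (by omega), hfr1 b (by omega)]
    have hvec : vec k q U ν = mul k u (row k q U μ r) := by
      rw [vec, hv, vecAt_congr fun i hi => hfr1 (a + i) (by omega)]
      rfl
    refine (reduce_spec hΓ (hμ1.congr fun b _ h => hfr b (by omega)) (hE.congr hfr') hsm
      (s := s) ?_ hs).wp (by omega) ?_
    · rw [hfr 17 (by omega), hfr1 17 (by omega), h17]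
    rintro ν' n' ⟨hfr2, hE', hext, hspan⟩ hn'
    refine ⟨⟨fun b hb => ?_, hE', (Ext.of_congr hfr').trans hs hext, ?_⟩, rfl⟩
    · rw [hfr2 b (by omega), hfr b (by omega), hfr1 b (by omega)]
    · rw [hspan, rowSpan_congr hfr', hvec]
      simp [hlt]
  · refine ⟨hE, Ext.refl _, ?_⟩
    have : {x : ℕ → ZMod q | e < start k U μ r ∧ x = mul k u (row k q U μ r)} = ∅ := by
      ext x
      simp [hle]
    simp [this]

/-- Rows are inserted into the very family that the loop scans. This is harmless: new rows are
tagged `s ≤ e` and fail the test for a tag above `e`, so only original rows are multiplied. -/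
theorem addProducts_spec [Fact q.Prime] (hΓ : Layout k q U Γ) (hμ : Consts k q U μ)
    (hE : Ech k q U μ) (h17 : μ 17 = s) (hs : 0 < s) {e : ℕ} (h18 : μ 18 = e) (hse : s ≤ e)
    {u : ℕ → ZMod q} (hu : ∀ j < k, μ (U + j) < q ∧ (μ (U + j) : ZMod q) = u j) :
    HT Γ addProducts μ
      (2 ^ k * (2 ^ k * (60 * k + 50) + 2 ^ k * (50 * 2 ^ k + 90) + 70) + 10) fun ν =>
      (∀ a, a < 20 ∨ (30 < a ∧ a < U + k) → ν a = μ a) ∧ Ech k q U ν ∧ Ext k q U s μ ν ∧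
      rowSpan k q U ν 0 = rowSpan k q U μ 0 ⊔ (rowSpan k q U μ e).map (mul k u) := by
  intro p
  have hS := hΓ.std
  have hbase := hΓ.base
  have hN := Nat.two_pow_pos k
  obtain ⟨B, hB⟩ : ∃ B, 2 ^ k * (60 * k + 50) + 2 ^ k * (50 * 2 ^ k + 90) = B := ⟨_, rfl⟩
  rw [hB]
  refine .of_vc ?_
  simp [addProducts, vc_set hS, ok_ofNat hS]
  refine WP.loop (fun i ν p' => p' = p ∧ i ≤ 2 ^ k ∧ ν 20 = 2 ^ k - i ∧
    (∀ a, a < 20 ∨ (30 < a ∧ a < U + k) → ν a = μ a) ∧ Ech k q U ν ∧ Ext k q U s μ ν ∧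
      rowSpan k q U ν 0 = rowSpan k q U μ 0 ⊔ Submodule.span _
        {x | ∃ j < 2 ^ k - i, e < start k U μ j ∧ x = mul k u (row k q U μ j)})
    (2 ^ k) (B + 60) ?_ ?_ ?_ ?_ ?_
  · have hfr1 : ∀ a, a ≠ 20 → Function.update μ 20 0 a = μ a := fun a h =>
      Function.update_of_ne h _ _
    refine ⟨rfl, le_rfl, by simp, fun a ha => hfr1 a (by omega),
      hE.congr fun a ha => hfr1 a (by omega), Ext.of_congr fun a ha => hfr1 a (by omega), ?_⟩
    rw [rowSpan_congr fun a ha => hfr1 a (by omega)]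
    simp
  · rintro i ν p' ⟨-, hi, h20, hfr, -⟩
    have e10 : ν 10 = 2 ^ k := (hfr 10 (by omega)).trans hμ.c10
    simp [ok_v hS, e10, h20]
  · simp only [cost_v, Nat.reduceAdd]
    have : 2 ^ k * (B + 70) = 2 ^ k * (B + 60 + 6) + 4 * 2 ^ k := by ring
    have := Nat.one_le_two_pow (n := k)
    omega
  · rintro i ν p' ⟨rfl, hi, h20, hfr, hE', hext, hspan⟩
    obtain ⟨r, hr⟩ : ∃ r, 2 ^ k - (i + 1) = r := ⟨_, rfl⟩
    have hr' : 2 ^ k - i = r + 1 := by omega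
    rw [hr] at h20 hspan
    rw [hr']
    have hfit := hΓ.fit
    refine .of_vc ?_
    simp only [vc_seq, vc_call]
    refine (addProduct_spec hΓ (hμ.congr fun a _ h => hfr a (by omega)) hE'
      ((hfr 17 (by omega)).trans h17) hs ((hfr 18 (by omega)).trans h18) h20 (by omega)
      (u := u) (fun j hj => by rw [hfr _ (by omega)]; exact hu j hj)).wp (by omega) ?_
    rintro ν' n' ⟨hfr', hE'', hext', hspan'⟩ hn'
    have e20 : ν' 20 = r := (hfr' 20 (by omega)).trans h20
    simp [vc_set hS, ok_v hS, ok_ofNat hS, e20]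
    have hfr1 : ∀ a, a ≠ 20 → Function.update ν' 20 (r + 1) a = ν' a := fun a h =>
      Function.update_of_ne h _ _
    have hsq := Nat.zero_le (2 ^ k * 2 ^ k)
    refine ⟨by omega, by omega, by omega, fun a ha => ?_,
      hE''.congr fun a ha => hfr1 a (by omega),
      (hext.trans hs hext').trans hs (Ext.of_congr fun a ha => hfr1 a (by omega)), ?_⟩
    · rw [hfr1 a (by omega), hfr' a (by omega), hfr a ha]
    · rw [rowSpan_congr fun a ha => hfr1 a (by omega), hspan', hspan, sup_assoc,
        ← Submodule.span_union]
      congr 2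
      -- A row that was free at the outset has tag 0 or `s` by now, neither above `e`; a row in use
      -- at the outset is unchanged.
      have hiff : ∀ x, (e < start k U ν r ∧ x = mul k u (row k q U ν r)) ↔
          (e < start k U μ r ∧ x = mul k u (row k q U μ r)) := fun x => by
        rcases Nat.eq_zero_or_pos (start k U μ r) with h0 | h0
        · have := hext.new r (by omega) h0
          constructor <;> intro h <;> have := h.1 <;> omega
        · rw [(hext.old r (by omega) h0).1, (hext.old r (by omega) h0).2]
      ext x
      simp only [Set.mem_union, Set.mem_ofPred_eq, hiff]
      constructor
      · rintro (⟨j, hj, h⟩ | h)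
        · exact ⟨j, by omega, h⟩
        · exact ⟨r, by omega, h⟩
      · rintro ⟨j, hj, h⟩
        rcases Nat.lt_or_eq_of_le (show j ≤ r by omega) with hj | rfl
        · exact .inl ⟨j, hj, h⟩
        · exact .inr h
  · rintro ν p' ⟨rfl, -, -, hfr, hE', hext, hspan⟩
    refine ⟨⟨hfr, hE', hext, ?_⟩, rfl⟩
    rw [hspan, rowSpan, rowSpan, Submodule.map_span]
    congr 2
    ext x
    simp only [Nat.sub_zero, Set.mem_ofPred_eq, Set.mem_image]
    constructor
    · rintro ⟨j, h1, h2, rfl⟩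
      exact ⟨_, ⟨j, ⟨h1, h2⟩, rfl⟩, rfl⟩
    · rintro ⟨_, ⟨j, ⟨h1, h2⟩, rfl⟩, rfl⟩
      exact ⟨j, h1, h2, rfl⟩

/-- New rows are tagged `s ≤ e` and do not count above `e`. -/
theorem Ext.rowSpan_of_le (h : Ext k q U s μ ν) {e : ℕ} (he : s ≤ e) :
    rowSpan k q U ν e = rowSpan k q U μ e := by
  have hset : ∀ j < 2 ^ k, (e < start k U ν j ↔ e < start k U μ j) := fun j hj => by
    rcases Nat.eq_zero_or_pos (start k U μ j) with h0 | h0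
    · have := h.new j hj h0; omega
    · rw [(h.old j hj h0).1]
  rw [rowSpan, rowSpan]
  congr 1
  ext x
  constructor
  · rintro ⟨j, ⟨h1, h2⟩, rfl⟩
    have h3 := (hset j h1).mp h2
    exact ⟨j, ⟨h1, h3⟩, ((h.old j h1 (by omega)).2).symm⟩
  · rintro ⟨j, ⟨h1, h2⟩, rfl⟩
    exact ⟨j, ⟨h1, (hset j h1).mpr h2⟩, (h.old j h1 (by omega)).2⟩

/-- If no tag in use is smaller than the current start point `s`, all rows count for each `e < s`.
Together with `Ext.rowSpan_of_le` this lets one echelon basis serve all thresholds. -/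
theorem rowSpan_eq_of_lt (h : ∀ j < 2 ^ k, start k U μ j = 0 ∨ s ≤ start k U μ j) {e : ℕ}
    (he : e < s) : rowSpan k q U μ e = rowSpan k q U μ 0 := by
  rw [rowSpan, rowSpan]
  congr 2
  ext j
  simp only [Set.mem_ofPred_eq]
  constructor
  · rintro ⟨h1, h2⟩; exact ⟨h1, by omega⟩
  · rintro ⟨h1, h2⟩
    have := h j h1
    exact ⟨h1, by omega⟩

end Wedge

/-! ### Spans of the products of chains -/

namespace JobIntervalSelection

variable {I : JobIntervalSelection} {F : Type*} [Field F] (g : Fin I.n → F)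

variable (I) in
/-- The span of the exterior products that belong to the chains of intervals with numbers at least
`v` that start after `e`. -/
def chainSpan (v e : ℕ) : Submodule F (ℕ → F) :=
  Submodule.span F {x | ∃ l, I.Chain l ∧ (∀ u ∈ l, v ≤ (u : ℕ) ∧ e < I.rep.first u) ∧
    Wedge.prod I.k ((l.map g).map Wedge.powers) = x}

theorem chainSpan_mono {v v' e e' : ℕ} (hv : v ≤ v') (he : e ≤ e') :
    I.chainSpan g v' e' ≤ I.chainSpan g v e :=
  Submodule.span_mono fun _ ⟨l, h1, h2, h3⟩ =>
    ⟨l, h1, fun u hu => ⟨hv.trans (h2 u hu).1, he.trans_lt (h2 u hu).2⟩, h3⟩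

theorem chainSpan_of_le (v : Fin I.n) {e : ℕ} (he : I.rep.first v ≤ e) :
    I.chainSpan g v e = I.chainSpan g (v + 1) e := by
  refine le_antisymm (Submodule.span_mono ?_) (chainSpan_mono g (by omega) le_rfl)
  rintro x ⟨l, h1, h2, h3⟩
  refine ⟨l, h1, fun u hu => ⟨?_, (h2 u hu).2⟩, h3⟩
  have h4 := h2 u hu
  by_contra h
  obtain rfl : u = v := Fin.ext (by omega)
  omega

/-- The linear version of `reach_step`: chains that avoid `v` give the first summand, and chains
that begin with `v` give the products of its vector with the chains after its end. Distinctness of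
colors is not demanded here; the alternating product enforces it. -/
theorem chainSpan_of_lt (v : Fin I.n) {e : ℕ} (he : e < I.rep.first v) :
    I.chainSpan g v e = I.chainSpan g (v + 1) e ⊔
      (I.chainSpan g (v + 1) (I.rep.last v)).map (Wedge.mul I.k (Wedge.powers (g v))) := by
  refine le_antisymm ?_ (sup_le (chainSpan_mono g (by omega) le_rfl) ?_)
  · refine Submodule.span_le.mpr ?_
    rintro x ⟨l, h1, h2, rfl⟩
    rcases chain_cases h1 (fun u hu => (h2 u hu).1) with h | ⟨l, rfl, h5, h6⟩
    · exact Submodule.mem_sup_left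
        (Submodule.subset_span ⟨l, h1, fun u hu => ⟨h u hu, (h2 u hu).2⟩, rfl⟩)
    · exact Submodule.mem_sup_right
        (Submodule.mem_map_of_mem (Submodule.subset_span ⟨l, h5, h6, rfl⟩))
  · rw [chainSpan, Submodule.map_span]
    refine Submodule.span_mono ?_
    rintro _ ⟨_, ⟨l, h1, h2, rfl⟩, rfl⟩
    refine ⟨v :: l, chain_cons.mpr ⟨fun u hu => (h2 u hu).2, h1⟩, fun u hu => ?_, rfl⟩
    rcases List.mem_cons.mp hu with rfl | hu
    · exact ⟨le_rfl, he⟩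
    · have a1 := h2 u hu
      have a2 := I.rep.first_le_last v
      exact ⟨by omega, by omega⟩

theorem chainSpan_top (e : ℕ) : I.chainSpan g I.n e = Submodule.span F {Pi.single 0 1} := by
  rw [chainSpan]
  congr 1
  ext x
  constructor
  · rintro ⟨l, -, h2, rfl⟩
    cases l with
    | nil => rfl
    | cons u l => have := (h2 u (by simp)).1; have := u.2; omega
  · rintro rfl
    exact ⟨[], List.Pairwise.nil, by simp, rfl⟩

end JobIntervalSelection

/-! ### The vector of powers of a color number -/

namespace Wedge

open WordRAM WordRAM.Exp

/-- Computes the powers of the number in cell `19`. -/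
def powersLoop : Cmd :=
  .seq (.set 23 0) <| .seq (.set 24 1) <| .loop (v 23) (v 9) <|
    .seq (.store (v 11 + v 23) (v 24)) <| .seq (.set 24 (v 24 * v 19 % v 15)) (.set 23 (v 23 + 1))

variable {k q U s : ℕ} {Γ : Env} {μ ν : ℕ → ℕ}

theorem powersLoop_spec [Fact q.Prime] (hΓ : Layout k q U Γ) (hμ : Consts k q U μ) {c : ℕ} (h19 : μ 19 = c)
    (hc : c < q) :
    HT Γ powersLoop μ (40 * k + 15) fun ν =>
      (∀ a, (a < 23 ∨ 24 < a) → (a < U ∨ U + k ≤ a) → ν a = μ a) ∧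
      ∀ j < k, ν (U + j) < q ∧ (ν (U + j) : ZMod q) = powers (c : ZMod q) j := by
  intro p
  have hS := hΓ.std
  have hq := hΓ.prime.one_lt
  have hbase := hΓ.base
  have hfit := hΓ.fit
  have hfitq := hΓ.fitq
  refine .of_vc ?_
  simp [powersLoop, vc_set hS, ok_ofNat hS]
  refine WP.loop (fun i ν p' => p' = p ∧ i ≤ k ∧ ν 23 = k - i ∧ ν 24 < q ∧
    (ν 24 : ZMod q) = c ^ (k - i) ∧
    (∀ a, (a < 23 ∨ 24 < a) → (a < U ∨ U + k ≤ a) → ν a = μ a) ∧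
      ∀ j < k - i, ν (U + j) < q ∧ (ν (U + j) : ZMod q) = powers (c : ZMod q) j)
    k 34 ?_ ?_ ?_ ?_ ?_
  · refine ⟨rfl, le_rfl, by simp, by simpa using hq, by simp, fun a ha _ => ?_, fun j hj => by omega⟩
    rw [Function.update_of_ne (by omega), Function.update_of_ne (by omega)]
  · rintro i ν p' ⟨-, hi, h23, -, -, hfr, -⟩
    have e9 : ν 9 = k := (hfr 9 (by omega) (by omega)).trans hμ.c9
    simp [ok_v hS, e9, h23]
    omega
  · simp; omega
  · rintro i ν p' ⟨rfl, hi, h23, h24, hval, hfr, hpow⟩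
    obtain ⟨j, hj⟩ : ∃ j, k - (i + 1) = j := ⟨_, rfl⟩
    have hj' : k - i = j + 1 := by omega
    rw [hj] at h23 hval hpow
    rw [hj']
    have e11 : ν 11 = U := (hfr 11 (by omega) (by omega)).trans hμ.c11
    have e15 : ν 15 = q := (hfr 15 (by omega) (by omega)).trans hμ.c15
    have e19 : ν 19 = c := (hfr 19 (by omega) (by omega)).trans h19
    have n15 : ¬ 15 = U + j := by omega
    have n19 : ¬ 19 = U + j := by omega
    have n23 : ¬ 23 = U + j := by omega
    have n24 : ¬ 24 = U + j := by omega
    have hmul := Nat.mul_le_mul h24.le hc.le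
    refine .of_vc ?_
    simp [vc_set hS, ok_v hS, ok_ofNat hS, e11, h23, Function.update_of_ne n15,
      Function.update_of_ne n19, Function.update_of_ne n23, Function.update_of_ne n24, e15, e19]
    have hmod := Nat.mod_lt (ν 24 * c) (by omega : q > 0)
    and_intros
    all_goals first | omega | exact hΓ.cell _ | skip
    · rw [hval, pow_succ]
    · intro a h1 h2
      rw [Function.update_of_ne (by omega), Function.update_of_ne (by omega),
        Function.update_of_ne (by omega), hfr a h1 h2]
    · intro j1 hj1
      rw [Function.update_of_ne (by omega), Function.update_of_ne (by omega)]
      by_cases h : j1 = j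
      · subst h
        rw [Function.update_self]
        exact ⟨h24, hval⟩
      · rw [Function.update_of_ne (by omega)]
        exact hpow j1 (by omega)
  · rintro ν p' ⟨rfl, -, -, -, -, hfr, hpow⟩
    exact ⟨⟨hfr, by simpa using hpow⟩, rfl⟩

end Wedge

/-! ### The echelon basis of the chain products -/

namespace JobIntervalSelection

open WordRAM WordRAM.Exp Wedge

variable {I : JobIntervalSelection}

/-- The environment of the deterministic algorithm admits all cells, and its numbers fit into a
word. -/
structure DetEnv (I : JobIntervalSelection) (Γ : Env) : Prop where
  std : Γ.Std
  input : Γ.x = I.encode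
  cell : ∀ a, Γ.A a
  yes : Γ.Y ↔ I.IsYes
  fit1 : 3 * I.n + 16 ≤ 2 ^ Γ.w
  fit2 : 65 + I.γ + I.k + 2 * 2 ^ I.k + 2 ^ I.k * 2 ^ I.k < 2 ^ Γ.w
  fit3 : 8 * ((I.γ + 1) * (I.γ + 1)) < 2 ^ Γ.w

theorem DetEnv.getD {Γ : Env} (hΓ : I.DetEnv Γ) (u : Fin I.n) (j : ℕ) (hj : j < 3) :
    Γ.x[3 + j + 3 * (u : ℕ)]?.getD 0 = (I.triple u).getD j 0 := by
  have : 3 + j + 3 * (u : ℕ) = 3 + (3 * u + j) := by omega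
  rw [hΓ.input, this, ← I.getD_encode u j hj]
  simp

/-- Adds to the rows the products that belong to the next interval. -/
def addInterval : Cmd :=
  .seq (.set 16 (v 16 - 1)) <| .seq (.set 17 (inp (3 + 3 * v 16))) <|
    .seq (.set 18 (inp (4 + 3 * v 16))) <| .seq (.set 19 (ld (64 + inp (5 + 3 * v 16)))) <|
    .seq (.call powersLoop) (.call addProducts)

/-- The cost of the treatment of an interval. -/
def intervalCost (k : ℕ) : ℕ :=
  2 ^ k * (2 ^ k * (60 * k + 50) + 2 ^ k * (50 * 2 ^ k + 90) + 70) + 40 * k + 100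

theorem addInterval_spec {Γ : Env} (hΓ : I.DetEnv Γ) {q : ℕ} [Fact q.Prime]
    (hL : Layout I.k q (65 + I.γ) Γ) {μ : ℕ → ℕ} (hμ : Consts I.k q (65 + I.γ) μ)
    (hE : Ech I.k q (65 + I.γ) μ) (u : Fin I.n) (h16 : μ 16 = u + 1)
    (hid : μ (64 + (I.col u + 1)) < q) :
    HT Γ addInterval μ (intervalCost I.k) fun ν =>
      (∀ a, a < 16 ∨ (30 < a ∧ a < 65 + I.γ) → ν a = μ a) ∧ ν 16 = u ∧
      Ech I.k q (65 + I.γ) ν ∧ Ext I.k q (65 + I.γ) (I.rep.first u) μ ν ∧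
      rowSpan I.k q (65 + I.γ) ν 0 = rowSpan I.k q (65 + I.γ) μ 0 ⊔
        (rowSpan I.k q (65 + I.γ) μ (I.rep.last u)).map
          (mul I.k (powers (μ (64 + (I.col u + 1)) : ZMod q))) := by
  intro p
  have hS := hΓ.std
  have hu := u.2
  have x3 : Γ.x[3 + 3 * (u : ℕ)]?.getD 0 = I.rep.first u := hΓ.getD u 0 (by omega)
  have x4 : Γ.x[4 + 3 * (u : ℕ)]?.getD 0 = I.rep.last u := hΓ.getD u 1 (by omega)
  have x5 : Γ.x[5 + 3 * (u : ℕ)]?.getD 0 = I.col u + 1 := hΓ.getD u 2 (by omega)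
  have hf := I.first_le_n u
  have hf1 := I.rep.one_le_first u
  have hl := I.last_le_n u
  have hc := (I.col u).2
  have h1 := hΓ.fit1
  have h2 := hΓ.fit2
  have hN := Nat.two_pow_pos I.k
  have hN2 := Nat.zero_le (2 ^ I.k * 2 ^ I.k)
  refine .of_vc ?_
  obtain ⟨d, hd⟩ : ∃ d, μ (64 + ((I.col u : ℕ) + 1)) = d := ⟨_, rfl⟩
  rw [hd] at hid ⊢
  have n16 : ¬ 64 + ((I.col u : ℕ) + 1) = 16 := by omega
  have n17 : ¬ 64 + ((I.col u : ℕ) + 1) = 17 := by omega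
  have n18 : ¬ 64 + ((I.col u : ℕ) + 1) = 18 := by omega
  simp only [intervalCost]
  obtain ⟨B, hB⟩ : ∃ B, 2 ^ I.k * (2 ^ I.k * (60 * I.k + 50) + 2 ^ I.k * (50 * 2 ^ I.k + 90) + 70) = B :=
    ⟨_, rfl⟩
  rw [hB]
  simp [addInterval, vc_set hS, ok_v hS, ok_ofNat hS, h16, x3, x4, x5,
    Function.update_of_ne n16, Function.update_of_ne n17, Function.update_of_ne n18, hd]
  and_intros
  all_goals first | omega | exact hΓ.cell _ | skip
  set μ1 := Function.update (Function.update (Function.update (Function.update μ 16 u) 17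
    (I.rep.first u)) 18 (I.rep.last u)) 19 d with hμ1
  have hfr1 : ∀ a, a < 16 ∨ 19 < a → μ1 a = μ a := fun a ha => by
    rw [hμ1, Function.update_of_ne (by omega), Function.update_of_ne (by omega),
      Function.update_of_ne (by omega), Function.update_of_ne (by omega)]
  have hc1 : Consts I.k q (65 + I.γ) μ1 := hμ.congr fun a _ _ => hfr1 a (by omega)
  refine (powersLoop_spec hL hc1 (c := d) (by simp [hμ1]) hid).wp (by omega) ?_
  rintro ν n ⟨hfr, hpow⟩ hn
  have hfr' : ∀ a, 65 + I.γ + I.k + 2 ^ I.k ≤ a → ν a = μ a := fun a ha => by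
    rw [hfr a (by omega) (by omega), hfr1 a (by omega)]
  refine (addProducts_spec hL (hc1.congr fun a _ h => hfr a (by omega) (by omega)) (hE.congr hfr')
    (s := I.rep.first u) ?_ hf1 (e := I.rep.last u) ?_ (I.rep.first_le_last u) hpow).wp ?_ ?_
  · rw [hfr 17 (by omega) (by omega)]; simp [hμ1]
  · rw [hfr 18 (by omega) (by omega)]; simp [hμ1]
  · rw [hB]; omega
  rintro ν' n' ⟨hfr2, hE', hext, hspan⟩ hn'
  refine ⟨⟨fun a ha => ?_, ?_, hE', (Ext.of_congr hfr').trans hf1 hext, ?_⟩, rfl⟩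
  · rw [hfr2 a (by omega), hfr a (by omega) (by omega), hfr1 a (by omega)]
  · rw [hfr2 16 (by omega), hfr 16 (by omega) (by omega)]; simp [hμ1]
  · rw [hspan, rowSpan_congr hfr']

/-- Adds to the rows the products that belong to all intervals, from the last to the first. -/
def addIntervals : Cmd := .loop 0 (v 16) addInterval

/-- The invariant is that, for every `e ≤ n`, the rows tagged above `e` span `chainSpan g i e`. For
`e` below the current start point all rows count and `chainSpan_of_lt` applies; for larger `e`
neither side changes. The start is the empty product in row 0, whose tag `n + 1` exceeds every `e`
in question. -/
theorem addIntervals_spec {Γ : Env} (hΓ : I.DetEnv Γ) {q : ℕ} [Fact q.Prime]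
    (hL : Layout I.k q (65 + I.γ) Γ) {μ : ℕ → ℕ} (hμ : Consts I.k q (65 + I.γ) μ)
    (hE : Ech I.k q (65 + I.γ) μ) (h16 : μ 16 = I.n)
    (hid : ∀ u, μ (64 + (I.col u + 1)) < q)
    (hst : ∀ j < 2 ^ I.k, start I.k (65 + I.γ) μ j = if j = 0 then I.n + 1 else 0)
    (hrow : row I.k q (65 + I.γ) μ 0 = Pi.single 0 1) :
    HT Γ addIntervals μ (I.n * (intervalCost I.k + 10) + 10) fun ν =>
      Consts I.k q (65 + I.γ) ν ∧ Ech I.k q (65 + I.γ) ν ∧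
      rowSpan I.k q (65 + I.γ) ν 0 =
        I.chainSpan (fun u => (μ (64 + (I.col u + 1)) : ZMod q)) 0 0 := by
  intro p
  have hS := hΓ.std
  set g : Fin I.n → ZMod q := fun u => (μ (64 + (I.col u + 1)) : ZMod q) with hg
  refine .of_vc ?_
  simp only [addIntervals, vc_loop]
  refine WP.loop (fun i ν p' => p' = p ∧ i ≤ I.n ∧ ν 16 = i ∧
    (∀ a, a < 16 ∨ (30 < a ∧ a < 65 + I.γ) → ν a = μ a) ∧ Ech I.k q (65 + I.γ) ν ∧
    -- Tags in use are at least the start points of all intervals still to come, as the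
    -- representation is sorted.
    (∀ j < 2 ^ I.k, start I.k (65 + I.γ) ν j = 0 ∨
      ∀ u : Fin I.n, (u : ℕ) < i → I.rep.first u ≤ start I.k (65 + I.γ) ν j) ∧
    ∀ e ≤ I.n, rowSpan I.k q (65 + I.γ) ν e = I.chainSpan g i e)
    I.n (intervalCost I.k) ?_ ?_ ?_ ?_ ?_
  · refine ⟨rfl, le_rfl, h16, fun a _ => rfl, hE, fun j hj => ?_, fun e he => ?_⟩
    · rw [hst j hj]
      split_ifs
      · exact .inr fun u _ => (I.first_le_n u).trans (by omega)
      · exact .inl rfl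
    · rw [chainSpan_top, rowSpan]
      have : {j | j < 2 ^ I.k ∧ e < start I.k (65 + I.γ) μ j} = {0} := by
        ext j
        simp only [Set.mem_ofPred_eq, Set.mem_singleton_iff]
        constructor
        · rintro ⟨h1, h2⟩
          rw [hst j h1] at h2
          split_ifs at h2 with h
          · exact h
          · omega
        · rintro rfl
          rw [hst 0 (Nat.two_pow_pos _)]
          exact ⟨Nat.two_pow_pos _, by simp; omega⟩
      rw [this, Set.image_singleton, hrow]
  · rintro i ν p' ⟨-, hi, h16', -⟩
    simp [ok_v hS, ok_ofNat hS, h16']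
  · have : I.n * (intervalCost I.k + 10) = I.n * (intervalCost I.k + 5) + I.n * 5 := by ring
    simp only [cost_ofNat, cost_v, Nat.reduceAdd]; omega
  · rintro i ν p' ⟨rfl, hi, h16', hfr, hE', hbd, hspan⟩
    set u : Fin I.n := ⟨i, by omega⟩ with hu
    have hui : (u : ℕ) = i := rfl
    have hc := (I.col u).2
    have eid : ν (64 + (I.col u + 1)) = μ (64 + (I.col u + 1)) := hfr _ (by omega)
    refine (addInterval_spec hΓ hL (hμ.congr fun a _ h => hfr a (by omega)) hE' u h16'
      (by rw [eid]; exact hid u)).wp le_rfl ?_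
    rintro ν' n' ⟨hfr', h16'', hE'', hext, hsp⟩ hn'
    have hf := I.first_le_n u
    have hf1 := I.rep.one_le_first u
    have hfl := I.rep.first_le_last u
    have hl := I.last_le_n u
    have hbd' : ∀ j < 2 ^ I.k, start I.k (65 + I.γ) ν' j = 0 ∨
        I.rep.first u ≤ start I.k (65 + I.γ) ν' j := fun j hj => by
      rcases Nat.eq_zero_or_pos (start I.k (65 + I.γ) ν j) with h | h
      · rcases hext.new j hj h with h1 | h1
        · exact .inl h1
        · exact .inr h1.ge
      · rw [(hext.old j hj h).1]
        rcases hbd j hj with h1 | h1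
        · omega
        · exact .inr (h1 u (by omega))
    refine ⟨rfl, by omega, h16'', fun a ha => ?_, hE'', fun j hj => ?_, fun e he => ?_⟩
    · rw [hfr' a ha, hfr a ha]
    · refine (hbd' j hj).imp_right fun h u' hu' => (I.rep.sorted ?_).trans h
      rw [Fin.le_def]; omega
    · rcases Nat.lt_or_ge e (I.rep.first u) with h | h
      · have hb : ∀ j < 2 ^ I.k, start I.k (65 + I.γ) ν j = 0 ∨
            I.rep.first u ≤ start I.k (65 + I.γ) ν j := fun j hj =>
          (hbd j hj).imp_right fun h => h u (by omega)
        rw [rowSpan_eq_of_lt hbd' h, hsp, hspan _ hl, eid, ← rowSpan_eq_of_lt hb h, hspan e he,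
          ← hui, chainSpan_of_lt g u h]
      · rw [hext.rowSpan_of_le h, hspan e he, ← hui, chainSpan_of_le g u h]
  · rintro ν p' ⟨rfl, -, -, hfr, hE', -, hspan⟩
    exact ⟨⟨hμ.congr fun a _ h => hfr a (by omega), hE', hspan 0 (by omega)⟩, rfl⟩

/-- The row of the full mask is in use if and only if the instance is a yes-instance. -/
theorem start_full_pos_iff {q : ℕ} [Fact q.Prime] {U : ℕ} {ν : ℕ → ℕ} {g : Fin I.n → ZMod q}
    (hE : Ech I.k q U ν) (hg : ∀ u u', g u = g u' ↔ I.col u = I.col u')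
    (hspan : rowSpan I.k q U ν 0 = I.chainSpan g 0 0) :
    0 < start I.k U ν (2 ^ I.k - 1) ↔ I.IsYes := by
  have hN := Nat.two_pow_pos I.k
  have hmap : ∀ l : List (Fin I.n), (l.map g).Nodup ↔ (l.map I.col).Nodup := fun l => by
    constructor
    · intro h
      refine (List.nodup_map_iff_inj_on h.of_map).mpr fun x hx y hy hxy => ?_
      exact List.inj_on_of_nodup_map h hx hy ((hg _ _).mpr hxy)
    · intro h
      refine (List.nodup_map_iff_inj_on h.of_map).mpr fun x hx y hy hxy => ?_
      exact List.inj_on_of_nodup_map h hx hy ((hg _ _).mp hxy)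
  constructor
  · intro h
    by_contra hno
    -- Without a solution the full coordinate vanishes on all products, hence on all rows,
    -- contradicting the pivot of the last row.
    have hle : I.chainSpan g 0 0 ≤ LinearMap.ker (LinearMap.proj (2 ^ I.k - 1)) := by
      rw [chainSpan, Submodule.span_le]
      rintro _ ⟨l, h1, -, rfl⟩
      by_contra hne
      obtain ⟨h2, h3⟩ := prod_powers_ne_zero hne
      exact hno (I.isYes_iff.mpr ⟨l, h1, by simpa using h2, (hmap l).mp h3⟩)
    rw [← hspan] at hle
    exact (hE.lead _ (by omega) h).1
      (hle (Submodule.subset_span ⟨2 ^ I.k - 1, ⟨by omega, h⟩, rfl⟩))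
  · intro h
    obtain ⟨l, h1, h2, h3⟩ := I.isYes_iff.mp h
    by_contra h0
    have hne := (prod_powers_ne_zero_iff (l := l.map g) (by simpa using h2)).mpr ((hmap l).mpr h3)
    refine hne ?_
    -- The product of a solution is supported at the full mask alone. If no row has its pivot there,
    -- it vanishes at all pivots and is zero by `eq_zero_of_mem_span_echelon`.
    have hmem : prod I.k ((l.map g).map powers) ∈ rowSpan I.k q U ν 0 := by
      rw [hspan]
      exact Submodule.subset_span
        ⟨l, h1, fun u _ => ⟨Nat.zero_le _, I.rep.one_le_first u⟩, rfl⟩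
    have hset : {j | j < 2 ^ I.k ∧ 0 < start I.k U ν j} =
        ((Finset.range (2 ^ I.k)).filter fun j => 0 < start I.k U ν j : Finset ℕ) := by
      ext j; simp
    rw [rowSpan, hset] at hmem
    have := eq_zero_of_mem_span_echelon (fun j hj => ?_) hmem fun j hj => ?_
    · rw [this]; rfl
    · rw [Finset.mem_filter, Finset.mem_range] at hj
      exact hE.lead j hj.1 hj.2
    · rw [Finset.mem_filter] at hj
      refine prod_apply_eq_zero (by simpa using h2) ?_
      rintro rfl
      exact h0 hj.2

end JobIntervalSelection

/-! ### A prime modulus by trial division -/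

namespace WordRAM

open WordRAM.Exp

/-- Tests whether the number in cell `15` has a proper divisor; the answer goes to cell `21`. -/
def divisorLoop : Cmd :=
  .seq (.set 21 0) <| .seq (.set 22 2) <| .loop (v 22) (v 15) <|
    .seq (.ite (v 15 % v 22) 1 (.set 21 1) .skip) (.set 22 (v 22 + 1))

/-- Finds the least prime that is greater than the successor of the number in cell `20`. -/
def findPrime : Cmd :=
  .seq (.set 15 (v 20 + 1)) <| .seq (.set 21 1) <| .loop 0 (v 21) <|
    .seq (.set 15 (v 15 + 1)) (.call divisorLoop)

variable {Γ : Env} {μ : ℕ → ℕ}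

open Classical in
theorem divisorLoop_spec (hS : Γ.Std) {q : ℕ} (h15 : μ 15 = q) (hq : 2 ≤ q) (hw : q < 2 ^ Γ.w) :
    HT Γ divisorLoop μ (30 * q + 10) fun ν =>
      (∀ a, a < 21 ∨ 22 < a → ν a = μ a) ∧ ν 21 = if q.Prime then 0 else 1 := by
  intro p
  refine .of_vc ?_
  simp [divisorLoop, vc_set hS, ok_ofNat hS]
  refine WP.loop (fun i ν p' => p' = p ∧ i ≤ q - 2 ∧ ν 22 = q - i ∧
    (∀ a, a < 21 ∨ 22 < a → ν a = μ a) ∧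
    ((ν 21 = 0 ∧ ∀ d < q - i, 2 ≤ d → ¬ d ∣ q) ∨ (ν 21 = 1 ∧ ∃ d < q - i, 2 ≤ d ∧ d ∣ q)))
    (q - 2) 20 ?_ ?_ ?_ ?_ ?_
  · refine ⟨rfl, le_rfl, by simp; omega, fun a ha => ?_, .inl ⟨by simp, fun d hd h2 => by omega⟩⟩
    rw [Function.update_of_ne (by omega), Function.update_of_ne (by omega)]
  · rintro i ν p' ⟨-, hi, h22, hfr, -⟩
    have e15 : ν 15 = q := (hfr 15 (by omega)).trans h15
    simp [ok_v hS, e15, h22]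
    omega
  · simp only [cost_v, Nat.reduceAdd]; omega
  · rintro i ν p' ⟨rfl, hi, h22, hfr, hd⟩
    obtain ⟨d, hd0⟩ : ∃ d, q - (i + 1) = d := ⟨_, rfl⟩
    have hd1 : q - i = d + 1 := by clear hd; omega
    rw [hd0] at h22 hd
    rw [hd1]
    have e15 : ν 15 = q := (hfr 15 (by omega)).trans h15
    refine .of_vc ?_
    simp [vc_set hS, ok_ofNat hS, ok_v hS, e15, h22]
    refine ⟨fun hmod => ⟨by omega, by omega, fun a ha => ?_, d, le_rfl, by omega,
      Nat.dvd_of_mod_eq_zero hmod⟩, fun hmod => ⟨by omega, by omega, fun a ha => ?_, ?_⟩⟩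
    · rw [Function.update_of_ne (by omega), Function.update_of_ne (by omega), hfr a ha]
    · rw [Function.update_of_ne (by omega), hfr a ha]
    · rcases hd with ⟨h1, h2⟩ | ⟨h1, e, he, h2⟩
      · refine .inl ⟨h1, fun e he h3 h4 => ?_⟩
        rcases Nat.lt_or_eq_of_le he with he | rfl
        · exact h2 e he h3 h4
        · exact absurd (Nat.mod_eq_zero_of_dvd h4) (by omega)
      · exact .inr ⟨h1, e, by omega, h2⟩
  · rintro ν p' ⟨rfl, -, -, hfr, hd⟩
    refine ⟨⟨hfr, ?_⟩, rfl⟩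
    rw [Nat.sub_zero] at hd
    rcases hd with ⟨h1, h2⟩ | ⟨h1, d, h2, h3, h4⟩
    · rw [h1, if_pos]
      refine Nat.prime_def_lt.mpr ⟨hq, fun d hd hdq => ?_⟩
      by_contra hne
      have := Nat.pos_of_dvd_of_pos hdq (by omega)
      exact h2 d hd (by omega) hdq
    · rw [h1, if_neg]
      intro hp
      have := (Nat.prime_def_lt.mp hp).2 d h2 h4
      omega

/-- By Bertrand's postulate at most `m + 1` candidates have to be tested, each with `O(m)`
divisions. -/
theorem findPrime_spec (hS : Γ.Std) {m : ℕ} (h20 : μ 20 = m) (hw : 2 * (m + 1) < 2 ^ Γ.w) :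
    HT Γ findPrime μ (60 * ((m + 1) * (m + 2)) + 20) fun ν =>
      (∀ a, a ≠ 15 → a < 21 ∨ 22 < a → ν a = μ a) ∧ (ν 15).Prime ∧ m + 1 < ν 15 ∧
        ν 15 ≤ 2 * (m + 1) := by
  classical
  intro p
  have hex := Nat.exists_prime_lt_and_le_two_mul (m + 1) (by omega)
  obtain ⟨hP, hP1, hP2⟩ := Nat.find_spec hex
  have hmin : ∀ r, r < Nat.find hex → ¬ (r.Prime ∧ m + 1 < r ∧ r ≤ 2 * (m + 1)) := fun r hr =>
    Nat.find_min hex hr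
  generalize Nat.find hex = P at *
  refine .of_vc ?_
  simp [findPrime, vc_set hS, ok_ofNat hS, ok_v hS, h20]
  refine ⟨by omega, ?_⟩
  refine WP.loop (fun i ν p' => p' = p ∧ ν 15 + i = P ∧ m + 1 ≤ ν 15 ∧
    (ν 21 = if i = 0 then 0 else 1) ∧ (∀ a, a ≠ 15 → a < 21 ∨ 22 < a → ν a = μ a))
    (P - (m + 1)) (30 * P + 20) ?_ ?_ ?_ ?_ ?_
  · refine ⟨rfl, by simp; omega, by simp, ?_, fun a ha _ => ?_⟩
    · rw [if_neg (by omega)]; simp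
    · rw [Function.update_of_ne (by omega), Function.update_of_ne (by omega)]
  · rintro i ν p' ⟨-, -, -, h21, -⟩
    simp [ok_v hS, ok_ofNat hS, h21, Nat.pos_iff_ne_zero]
  · simp only [cost_v, cost_ofNat, Nat.reduceAdd]
    have h1 : (P - (m + 1)) * (30 * P + 20 + 5) ≤ (m + 1) * (60 * (m + 1) + 25) :=
      Nat.mul_le_mul (by omega) (by omega)
    have h2 : 60 * ((m + 1) * (m + 2)) = (m + 1) * (60 * (m + 1) + 25) + 35 * (m + 1) := by ring
    omega
  · rintro i ν p' ⟨rfl, hP3, h15, h21, hfr⟩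
    refine .of_vc ?_
    simp [vc_set hS, ok_ofNat hS, ok_v hS]
    refine ⟨by omega, ?_⟩
    refine (divisorLoop_spec hS (q := ν 15 + 1) (by simp) (by omega) (by omega)).wp (by omega) ?_
    rintro ν' n' ⟨hfr', h21'⟩ -
    have e15 : ν' 15 = ν 15 + 1 := by rw [hfr' 15 (by omega)]; simp
    refine ⟨rfl, by omega, by omega, ?_, fun a h1 h2 => ?_⟩
    · rw [h21']
      refine if_congr ⟨fun h => ?_, fun h => ?_⟩ rfl rfl
      · by_contra hi
        exact hmin (ν 15 + 1) (by omega) ⟨h, by omega, by omega⟩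
      · rwa [show ν 15 + 1 = P by omega]
    · rw [hfr' a h2, Function.update_of_ne h1, hfr a h1 h2]
  · rintro ν p' ⟨rfl, h1, -, -, hfr⟩
    rw [Nat.add_zero] at h1
    rw [h1]
    exact ⟨⟨hfr, hP, hP1, hP2⟩, rfl⟩

end WordRAM

/-! ### Numbering of the occurring colors -/

namespace JobIntervalSelection

open WordRAM WordRAM.Exp Wedge

variable {I : JobIntervalSelection}

/-- Numbers the colors that occur in the order of their first occurrences; the number of the color
`c` goes to cell `64 + c`, and the number of these colors to cell `20`. -/
def numberColors : Cmd :=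
  .seq (.set 16 0) <| .seq (.set 20 0) <| .loop (v 16) (v 8) <|
    .seq (.set 21 (64 + inp (5 + 3 * v 16))) <|
    .seq (.ite (ld (v 21)) 1 (.seq (.set 20 (v 20 + 1)) (.store (v 21) (v 20))) .skip)
    (.set 16 (v 16 + 1))

/-- The numbers are bounded by both `n` and `γ`, so a prime search quadratic in their maximum costs
only `O(γ * n)`; a modulus above `γ` itself could cost `γ * γ`. Numbers start at 1, and the initial
zero of a cell marks a color not met yet, so no pass over all `γ` cells is needed. -/
theorem numberColors_spec {Γ : Env} (hΓ : I.DetEnv Γ) {μ : ℕ → ℕ} (h8 : μ 8 = I.n)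
    (h0 : ∀ a, 64 ≤ a → μ a = 0) :
    HT Γ numberColors μ (60 * I.n + 15) fun ν =>
      (∀ a, a < 16 ∨ 65 + I.γ ≤ a → ν a = μ a) ∧ ν 16 = I.n ∧ ν 20 ≤ I.n ∧ ν 20 ≤ I.γ ∧
      (∀ u, ν (64 + (I.col u + 1)) ≤ ν 20) ∧
      ∀ u u', ν (64 + (I.col u + 1)) = ν (64 + (I.col u' + 1)) ↔ I.col u = I.col u' := by
  intro p
  have hS := hΓ.std
  have h1 := hΓ.fit1
  have h2 := hΓ.fit2
  have hN2 := Nat.zero_le (2 ^ I.k * 2 ^ I.k)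
  refine .of_vc ?_
  simp [numberColors, vc_set hS, ok_ofNat hS]
  refine WP.loop (fun i ν p' => p' = p ∧ i ≤ I.n ∧ ν 16 = I.n - i ∧ ν 20 ≤ I.n - i ∧
    (∀ a, a < 16 ∨ 65 + I.γ ≤ a → ν a = μ a) ∧
    -- The counter equals the number of colors numbered so far; this is what bounds it by `γ`.
    ((Finset.range I.γ).filter fun c => 0 < ν (64 + (c + 1))).card = ν 20 ∧
    (∀ c < I.γ, ν (64 + (c + 1)) ≤ ν 20) ∧
    (∀ c < I.γ, ∀ c' < I.γ, 0 < ν (64 + (c + 1)) → ν (64 + (c + 1)) = ν (64 + (c' + 1)) → c = c') ∧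
    ∀ u : Fin I.n, (u : ℕ) < I.n - i → 0 < ν (64 + (I.col u + 1)))
    I.n 50 ?_ ?_ ?_ ?_ ?_
  · have hz : ∀ a, 64 ≤ a → Function.update (Function.update μ 16 0) 20 0 a = 0 := fun a ha => by
      rw [Function.update_of_ne (by omega), Function.update_of_ne (by omega), h0 a ha]
    refine ⟨rfl, le_rfl, by simp, by simp, fun a ha => ?_, ?_, fun c _ => ?_, fun c _ c' _ h => ?_,
      fun u hu => by omega⟩
    · rw [Function.update_of_ne (by omega), Function.update_of_ne (by omega)]
    · rw [Function.update_self, Finset.card_eq_zero, Finset.filter_eq_empty_iff]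
      intro c _
      rw [hz _ (by omega)]; simp
    · rw [hz _ (by omega)]; simp
    · rw [hz _ (by omega)] at h; omega
  · rintro i ν p' ⟨-, hi, h16, -, hfr, -⟩
    have e8 : ν 8 = I.n := (hfr 8 (by omega)).trans h8
    simp [ok_v hS, e8, h16]
    omega
  · simp only [cost_v, Nat.reduceAdd]; omega
  · rintro i ν p' ⟨rfl, hi, h16, h20, hfr, hcard, hle, hinj, hpos⟩
    obtain ⟨j, hj⟩ : ∃ j, I.n - (i + 1) = j := ⟨_, rfl⟩
    have hj' : I.n - i = j + 1 := by omega
    rw [hj] at h16 h20 hpos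
    rw [hj']
    set u : Fin I.n := ⟨j, by omega⟩ with hu
    have huj : ∀ u' : Fin I.n, (u' : ℕ) < j + 1 → (u' : ℕ) < j ∨ u' = u := fun u' h => by
      rcases Nat.lt_or_eq_of_le (Nat.lt_succ_iff.mp h) with h | h
      · exact .inl h
      · exact .inr (Fin.ext h)
    have x5 : Γ.x[5 + 3 * j]?.getD 0 = I.col u + 1 := hΓ.getD u 2 (by omega)
    have hc := (I.col u).2
    obtain ⟨c, hcu⟩ : ∃ c : ℕ, (I.col u : ℕ) = c := ⟨_, rfl⟩
    rw [hcu] at x5 hc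
    have n16 : ¬ 16 = 64 + (c + 1) := by omega
    have n20 : ¬ 20 = 64 + (c + 1) := by omega
    have n21 : ¬ 64 + (c + 1) = 21 := by omega
    refine .of_vc ?_
    simp [vc_set hS, ok_ofNat hS, ok_v hS, h16, x5, Function.update_of_ne n16,
      Function.update_of_ne n20, Function.update_of_ne n21]
    refine ⟨by omega, ⟨by omega, hΓ.cell _⟩, fun hz => ?_, fun hnz => ?_⟩
    · refine ⟨by omega, hΓ.cell _, by omega, by omega, h20, ?_⟩
      have hself : ∀ b, Function.update (Function.update (Function.update (Function.update ν 21
          (64 + (c + 1))) 20 (ν 20 + 1)) (64 + (c + 1)) (ν 20 + 1)) 16 b (64 + (c + 1)) =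
          ν 20 + 1 := fun b => by
        rw [Function.update_of_ne (by omega), Function.update_self]
      have hother : ∀ b c', c' ≠ c → Function.update (Function.update (Function.update
          (Function.update ν 21 (64 + (c + 1))) 20 (ν 20 + 1)) (64 + (c + 1)) (ν 20 + 1)) 16 b
          (64 + (c' + 1)) = ν (64 + (c' + 1)) := fun b c' h => by
        rw [Function.update_of_ne (by omega), Function.update_of_ne (by omega),
          Function.update_of_ne (by omega), Function.update_of_ne (by omega)]
      refine ⟨fun a ha => ?_, ?_, fun c' hc' => ?_, fun c1 hc1 c2 hc2 => ?_, fun u' hu' => ?_⟩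
      · rw [Function.update_of_ne (by omega), Function.update_of_ne (by omega),
          Function.update_of_ne (by omega), Function.update_of_ne (by omega), hfr a ha]
      · have e := Finset.card_insert_of_notMem (a := c)
          (s := (Finset.range I.γ).filter fun c => 0 < ν (64 + (c + 1))) (by simp [hz])
        rw [hcard] at e
        refine Eq.trans (congrArg Finset.card ?_) e
        ext c'
        simp only [Finset.mem_filter, Finset.mem_range, Finset.mem_insert]
        by_cases h : c' = c
        · subst h; rw [hself]; simp [hc]
        · rw [hother _ _ h]; simp [h]
      · by_cases h : c' = c
        · subst h; rw [hself]
        · rw [hother _ _ h]; have := hle c' hc'; omega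
      · by_cases e1 : c1 = c <;> by_cases e2 : c2 = c
        · intro _ _; rw [e1, e2]
        · subst e1
          rw [hself, hother _ _ e2]
          have := hle c2 hc2; omega
        · subst e2
          rw [hself, hother _ _ e1]
          have := hle c1 hc1; omega
        · rw [hother _ _ e1, hother _ _ e2]
          exact hinj c1 hc1 c2 hc2
      · by_cases h : (I.col u' : ℕ) = c
        · rw [h, hself]; omega
        · rw [hother _ _ h]
          rcases huj u' (by omega) with h' | h'
          · exact hpos u' h'
          · exact absurd (h' ▸ hcu) h
    · have hother : ∀ b a, a ≠ 16 → a ≠ 21 → Function.update (Function.update ν 21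
          (64 + (c + 1))) 16 b a = ν a := fun b a h1 h2 => by
        rw [Function.update_of_ne h1, Function.update_of_ne h2]
      have hoth : ∀ b c', Function.update (Function.update ν 21
          (64 + (c + 1))) 16 b (64 + (c' + 1)) = ν (64 + (c' + 1)) := fun b c' =>
        hother _ _ (by omega) (by omega)
      simp only [hoth]
      refine ⟨by omega, by omega, by omega, fun a ha => ?_, hcard, hle, hinj, fun u' hu' => ?_⟩
      · rw [hother _ _ (by omega) (by omega), hfr a ha]
      · rcases huj u' (by omega) with h' | h'
        · exact hpos u' h'
        · rw [h', hcu]; omega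
  · rintro ν p' ⟨rfl, -, h16, h20, hfr, hcard, hle, hinj, hpos⟩
    refine ⟨⟨hfr, by simpa using h16, by simpa using h20, ?_, fun u => hle _ (I.col u).2,
      fun u u' => ⟨fun h => ?_, fun h => by rw [h]⟩⟩, rfl⟩
    · rw [← hcard]
      exact (Finset.card_filter_le _ _).trans (by simp)
    · exact Fin.ext (hinj _ (I.col u).2 _ (I.col u').2 (hpos u (by have := u.2; omega)) h)

end JobIntervalSelection

-- An event of probability at least 1 contains the whole support; this turns the probability bound
-- into certain acceptance.
open WordRAM in
theorem WordRAM.Good.accepted_of_one {Γ : Env} {P : Program} {t : ℕ} (h : Good Γ P t init 1) :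
    ∀ σ ∈ (WordRAM.run P Γ.w Γ.x t).support, σ.status = .accepted := by
  obtain ⟨-, -, -, h4⟩ := h.run
  rw [ENNReal.ofReal_one] at h4
  refine fun σ hσ => (PMF.toOuterMeasure_apply_eq_one_iff _ _).mp (le_antisymm ?_ h4) hσ
  exact ((WordRAM.run P Γ.w Γ.x t).toOuterMeasure.mono (Set.subset_univ _)).trans_eq
    ((PMF.toOuterMeasure_apply_eq_one_iff _ _).mpr (Set.subset_univ _))

/-! ### The complete deterministic algorithm -/

namespace JobIntervalSelection

open WordRAM WordRAM.Exp Wedge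

/-- The initialization of the deterministic algorithm. -/
def detInit : Cmd :=
  .seq (.set 8 (inp 0)) <| .seq (.set 9 (inp 2)) <| .seq (.set 10 1) <| .seq (.set 20 0) <|
    .seq (.call <| .loop (v 20) (v 9) <|
      .seq (.set 10 (v 10 + v 10)) (.set 20 (v 20 + 1))) <|
    .seq (.set 11 (65 + inp 1)) <| .seq (.set 12 (v 11 + v 9)) <| .seq (.set 13 (v 12 + v 10)) <|
    .seq (.set 14 (v 13 + v 10)) <| .seq (.call numberColors) <| .seq (.call findPrime) <|
    .seq (.store (v 13) (v 8 + 1)) (.store (v 14) 1)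

/-- The deterministic algorithm. -/
def detAlg : Cmd :=
  .seq (.call detInit) <| .seq (.call addIntervals) <|
    .ite 0 (ld (v 13 + (v 10 - 1))) .accept .reject

variable {I : JobIntervalSelection}

theorem detInit_spec {Γ : Env} (hΓ : I.DetEnv Γ) :
    HT Γ detInit (fun _ => 0) (30 * I.k + 60 * I.n + 60 * ((I.γ + 1) * (I.n + 2)) + 150) fun ν =>
      ∃ q, q.Prime ∧ q ≤ 2 * (I.γ + 1) ∧ Consts I.k q (65 + I.γ) ν ∧ ν 16 = I.n ∧
      (∀ u, ν (64 + (I.col u + 1)) < q) ∧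
      (∀ u u', ν (64 + (I.col u + 1)) = ν (64 + (I.col u' + 1)) ↔ I.col u = I.col u') ∧
      (∀ j < 2 ^ I.k, start I.k (65 + I.γ) ν j = if j = 0 then I.n + 1 else 0) ∧
      ∀ j, ν (65 + I.γ + I.k + 2 * 2 ^ I.k + j) = if j = 0 then 1 else 0 := by
  intro p
  have hS := hΓ.std
  have h1 := hΓ.fit1
  have h2 := hΓ.fit2
  have h3 := hΓ.fit3
  have hN := Nat.two_pow_pos I.k
  have hN2 := Nat.zero_le (2 ^ I.k * 2 ^ I.k)
  have x0 : Γ.x[0]?.getD 0 = I.n := by rw [hΓ.input]; simp [encode]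
  have x1 : Γ.x[1]?.getD 0 = I.γ := by rw [hΓ.input]; simp [encode]
  have x2 : Γ.x[2]?.getD 0 = I.k := by rw [hΓ.input]; simp [encode]
  refine .of_vc ?_
  simp [detInit, vc_set hS, ok_ofNat hS, x0, x2]
  refine ⟨by omega, by omega, ?_⟩
  set μ0 : ℕ → ℕ := Function.update (Function.update (Function.update (Function.update
    (fun _ => 0) 8 I.n) 9 I.k) 10 1) 20 0 with hμ0
  have hfirst : HT Γ (.loop (v 20) (v 9) <| .seq (.set 10 (v 10 + v 10)) (.set 20 (v 20 + 1)))
      μ0 (26 * I.k + 10) fun ν => (∀ a, a ≠ 10 → a ≠ 20 → ν a = μ0 a) ∧ ν 10 = 2 ^ I.k := by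
    refine HT.loop (fun i ν => i ≤ I.k ∧ ν 20 = I.k - i ∧ ν 10 = 2 ^ (I.k - i) ∧
      ∀ a, a ≠ 10 → a ≠ 20 → ν a = μ0 a) I.k 20 ?_ ?_ ?_ ?_ ?_
    · exact ⟨le_rfl, by simp [hμ0], by simp [hμ0], fun _ _ _ => rfl⟩
    · rintro i ν ⟨hi, h20, -, hfr⟩
      have e9 : ν 9 = I.k := (hfr 9 (by omega) (by omega)).trans (by simp [hμ0])
      simp [ok_v hS, h20, e9]
      omega
    · simp only [cost_v, Nat.reduceAdd]; omega
    · rintro i ν ⟨hi, h20, h10, hfr⟩ q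
      obtain ⟨j, hj⟩ : ∃ j, I.k - (i + 1) = j := ⟨_, rfl⟩
      have hj' : I.k - i = j + 1 := by omega
      rw [hj] at h20 h10
      rw [hj']
      have hpow : 2 ^ (j + 1) ≤ 2 ^ I.k := Nat.pow_le_pow_right (by omega) (by omega)
      have hp1 : 2 ^ (j + 1) = 2 ^ j + 2 ^ j := by rw [pow_succ]; omega
      refine .of_vc ?_
      simp [vc_set hS, ok_v hS, ok_ofNat hS, h10, h20]
      refine ⟨by omega, by omega, by omega, by omega, fun a ha hb => ?_⟩
      rw [Function.update_of_ne hb, Function.update_of_ne ha, hfr a ha hb]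
    · rintro ν ⟨-, -, h10, hfr⟩
      exact ⟨hfr, by simpa using h10⟩
  refine hfirst.wp (by omega) ?_
  rintro ν n ⟨hfr, h10⟩ hn
  have e8 : ν 8 = I.n := (hfr 8 (by omega) (by omega)).trans (by simp [hμ0])
  have e9 : ν 9 = I.k := (hfr 9 (by omega) (by omega)).trans (by simp [hμ0])
  have hz : ∀ a, 64 ≤ a → ν a = 0 := fun a ha => by
    rw [hfr a (by omega) (by omega), hμ0, Function.update_of_ne (by omega),
      Function.update_of_ne (by omega), Function.update_of_ne (by omega),
      Function.update_of_ne (by omega)]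
  simp [vc_set hS, ok_v hS, ok_ofNat hS, x1, e9, h10]
  and_intros
  all_goals first | omega | skip
  set μ1 := Function.update (Function.update (Function.update (Function.update ν 11 (65 + I.γ)) 12
    (65 + I.γ + I.k)) 13 (65 + I.γ + I.k + 2 ^ I.k)) 14 (65 + I.γ + I.k + 2 ^ I.k + 2 ^ I.k)
    with hμ1
  have hfr1 : ∀ a, a < 11 ∨ 14 < a → μ1 a = ν a := fun a ha => by
    rw [hμ1, Function.update_of_ne (by omega), Function.update_of_ne (by omega),
      Function.update_of_ne (by omega), Function.update_of_ne (by omega)]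
  refine (numberColors_spec hΓ ((hfr1 8 (by omega)).trans e8) fun a ha => by
    rw [hfr1 a (by omega), hz a ha]).wp (by omega) ?_
  rintro ν2 n2 ⟨hfr2, h16, hm1, hm2, hid, hinj⟩ hn2
  -- One factor is estimated by the bound `γ` on the number of occurring colors, the other by the
  -- bound `n`.
  have hmm : (ν2 20 + 1) * (ν2 20 + 2) ≤ (I.γ + 1) * (I.n + 2) :=
    Nat.mul_le_mul (by omega) (by omega)
  have hγ : I.γ + 1 ≤ (I.γ + 1) * (I.γ + 1) := Nat.le_mul_of_pos_left _ (by omega)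
  refine (findPrime_spec hS rfl (by omega)).wp (by omega) ?_
  rintro ν3 n3 ⟨hfr3, hp, hlt, hle⟩ hn3
  have key : ∀ a, a < 15 ∨ 65 + I.γ ≤ a → ν3 a = μ1 a := fun a ha => by
    rw [hfr3 a (by omega) (by omega), hfr2 a (by omega)]
  have k8 : ν3 8 = I.n := by rw [key 8 (by omega), hfr1 8 (by omega), e8]
  have k9 : ν3 9 = I.k := by rw [key 9 (by omega), hfr1 9 (by omega), e9]
  have k10 : ν3 10 = 2 ^ I.k := by rw [key 10 (by omega), hfr1 10 (by omega), h10]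
  have k11 : ν3 11 = 65 + I.γ := by rw [key 11 (by omega)]; simp [hμ1]
  have k12 : ν3 12 = 65 + I.γ + I.k := by rw [key 12 (by omega)]; simp [hμ1]
  have k13 : ν3 13 = 65 + I.γ + I.k + 2 ^ I.k := by rw [key 13 (by omega)]; simp [hμ1]
  have k14 : ν3 14 = 65 + I.γ + I.k + 2 ^ I.k + 2 ^ I.k := by rw [key 14 (by omega)]; simp [hμ1]
  have kz : ∀ a, 65 + I.γ ≤ a → ν3 a = 0 := fun a ha => by
    rw [key a (by omega), hfr1 a (by omega), hz a (by omega)]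
  have kid : ∀ u, ν3 (64 + (I.col u + 1)) = ν2 (64 + (I.col u + 1)) := fun u =>
    hfr3 _ (by omega) (by omega)
  have n14 : ¬ 14 = 65 + I.γ + I.k + 2 ^ I.k := by omega
  simp [ok_v hS, ok_ofNat hS, k8, k13, k14, Function.update_of_ne n14]
  and_intros
  all_goals first | omega | exact hΓ.cell _ | skip
  set μ2 := Function.update (Function.update ν3 (65 + I.γ + I.k + 2 ^ I.k) (I.n + 1))
    (65 + I.γ + I.k + 2 ^ I.k + 2 ^ I.k) 1 with hμ2
  have hfr4 : ∀ a, a < 65 + I.γ → μ2 a = ν3 a := fun a ha => by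
    rw [hμ2, Function.update_of_ne (by omega), Function.update_of_ne (by omega)]
  refine ⟨ν3 15, hp, by omega, ⟨?_, ?_, ?_, ?_, ?_, ?_, ?_⟩, ?_, fun u => ?_, fun u u' => ?_,
    fun j hj => ?_, fun j => ?_⟩
  · rw [hfr4 _ (by omega), k9]
  · rw [hfr4 _ (by omega), k10]
  · rw [hfr4 _ (by omega), k11]
  · rw [hfr4 _ (by omega), k12]
  · rw [hfr4 _ (by omega), k13]
  · rw [hfr4 _ (by omega), k14]; omega
  · rw [hfr4 _ (by omega)]
  · rw [hfr4 _ (by omega), hfr3 16 (by omega) (by omega), h16]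
  · have := (I.col u).2
    rw [hfr4 _ (by omega), kid]
    have := hid u
    omega
  · have := (I.col u).2
    have := (I.col u').2
    rw [hfr4 _ (by omega), hfr4 _ (by omega), kid, kid]
    exact hinj u u'
  · rw [start, hμ2, Function.update_of_ne (by omega)]
    split_ifs with h
    · subst h
      exact Function.update_self ..
    · rw [Function.update_of_ne (by omega), kz _ (by omega)]
  · rw [hμ2]
    split_ifs with h
    · subst h
      rw [show 65 + I.γ + I.k + 2 * 2 ^ I.k + 0 = 65 + I.γ + I.k + 2 ^ I.k + 2 ^ I.k by omega,
        Function.update_self]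
    · rw [Function.update_of_ne (by omega), Function.update_of_ne (by omega), kz _ (by omega)]

/-- The running time of the deterministic algorithm. -/
def detTime (I : JobIntervalSelection) : ℕ :=
  30 * I.k + 60 * I.n + 60 * ((I.γ + 1) * (I.n + 2)) + I.n * (intervalCost I.k + 10) + 200

-- A guarantee of 1 on yes-instances forces acceptance, and `Good` excludes acceptance on
-- no-instances; together they make the run a decision.
open Classical in
theorem detAlg_spec {Γ : Env} (hΓ : I.DetEnv Γ) :
    WP Γ detAlg (fun _ _ _ => False) (fun _ => 0) I.detTime (if I.IsYes then 1 else 0) := by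
  have hS := hΓ.std
  have h2 := hΓ.fit2
  have hN := Nat.two_pow_pos I.k
  have hN2 := Nat.zero_le (2 ^ I.k * 2 ^ I.k)
  refine .of_vc ?_
  simp only [detAlg, vc_seq, vc_call, detTime]
  refine (detInit_spec hΓ).wp (by omega) ?_
  rintro μ n ⟨q, hq, hqγ, hμ, h16, hid, hinj, hst, hrow⟩ hn
  have : Fact q.Prime := ⟨hq⟩
  have hq1 := hq.one_lt
  have hqq : q * q ≤ 2 * (I.γ + 1) * (2 * (I.γ + 1)) := Nat.mul_le_mul hqγ hqγ
  have hqq' : 2 * (I.γ + 1) * (2 * (I.γ + 1)) = 4 * ((I.γ + 1) * (I.γ + 1)) := by ring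
  have h3 := hΓ.fit3
  have hL : Layout I.k q (65 + I.γ) Γ := ⟨hS, hΓ.cell, by omega, by omega, by omega, hq⟩
  have hrow0 : row I.k q (65 + I.γ) μ 0 = Pi.single 0 1 := by
    ext i
    simp only [row, vecAt, Nat.mul_zero, Nat.add_zero, hrow]
    by_cases h : i = 0
    · subst h; simp
    · rw [Pi.single_eq_of_ne h]; simp [h]
  have hE : Ech I.k q (65 + I.γ) μ := by
    refine ⟨fun j hj i hi => ?_, fun j hj h0 => ?_⟩
    · rw [Nat.add_assoc, hrow]
      split_ifs <;> omega
    · rw [hst j hj] at h0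
      split_ifs at h0 with h
      · subst h
        rw [hrow0]
        exact ⟨by simp, fun i hi => by omega⟩
      · omega
  refine (addIntervals_spec hΓ hL hμ hE h16 hid hst hrow0).wp (by omega) ?_
  rintro ν n' ⟨hν, hE', hspan⟩ hn'
  have hiff := start_full_pos_iff hE' (fun u u' => ?_) hspan
  · rw [start] at hiff
    simp [ok_v hS, ok_ofNat hS, hν.c10, hν.c13]
    refine ⟨⟨⟨by omega, by omega⟩, by omega, hΓ.cell _⟩, by omega, fun h => ?_, fun h => ?_⟩
    · have hy := hiff.mp h
      exact ⟨hΓ.yes.mpr hy, by rw [if_pos hy], by omega⟩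
    · have hy : ¬ I.IsYes := fun hy => by have := hiff.mpr hy; omega
      exact ⟨by rw [if_neg hy], by omega⟩
  · rw [ZMod.natCast_eq_natCast_iff', Nat.mod_eq_of_lt (hid u), Nat.mod_eq_of_lt (hid u')]
    exact hinj u u'

/-- Word lengths that are large enough for the deterministic algorithm. -/
theorem detEnv_of_le {w : ℕ} (hn : 0 < I.n) (hw : 20 * (I.k + Nat.clog 2 (I.n + I.γ + 1)) ≤ w) :
    I.DetEnv ⟨w, I.encode, fun _ => True, I.IsYes, fun _ _ => trivial⟩ := by
  have hγ : 0 < I.γ := (I.col ⟨0, hn⟩).pos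
  set Z := I.n + I.γ + 1 with hZ
  set V := 2 ^ I.k * Z with hV
  have hZ2 : Z ≤ 2 ^ Nat.clog 2 Z := Nat.le_pow_clog (by omega) _
  have hVw : V ^ 20 ≤ 2 ^ w := by
    calc V ^ 20 ≤ (2 ^ I.k * 2 ^ Nat.clog 2 Z) ^ 20 :=
          Nat.pow_le_pow_left (Nat.mul_le_mul_left _ hZ2) _
      _ = 2 ^ (20 * (I.k + Nat.clog 2 Z)) := by rw [← pow_add, ← pow_mul, Nat.mul_comm]
      _ ≤ 2 ^ w := Nat.pow_le_pow_right (by omega) hw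
  have hk1 : 1 ≤ 2 ^ I.k := Nat.one_le_two_pow
  have hkk : I.k < 2 ^ I.k := Nat.lt_two_pow_self
  have hZV : Z ≤ V := Nat.le_mul_of_pos_left _ hk1
  have hkV : 2 ^ I.k ≤ V := Nat.le_mul_of_pos_right _ (by omega)
  have hV3 : 3 ≤ V := by omega
  have hVV : V ≤ V * V := Nat.le_mul_of_pos_left _ (by omega)
  have h5 : 3 ^ 5 ≤ V ^ 5 := Nat.pow_le_pow_left hV3 _
  have h7 : V ^ 7 < V ^ 20 := Nat.pow_lt_pow_right (by omega) (by omega)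
  have h77 : 243 * (V * V) ≤ V ^ 7 := by
    calc 243 * (V * V) ≤ V ^ 5 * (V * V) := Nat.mul_le_mul_right _ h5
      _ = V ^ 7 := by ring
  have hkk2 : 2 ^ I.k * 2 ^ I.k ≤ V * V := Nat.mul_le_mul hkV hkV
  have hγ2 : (I.γ + 1) * (I.γ + 1) ≤ V * V := Nat.mul_le_mul (by omega) (by omega)
  refine ⟨⟨fun a ha => trivial, ?_⟩, rfl, fun _ => trivial, Iff.rfl, ?_, ?_, ?_⟩
  · change 128 ≤ 2 ^ w; omega
  · change 3 * I.n + 16 ≤ 2 ^ w; omega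
  · change _ < 2 ^ w; omega
  · change _ < 2 ^ w; omega

/-- There are at most `2 ^ k` rows to multiply; a product takes `O(k * 2 ^ k)` steps and its
reduction by up to `2 ^ k` rows of length `2 ^ k` takes `O(4 ^ k)`. Plain elimination thus already
stays below the base 12.8. -/
theorem intervalCost_le (k : ℕ) : intervalCost k ≤ 410 * 8 ^ k := by
  have hk : k + 1 ≤ 2 ^ k := Nat.lt_two_pow_self
  have e : 8 ^ k = 2 ^ k * (2 ^ k * 2 ^ k) := by
    rw [← mul_pow, ← mul_pow]; norm_num
  rw [intervalCost, e]
  set N := 2 ^ k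
  have h1 : N * (60 * k + 50) ≤ N * (60 * N) := Nat.mul_le_mul_left _ (by omega)
  have h2 : N * (50 * N + 90) ≤ N * (140 * N) := Nat.mul_le_mul_left _ (by omega)
  have h3 : 1 ≤ N * N := Nat.mul_pos (by omega) (by omega)
  have h4 : N * (60 * N) = 60 * (N * N) := by ring
  have h5 : N * (140 * N) = 140 * (N * N) := by ring
  have h6 : N * (N * (60 * k + 50) + N * (50 * N + 90) + 70) ≤ N * (270 * (N * N)) :=
    Nat.mul_le_mul_left _ (by omega)
  have h7 : N * (270 * (N * N)) = 270 * (N * (N * N)) := by ring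
  have h8 : N ≤ N * (N * N) := Nat.le_mul_of_pos_right _ h3
  omega

/-- The factor `γ` is needed only for the term `(γ + 1) * (n + 2)` of the prime search; the
treatment of the intervals is linear in `n` alone. -/
theorem detTime_le (hn : 0 < I.n) :
    (I.detTime : ℝ) ≤ (2000 : ℕ) * (12.8 : ℝ) ^ I.k * I.γ * I.n := by
  have hγ : 0 < I.γ := (I.col ⟨0, hn⟩).pos
  have h1 := intervalCost_le I.k
  have hk : I.k ≤ 8 ^ I.k := (Nat.lt_pow_self (by omega)).le
  have h8 : 1 ≤ 8 ^ I.k := Nat.one_le_pow _ _ (by omega)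
  have key : I.detTime ≤ 2000 * 8 ^ I.k * I.γ * I.n := by
    have e : 2000 * 8 ^ I.k * I.γ * I.n = 2000 * (8 ^ I.k * (I.γ * I.n)) := by ring
    rw [e, detTime]
    set A := 8 ^ I.k
    have hγn : I.n ≤ I.γ * I.n := Nat.le_mul_of_pos_left _ hγ
    have h2 : I.γ * I.n ≤ A * (I.γ * I.n) := Nat.le_mul_of_pos_left _ h8
    have h3 : A ≤ A * (I.γ * I.n) := Nat.le_mul_of_pos_right _ (by positivity)
    have h4 : (I.γ + 1) * (I.n + 2) ≤ (2 * I.γ) * (3 * I.n) := Nat.mul_le_mul (by omega) (by omega)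
    have h5 : (2 * I.γ) * (3 * I.n) = 6 * (I.γ * I.n) := by ring
    have h6 : I.n * (intervalCost I.k + 10) ≤ (I.γ * I.n) * (420 * A) :=
      Nat.mul_le_mul hγn (by omega)
    have h7 : (I.γ * I.n) * (420 * A) = 420 * (A * (I.γ * I.n)) := by ring
    omega
  calc (I.detTime : ℝ) ≤ ((2000 * 8 ^ I.k * I.γ * I.n : ℕ) : ℝ) := by exact_mod_cast key
    _ = (2000 : ℕ) * (8 : ℝ) ^ I.k * I.γ * I.n := by push_cast; ring
    _ ≤ _ := by gcongr; norm_num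

theorem deterministic :
    ∃ (P : WordRAM.Program) (C : ℕ), P.IsDeterministic ∧
      ∀ (I : JobIntervalSelection), 0 < I.n →
      ∀ w : ℕ, C * (I.k + Nat.clog 2 (I.n + I.γ + 1)) ≤ w →
      ∃ t : ℕ,
        (t : ℝ) ≤ C * (12.8 : ℝ) ^ I.k * I.γ * I.n ∧
        WordRAM.HaltsWithin P w I.encode t ∧
        ∀ σ ∈ (WordRAM.run P w I.encode t).support, (σ.status = .accepted ↔ I.IsYes) := by
  classical
  refine ⟨detAlg.program, 2000, Cmd.Det.isDeterministic ?_, fun I hn w hw => ?_⟩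
  · simp [detAlg, detInit, numberColors, findPrime, divisorLoop, addIntervals, addInterval,
      powersLoop, addProducts, addProduct, mulVec, mulEntry, reduce, reduceEntry, elim, moveVec,
      Cmd.Det, Cmd.set]
  · have hΓ := detEnv_of_le hn (le_trans (Nat.mul_le_mul_right _ (by norm_num)) hw)
    obtain ⟨h1, -, h3, -⟩ := (detAlg_spec hΓ).good.run
    refine ⟨_, detTime_le hn, h1, fun σ hσ => ⟨fun hacc => h3 σ hσ hacc, fun hyes => ?_⟩⟩
    have hgood := (detAlg_spec hΓ).good
    rw [if_pos hyes] at hgood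
    exact hgood.accepted_of_one σ hσ

end JobIntervalSelection

theorem mainTheorem2 :
    -- the randomized algorithm
    (∃ (P : WordRAM.Program) (C : ℕ),
      ∀ (I : JobIntervalSelection), 0 < I.n → ∀ ε : ℝ, 0 < ε → ε < 1 →
      ∀ w : ℕ, C * (I.k + Nat.clog 2 (I.n + I.γ + ⌈1 / ε⌉₊ + 1)) ≤ w →
      ∃ t s : ℕ,
        (t : ℝ) ≤ C * (5.5 : ℝ) ^ I.k * max 1 |Real.log ε| * I.n ∧
        s ≤ C * 2 ^ I.k * (I.rep.maxLength + 1) ∧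
        WordRAM.HaltsWithin P w (⌈1 / ε⌉₊ :: I.encode) t ∧
        WordRAM.SpaceWithin P w (⌈1 / ε⌉₊ :: I.encode) s ∧
        (¬ I.IsYes → WordRAM.acceptProb P w (⌈1 / ε⌉₊ :: I.encode) t = 0) ∧
        (I.IsYes →
          ENNReal.ofReal (1 - ε) ≤ WordRAM.acceptProb P w (⌈1 / ε⌉₊ :: I.encode) t)) ∧
    -- the deterministic algorithm
    (∃ (P : WordRAM.Program) (C : ℕ), P.IsDeterministic ∧
      ∀ (I : JobIntervalSelection), 0 < I.n →
      ∀ w : ℕ, C * (I.k + Nat.clog 2 (I.n + I.γ + 1)) ≤ w →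
      ∃ t : ℕ,
        (t : ℝ) ≤ C * (12.8 : ℝ) ^ I.k * I.γ * I.n ∧
        WordRAM.HaltsWithin P w I.encode t ∧
        ∀ σ ∈ (WordRAM.run P w I.encode t).support, (σ.status = .accepted ↔ I.IsYes)) := by
  exact ⟨JobIntervalSelection.randomized, JobIntervalSelection.deterministic⟩
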